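/- **Conventions.** Ports, roles $p,q,r,s$, message labels $\ell$ and recursion variables $X$ are names. There is a set of values, and every value $v$ has a basic type $\mathrm{ty}(v)$. Every function symbol $f$ is a total function on lists of values with a function type $\tilde b\to b$: if the arguments have types $\tilde b$, the result has type $b$. **Components.** A *base component* $[\tilde x>\tilde y]\{L\}$ has a list $L$ of local binders $y=f(\tilde x^{y})\langle\tilde\sigma^{y}$; the queue $\tilde\sigma^{y}$ is a list of partial maps from ports to values, oldest first. A *composite component* $[\tilde x>\tilde y]\{G;r_1=K_1,\dots,r_n=K_n;D;r[F]\}$ has a protocol $G$, subcomponents $K_i$ with roles $r_i$, distribution binders $q.x\xleftarrow{\ell}p.y$ in $D$ (label $\ell$ leaves $p$ on port $y$ and enters $q$ on port $x$), an interfacing role $r$, and forwarders in $F$: $z\leftarrow x$ (outer input $x$ to inner port $z$) and $y\leftarrow z$ (inner output $z$ to outer port $y$). $F^i$ and $F^o$ are the sets of inner input and inner output ports in $F$. Protocols are $G::=p\xrightarrow{\ell}\tilde q;G\mid\mu X.G\mid X\mid\mathbf{end}$ ($\tilde q$ a finite set of roles), and at runtime also $\ell\langle v\rangle\rightsquigarrow\tilde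 q;G$ (a message still to be received by $\tilde q$). **Component semantics.** *Protocols* (asynchronous): $p\xrightarrow{\ell}\tilde q;G$ does $p!\ell\langle v\rangle$ and becomes $\ell\langle v\rangle\rightsquigarrow\tilde q;G$; for $q\in\tilde q$, $\ell\langle v\rangle\rightsquigarrow\tilde q;G$ does $q?\ell\langle v\rangle$ and becomes $\ell\langle v\rangle\rightsquigarrow\tilde q\setminus\{q\};G$ (which is $G$ if no receiver is left); $\mu X.G$ does what $G\{\mu X.G/X\}$ does; and $G$ may act under a leading communication or message in transit when the acting role is not one of its (remaining) participants. *Base*: on $x?v$ with $x\in\tilde x$, each local binder that uses $x$ stores $v$ for $x$ in its oldest map without an entry for $x$ (or in a new youngest map), and the others discard it; on $y!v$ with $y\in\tilde y$, one binder for $y$ whose oldest map is defined on all its parameters removes that map and emits the value of $f$ (a binder without parameters can always emit). *Composite*: an input $x?v$, $x\in\tilde x$, is an input $z?v$ of a subcomponent with role $r$, where $z\leftarrow x$ is in $F$; an output $y!v$, $y\in\tilde y$, is an output $z!v$ of such a subcomponent, where $y\leftarrow z$ is in $F$; a $\tau$ step is a $\tau$ step of a subcomponent, or an output $y!v$ of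 $K_i$ together with $r_i!\ell\langle v\rangle$ of $G$, where $D$ lets $\ell$ leave $r_i$ on $y$, or an input $x?v$ of $K_i$ together with $r_i?\ell\langle v\rangle$ of $G$, where $D$ lets $\ell$ enter $r_i$ on $x$. **Runtime components.** A component is *initial* if at every level of nesting: the interface ports are pairwise distinct; all queues are empty; protocols have no message in transit, nonempty receiver sets, no repeated label and at most one recursion, and in each $\mu X.G$ the variable $X$ occurs free in $G$; the roles of subcomponents are distinct; a label has at most one port per sending and per receiving role, and a sending (receiving) port of a role has at most one label; the inner ports in $F$ are distinct, and so are the outer ports; no port that $D$ assigns to $r$ is an inner port in $F$. A *runtime component* is one reachable from an initial component by any finite sequence of steps. **Types.** $T=\langle X_b;\mathbf C\rangle$: $X_b$ is a set of typed input ports $x(b)$ and $\mathbf C$ a set of constraints $y(b):\mathbf B:\mathbf D$, at most one for each port, with $\mathbf B\in\mathbb N\cup\{\infty\}$ and $\mathbf D$ a set of dependencies $x:N$ ($N\in\mathbb N$, per each value) or $x:\Omega$ (initial), at most one for each $x$. Steps: $T\xrightarrow{\tau}T$. If $x(b)\in X_b$, then $T\xrightarrow{x?(b)}T'$, where in every constraint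 $x:\Omega$ is removed and $x:N$ becomes $x:N+1$. If $y(b):\mathbf B:\mathbf D$ is in $\mathbf C$, $\mathbf B>0$ and $\mathbf D$ has only dependencies $x:N$ with $N\ge1$, then $T\xrightarrow{y!(b)}T'$, where $\mathbf B$ and all numbers $N$ in this constraint decrease by $1$ ($\infty-1=\infty$). Modified types have the same rules, with $N\in\mathbb N\cup\{\infty\}$. $\mathcal T(F,T)$ replaces $x:N$ by $x:\infty$ and deletes $x:\Omega$, for every $x\in F^i$. **Local protocols.** $LP::=x?{:}b.LP\mid y!{:}b.LP\mid\mu X.LP\mid X\mid\mathbf{end}$. With $\gamma$ a map from labels to basic types, the projection of $G$ to a role $s$ keeps $\mu X$, $X$ and $\mathbf{end}$, turns the sending (reception) of $\ell$ by $s$ into $y!{:}\gamma(\ell)$ ($x?{:}\gamma(\ell)$) with the port given by $D$, and skips communications without $s$; a message in transit counts as a reception by its remaining receivers, and its value has to have type $\gamma(\ell)$. $\mathit{fp}(LP)$ is the set of ports in $LP$, $\mathit{rep}(LP)$ the set of those under a recursion. Contexts $\mathcal C$ are sequences of inputs and outputs without recursion. Put - $y'\diamond_1x'$ if $LP=\mathcal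 C[y'!{:}b'.\mathcal C'[x'?{:}b.LP']]$ and $x',y'\notin\mathit{rep}(LP)$; - $y'\diamond_2x'$ if $LP=\mathcal C[y'!{:}b'.\mathcal C'[\mu X.\mathcal C''[x'?{:}b.LP']]]$ and $y'\notin\mathit{rep}(LP)$; - $y'\diamond_3x'$ if $LP=\mathcal C[\mu X.\mathcal C'[y'!{:}b'.\mathcal C''[x'?{:}b.LP']]]$; - $\mathit{vf}(x',y')=1$ if $y'\diamond_3x'$ and $LP=\mathcal C[x'?{:}b.LP']$ for some $\mathcal C$ without $x',y'$; otherwise $\mathit{vf}(x',y')=0$. **Conformance** $\Gamma\vdash\mathcal T\bowtie LP$ is the least relation such that: $\mathcal T\bowtie x?{:}b.LP$ if $\mathcal T\xrightarrow{x?(b)}\mathcal T'$ and $\mathcal T'\bowtie LP$; $\mathcal T\bowtie y!{:}b.LP$ if $\mathcal T\xrightarrow{y!(b)}\mathcal T'$ and $\mathcal T'\bowtie LP$ (same $\Gamma$); $\mathcal T\bowtie\mathbf{end}$; $\Gamma\vdash\mathcal T\bowtie X$ if $\Gamma(X)$ evolves to $\mathcal T$ by finitely many (possibly no) inputs; $\Gamma\vdash\mathcal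 T\bowtie\mu X.LP$ if $\Gamma,X{:}\mathcal T\vdash\mathcal T\bowtie LP$. **Typing** $K\Downarrow T$ is defined inductively. *Base.* $[\tilde x>\tilde y]\{L\}\Downarrow T$ if $L$ has exactly one local binder for each port of $\tilde y$ and no others, and for some map $\gamma$ from ports to basic types, every binder $y=f(\tilde x^y)\langle\tilde\sigma^y$ has parameters in $\tilde x$ and function type $\gamma(\tilde x^y)\to\gamma(y)$, each stored value has the type of its port, and $$T=\langle\{x(\gamma(x))\mid x\in\tilde x\};\{y(\gamma(y)):\infty:\{x:\mathit{count}(x,\tilde\sigma^y)\mid x\in\tilde x^y\}\mid y\in\tilde y\}\rangle.$$ Here $\mathit{count}(x,\tilde\sigma)$ is the length of the longest initial segment of maps defined at $x$ if no later map is defined at $x$, and $0$ otherwise. *Composite.* $[\tilde x>\tilde y]\{G;r_1=K_1,\dots,r_n=K_n;D;r[F]\}\Downarrow T$ if for some $T_1,\dots,T_n$, $LP_1,\dots,LP_n$ and one $\gamma$: $K_i\Downarrow T_i$ and $LP_i$ is the projection of $G$ to $r_i$, for all $i$; $\emptyset\vdash\mathcal T(F,T_i)\bowtie LP_i$ if $r_i=r$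 and $\emptyset\vdash T_i\bowtie LP_i$ otherwise, for all $i$; and for some $k$ with $r_k=r$, $T$ is extracted from $T_k=\langle X_b;\mathbf C\rangle$ and $LP=LP_k$ as follows, up to renaming of inner ports to outer ports along $F$. The inputs are the $x(b)\in X_b$ with $x\in F^i$. Each constraint $y(b):\mathbf B:\mathbf D$ of $\mathbf C$ with $y\in F^o$ yields a constraint $y(b):\mathbf B^*:\mathbf D^*$. - $\mathbf B^*$ is the minimum of $\mathbf B$; all $N$ with $(x':N)\in\mathbf D$ and $x'\notin\mathit{fp}(LP)\cup F^i$; $0$ if some $(x':\Omega)\in\mathbf D$ has $x'\notin\mathit{fp}(LP)\cup F^i$; and all $N+1$ with $(x':N)\in\mathbf D$, $x'\in\mathit{fp}(LP)$ and $x'\notin\mathit{rep}(LP)\cup F^i$. - Collect the direct dependencies $(x:M)\in\mathbf D$ with $x\in F^i$ and the following transitive ones, for all $(x':M')\in\mathbf D$ and all $(x:M)$ with $x\in F^i$ in the constraint of another port $y'\neq y$: $x:\Omega$ if $y'\diamond_1x'$ or $y'\diamond_2x'$, and not $M>0$ (that is, $M=\Omega$ or $M=0$); $x:\Omega$ if $y'\diamond_3x'$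 and either $M=\Omega$, or $M'=\Omega$, $M=0$ and $\mathit{vf}(x',y')=0$; $x:(N+N'+\mathit{vf}(x',y'))$ if $y'\diamond_3x'$, $M=N$ and $M'=N'$. $\mathbf D^*$ is this collection without each $x:\Omega$ for which some $x:N$ is also collected. All $N$ collected for the same $x$ have to agree; otherwise no type is extracted. **Theorem (Subject Reduction).** Let $K$ be a runtime component, base or composite, with $K\Downarrow T$, and let $K\xrightarrow{\lambda}K'$, where $\lambda$ is $x?v$, $y!v$ or $\tau$. If $\lambda=x?v$ and $T$ declares a type for $x$, assume that it is the basic type of $v$. Then there is $T'$ with $T\xrightarrow{\lambda(b)}T'$ and $K'\Downarrow T'$, where $\lambda(b)$ is $x?(b)$, $y!(b)$ or $\tau$ respectively and $b=\mathrm{ty}(v)$ is the basic type of $v$. -/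

import Mathlib

namespace GC

universe u v w

/-! ## Names, labels, values -/

/-- Names are drawn from countably infinite sets. -/
abbrev Port := ℕ
abbrev Role := ℕ
abbrev Label := ℕ
abbrev RecVar := ℕ

/-- Observable labels, carrying `α`: values for components (`x?v`, `y!v`, `τ`), basic types for
types (`x?(b)`, `y!(b)`, `τ`). -/
inductive Act (α : Type u) : Type u
  | inp (x : Port) (a : α)
  | out (y : Port) (a : α)
  | tau

/-- From `λ(v)` to `λ(b)`, where `b` is the basic type of `v`. -/
def Act.map {α : Type u} {β : Type v} (f : α → β) : Act α → Act β
  | .inp x a => .inp x (f a)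
  | .out y a => .out y (f a)
  | .tau => .tau

section Syntax_of_components

variable {V : Type u} {B : Type v}

/-- A total function on values together with its function type `dom → cod`; `ty` gives the basic
type of each value. -/
structure FunSym (ty : V → B) where
  dom : List B
  cod : B
  eval : List V → V
  eval_ty : ∀ vs, vs.map ty = dom → ty (eval vs) = cod

/-- A partial mapping from input ports to values. -/
abbrev Store (V : Type u) := Port → Option V

/-- The (runtime) local binder `out = fn(params) < queue`; the oldest store comes first. -/
structure LocalBinder (ty : V → B) where
  out : Port
  params : List Port
  fn : FunSym ty
  queue : List (Store V)

/-- Choice-free global protocols. `msg l v qs G` is a runtime term: the message `l` carrying `v` has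
been sent and is still to be received by the roles `qs`. -/
inductive Global (V : Type u) : Type u
  | comm (p : Role) (l : Label) (qs : Finset Role) (G : Global V)
  | msg (l : Label) (v : V) (qs : Finset Role) (G : Global V)
  | mu (X : RecVar) (G : Global V)
  | var (X : RecVar)
  | done

/-- The distribution binder `rcv.rcvPort ←(label)- snd.sndPort`. -/
structure DBinder where
  label : Label
  rcv : Role
  rcvPort : Port
  snd : Role
  sndPort : Port

/-- Forwarders: `inp z x` is `z ← x` (the outer input port `x` feeds the inner port `z`) and
`out y z` is `y ← z` (the inner output port `z` feeds the outer port `y`). -/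
inductive Fwd
  | inp (z x : Port)
  | out (y z : Port)

/-- Components: base `[xs > ys]{L}` and composite
`[xs > ys]{G; role 0 = sub 0, …, role (n-1) = sub (n-1); D; r[F]}`. -/
inductive Component (ty : V → B) : Type (max u v)
  | base (xs ys : List Port) (L : List (LocalBinder ty))
  | composite (xs ys : List Port) (G : Global V) (n : ℕ) (role : Fin n → Role)
      (sub : Fin n → Component ty) (D : List DBinder) (r : Role) (F : List Fwd)

end Syntax_of_components

def Fwd.inner : Fwd → Port
  | .inp z _ => z
  | .out _ z => z

def Fwd.outer : Fwd → Port
  | .inp _ x => x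
  | .out y _ => y

/-- The inner input ports `Fⁱ` mentioned in the forwarders. -/
def innerIn (F : List Fwd) : List Port :=
  F.filterMap fun f => match f with
    | .inp z _ => some z
    | .out _ _ => none

/-- The inner output ports `Fᵒ` mentioned in the forwarders. -/
def innerOut (F : List Fwd) : List Port :=
  F.filterMap fun f => match f with
    | .inp _ _ => none
    | .out _ z => some z

/-- Messages `l` are emitted by role `p` on port `y`. -/
def SendsOn (D : List DBinder) (p : Role) (l : Label) (y : Port) : Prop :=
  ∃ d ∈ D, d.label = l ∧ d.snd = p ∧ d.sndPort = y

/-- Messages `l` are received by role `q` on port `x`. -/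
def RecvsOn (D : List DBinder) (q : Role) (l : Label) (x : Port) : Prop :=
  ∃ d ∈ D, d.label = l ∧ d.rcv = q ∧ d.rcvPort = x

/-! ## Operational semantics of components -/

section Semantics

variable {V : Type u} {B : Type v} {ty : V → B}

/-- Store `v` for `x` in the oldest store without an entry for `x`, or else in a new youngest
store. -/
def enqueue (x : Port) (v : V) : List (Store V) → List (Store V)
  | [] => [fun p => if p = x then some v else none]
  | σ :: q => if σ x = none then Function.update σ x (some v) :: q else σ :: enqueue x v q

/-- Effect of an input on a local binder: values on ports that are not used are discarded. -/
def LocalBinder.recv (b : LocalBinder ty) (x : Port) (v : V) : LocalBinder ty :=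
  if x ∈ b.params then { b with queue := enqueue x v b.queue } else b

/-- `b.Emit v b'`: the binder `b` outputs `v` on its port and becomes `b'`. The oldest store has to
be complete; a function without parameters needs no stored value. -/
inductive LocalBinder.Emit : LocalBinder ty → V → LocalBinder ty → Prop
  | nullary (b : LocalBinder ty) : b.params = [] → Emit b (b.fn.eval []) b
  | complete (b : LocalBinder ty) (σ : Store V) (q : List (Store V)) (vs : List V) :
      b.params ≠ [] → b.queue = σ :: q → b.params.map σ = vs.map some →
      Emit b (b.fn.eval vs) { b with queue := q }

/-- Transitions of lists of local binders: all of them react to an input, a single one outputs. -/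
inductive BindersStep : List (LocalBinder ty) → Act V → List (LocalBinder ty) → Prop
  | inp (L : List (LocalBinder ty)) (x : Port) (v : V) :
      BindersStep L (.inp x v) (L.map fun b => b.recv x v)
  | out (L₁ L₂ : List (LocalBinder ty)) (b b' : LocalBinder ty) (v : V) :
      b.Emit v b' → BindersStep (L₁ ++ b :: L₂) (.out b.out v) (L₁ ++ b' :: L₂)

/-- `G.subst X H` is `G` with `H` in place of the free occurrences of `X`. -/
def Global.subst (X : RecVar) : Global V → Global V → Global V
  | .comm p l qs G, H => .comm p l qs (G.subst X H)
  | .msg l v qs G, H => .msg l v qs (G.subst X H)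
  | .mu Y G, H => if Y = X then .mu Y G else .mu Y (G.subst X H)
  | .var Y, H => if Y = X then H else .var Y
  | .done, _ => .done

/-- Protocol labels `p!l⟨v⟩` and `q?l⟨v⟩`. -/
inductive GAct (V : Type u) : Type u
  | snd (p : Role) (l : Label) (v : V)
  | rcv (q : Role) (l : Label) (v : V)

/-- The role that acts. -/
def GAct.subj : GAct V → Role
  | .snd p _ _ => p
  | .rcv q _ _ => q

/-- A message in transit that nobody has to receive any more disappears. -/
def Global.transit (l : Label) (v : V) (qs : Finset Role) (G : Global V) : Global V :=
  if qs = ∅ then G else .msg l v qs G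

/-- Asynchronous protocol semantics: sending and the receptions are separate steps, and an action of
a role that does not take part in the leading communication may happen before it. -/
inductive Global.Step : Global V → GAct V → Global V → Prop
  | snd (p : Role) (l : Label) (qs : Finset Role) (G : Global V) (v : V) :
      Step (.comm p l qs G) (.snd p l v) (.msg l v qs G)
  | rcv (q : Role) (l : Label) (v : V) (qs : Finset Role) (G : Global V) :
      q ∈ qs → Step (.msg l v qs G) (.rcv q l v) (Global.transit l v (qs.erase q) G)
  | unfold (X : RecVar) (G G' : Global V) (a : GAct V) :
      Step (G.subst X (.mu X G)) a G' → Step (.mu X G) a G'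
  | underComm (p : Role) (l : Label) (qs : Finset Role) (G G' : Global V) (a : GAct V) :
      a.subj ≠ p → a.subj ∉ qs → Step G a G' → Step (.comm p l qs G) a (.comm p l qs G')
  | underMsg (l : Label) (v : V) (qs : Finset Role) (G G' : Global V) (a : GAct V) :
      a.subj ∉ qs → Step G a G' → Step (.msg l v qs G) a (.msg l v qs G')

/-- The transition relation of components. -/
inductive Component.Step : Component ty → Act V → Component ty → Prop
  | outBase (xs ys : List Port) (L L' : List (LocalBinder ty)) (y : Port) (v : V) :
      BindersStep L (.out y v) L' → y ∈ ys → Step (.base xs ys L) (.out y v) (.base xs ys L')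
  | inpBase (xs ys : List Port) (L L' : List (LocalBinder ty)) (x : Port) (v : V) :
      BindersStep L (.inp x v) L' → x ∈ xs → Step (.base xs ys L) (.inp x v) (.base xs ys L')
  | outComp (xs ys : List Port) (G : Global V) (n : ℕ) (role : Fin n → Role)
      (sub : Fin n → Component ty) (D : List DBinder) (r : Role) (F : List Fwd)
      (i : Fin n) (K' : Component ty) (y z : Port) (v : V) :
      role i = r → Step (sub i) (.out z v) K' → Fwd.out y z ∈ F → y ∈ ys →
      Step (.composite xs ys G n role sub D r F) (.out y v)
        (.composite xs ys G n role (Function.update sub i K') D r F)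
  | inpComp (xs ys : List Port) (G : Global V) (n : ℕ) (role : Fin n → Role)
      (sub : Fin n → Component ty) (D : List DBinder) (r : Role) (F : List Fwd)
      (i : Fin n) (K' : Component ty) (x z : Port) (v : V) :
      role i = r → Step (sub i) (.inp z v) K' → Fwd.inp z x ∈ F → x ∈ xs →
      Step (.composite xs ys G n role sub D r F) (.inp x v)
        (.composite xs ys G n role (Function.update sub i K') D r F)
  | internal (xs ys : List Port) (G : Global V) (n : ℕ) (role : Fin n → Role)
      (sub : Fin n → Component ty) (D : List DBinder) (r : Role) (F : List Fwd)
      (i : Fin n) (K' : Component ty) :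
      Step (sub i) .tau K' →
      Step (.composite xs ys G n role sub D r F) .tau
        (.composite xs ys G n role (Function.update sub i K') D r F)
  | outChor (xs ys : List Port) (G G' : Global V) (n : ℕ) (role : Fin n → Role)
      (sub : Fin n → Component ty) (D : List DBinder) (r : Role) (F : List Fwd)
      (i : Fin n) (K' : Component ty) (y : Port) (l : Label) (v : V) :
      Step (sub i) (.out y v) K' → SendsOn D (role i) l y → G.Step (.snd (role i) l v) G' →
      Step (.composite xs ys G n role sub D r F) .tau
        (.composite xs ys G' n role (Function.update sub i K') D r F)
  | inpChor (xs ys : List Port) (G G' : Global V) (n : ℕ) (role : Fin n → Role)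
      (sub : Fin n → Component ty) (D : List DBinder) (r : Role) (F : List Fwd)
      (i : Fin n) (K' : Component ty) (x : Port) (l : Label) (v : V) :
      Step (sub i) (.inp x v) K' → RecvsOn D (role i) l x → G.Step (.rcv (role i) l v) G' →
      Step (.composite xs ys G n role sub D r F) .tau
        (.composite xs ys G' n role (Function.update sub i K') D r F)

/-! ## Initial (static) components and runtime components -/

def Global.labels : Global V → List Label
  | .comm _ l _ G => l :: G.labels
  | .msg l _ _ G => l :: G.labels
  | .mu _ G => G.labels
  | .var _ => []
  | .done => []

def Global.recCount : Global V → ℕ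
  | .comm _ _ _ G => G.recCount
  | .msg _ _ _ G => G.recCount
  | .mu _ G => G.recCount + 1
  | .var _ => 0
  | .done => 0

/-- The variable `X` occurs free. -/
def Global.Occurs (X : RecVar) : Global V → Prop
  | .comm _ _ _ G => G.Occurs X
  | .msg _ _ _ G => G.Occurs X
  | .mu Y G => Y ≠ X ∧ G.Occurs X
  | .var Y => Y = X
  | .done => False

/-- No message is in transit, receivers are nonempty, and every recursion recurs. -/
def Global.Static : Global V → Prop
  | .comm _ _ qs G => qs.Nonempty ∧ G.Static
  | .msg _ _ _ _ => False
  | .mu X G => G.Occurs X ∧ G.Static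
  | .var _ => True
  | .done => True

/-- Static protocols with at most one recursion and in which no message label is repeated. -/
def Global.Initial (G : Global V) : Prop :=
  G.Static ∧ G.recCount ≤ 1 ∧ G.labels.Nodup

/-- Ports are uniquely associated with message labels. -/
def UniqueBinders (D : List DBinder) : Prop :=
  ∀ d ∈ D, ∀ e ∈ D,
    (d.label = e.label → d.snd = e.snd → d.sndPort = e.sndPort) ∧
    (d.label = e.label → d.rcv = e.rcv → d.rcvPort = e.rcvPort) ∧
    (d.snd = e.snd → d.sndPort = e.sndPort → d.label = e.label) ∧
    (d.rcv = e.rcv → d.rcvPort = e.rcvPort → d.label = e.label)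

/-- All values through a port that is bound to a label travel in messages with that label, so such a
port of the interfacing role `r` is not forwarded as well. -/
def BindersApart (D : List DBinder) (r : Role) (F : List Fwd) : Prop :=
  ∀ d ∈ D, (d.snd = r → d.sndPort ∉ F.map Fwd.inner) ∧ (d.rcv = r → d.rcvPort ∉ F.map Fwd.inner)

/-- A component as a programmer writes it: all queues are empty, no message is in transit, and the
conventions on names hold, at all levels of nesting. -/
def Component.Initial : Component ty → Prop
  | .base xs ys L => (xs ++ ys).Nodup ∧ ∀ b ∈ L, b.queue = []
  | .composite xs ys G _ role sub D r F =>
      (xs ++ ys).Nodup ∧ G.Initial ∧ Function.Injective role ∧ UniqueBinders D ∧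
      (F.map Fwd.inner).Nodup ∧ (F.map Fwd.outer).Nodup ∧ BindersApart D r F ∧
      ∀ i, (sub i).Initial

/-- Runtime components: those that an initial component can reach. -/
def Component.Runtime (K : Component ty) : Prop :=
  ∃ K₀ : Component ty, K₀.Initial ∧
    Relation.ReflTransGen (fun K₁ K₂ => ∃ a, Component.Step K₁ a K₂) K₀ K

end Semantics

/-! ## Types and their semantics

Types `CType ℕ B` and modified types `CType ℕ∞ B` share syntax and rules; they differ in the numbers
of available values. A set with at most one element for each port is a partial function on ports. -/

/-- Dependency kinds: per each value with the number of available values, and initial (`Ω`). -/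
inductive Dep (N : Type u) : Type u
  | per (n : N)
  | initial

/-- A constraint `y(ty) : bound : [deps]`, for the output port `y` to which it is assigned. -/
structure Constraint (N : Type u) (B : Type v) where
  ty : B
  bound : ℕ∞
  deps : Port → Option (Dep N)

/-- A type `<inputs; con>`. -/
structure CType (N : Type u) (B : Type v) where
  inputs : Port → Option B
  con : Port → Option (Constraint N B)

section TypeSemantics

variable {N : Type u} {B : Type v} [Add N] [Sub N] [One N] [LE N]

/-- The transition `x?` of a constraint. -/
inductive Constraint.Inp (x : Port) : Constraint N B → Constraint N B → Prop
  | discard (c : Constraint N B) : c.deps x = none → Inp x c c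
  | drop (c : Constraint N B) : c.deps x = some .initial →
      Inp x c { c with deps := Function.update c.deps x none }
  | incr (c : Constraint N B) (n : N) : c.deps x = some (.per n) →
      Inp x c { c with deps := Function.update c.deps x (some (.per (n + 1))) }

/-- One available value less. -/
def Dep.decr : Dep N → Dep N
  | .per n => .per (n - 1)
  | .initial => .initial

/-- The transition relation of types. -/
inductive CType.Step : CType N B → Act B → CType N B → Prop
  | tau (T : CType N B) : Step T .tau T
  | inp (T : CType N B) (x : Port) (b : B) (C' : Port → Option (Constraint N B)) :
      T.inputs x = some b → (∀ y, Option.Rel (Constraint.Inp x) (T.con y) (C' y)) →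
      Step T (.inp x b) { T with con := C' }
  | out (T : CType N B) (y : Port) (c : Constraint N B) :
      T.con y = some c → 0 < c.bound →
      (∀ x d, c.deps x = some d → ∃ n, d = .per n ∧ 1 ≤ n) →
      Step T (.out y c.ty)
        { T with con := Function.update T.con y (some
            { c with bound := c.bound - 1, deps := fun x => (c.deps x).map Dep.decr }) }

end TypeSemantics

/-! ## Local protocols -/

inductive LocalP (B : Type v) : Type v
  | recv (x : Port) (b : B) (P : LocalP B)
  | send (y : Port) (b : B) (P : LocalP B)
  | mu (X : RecVar) (P : LocalP B)
  | var (X : RecVar)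
  | done

/-- Contexts of local protocols, without recursion. -/
inductive Ctx (B : Type v) : Type v
  | hole
  | recv (x : Port) (b : B) (C : Ctx B)
  | send (y : Port) (b : B) (C : Ctx B)

section LocalProtocols

variable {V : Type u} {B : Type v}

def Ctx.fill : Ctx B → LocalP B → LocalP B
  | .hole, P => P
  | .recv x b C, P => .recv x b (C.fill P)
  | .send y b C, P => .send y b (C.fill P)

/-- Ports of a context. -/
def Ctx.fp : Ctx B → List Port
  | .hole => []
  | .recv x _ C => x :: C.fp
  | .send y _ C => y :: C.fp

/-- Ports of a local protocol. -/
def LocalP.fp : LocalP B → List Port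
  | .recv x _ P => x :: P.fp
  | .send y _ P => y :: P.fp
  | .mu _ P => P.fp
  | .var _ => []
  | .done => []

/-- Ports that occur in a recursion. -/
def LocalP.rep : LocalP B → List Port
  | .recv _ _ P => P.rep
  | .send _ _ P => P.rep
  | .mu _ P => P.fp
  | .var _ => []
  | .done => []

/-- `y' ⋄₁ x'`: a non-repetitive output on `y'` before a non-repetitive input on `x'`. -/
def LocalP.Rel1 (P : LocalP B) (y' x' : Port) : Prop :=
  (∃ (C C' : Ctx B) (b b' : B) (Q : LocalP B),
    P = C.fill (.send y' b' (C'.fill (.recv x' b Q)))) ∧ x' ∉ P.rep ∧ y' ∉ P.rep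

/-- `y' ⋄₂ x'`: a non-repetitive output on `y'` before a repetitive input on `x'`. -/
def LocalP.Rel2 (P : LocalP B) (y' x' : Port) : Prop :=
  (∃ (C C' C'' : Ctx B) (X : RecVar) (b b' : B) (Q : LocalP B),
    P = C.fill (.send y' b' (C'.fill (.mu X (C''.fill (.recv x' b Q)))))) ∧ y' ∉ P.rep

/-- `y' ⋄₃ x'`: an output on `y'` before an input on `x'` inside the recursion. -/
def LocalP.Rel3 (P : LocalP B) (y' x' : Port) : Prop :=
  ∃ (C C' C'' : Ctx B) (X : RecVar) (b b' : B) (Q : LocalP B),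
    P = C.fill (.mu X (C'.fill (.send y' b' (C''.fill (.recv x' b Q)))))

/-- A value is flowing from `y` to `x`: the output on `y` of the recursion has been carried out and
the input on `x` is yet to occur. -/
def LocalP.Flowing (P : LocalP B) (x y : Port) : Prop :=
  P.Rel3 y x ∧ ∃ (C : Ctx B) (b : B) (Q : LocalP B),
    P = C.fill (.recv x b Q) ∧ x ∉ C.fp ∧ y ∉ C.fp

open Classical in
noncomputable def LocalP.vf (P : LocalP B) (x y : Port) : ℕ :=
  if P.Flowing x y then 1 else 0

/-- `P'` is `P` preceded by the output that role `s` has in the sending of `l` by `p`. -/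
def ProjSend (D : List DBinder) (γ : Label → B) (s p : Role) (l : Label) (P P' : LocalP B) : Prop :=
  (s = p ∧ ∃ y, SendsOn D s l y ∧ P' = .send y (γ l) P) ∨ (s ≠ p ∧ P' = P)

/-- `P'` is `P` preceded by the input that role `s` has in the reception of `l` by `qs`. -/
def ProjRecv (D : List DBinder) (γ : Label → B) (s : Role) (qs : Finset Role) (l : Label)
    (P P' : LocalP B) : Prop :=
  (s ∈ qs ∧ ∃ x, RecvsOn D s l x ∧ P' = .recv x (γ l) P) ∨ (s ∉ qs ∧ P' = P)

/-- Projection of a global protocol to the role `s`. Labels are mapped to ports by `D` and to basic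
types by `γ`; a value in transit has the type of its label. -/
inductive Proj (ty : V → B) (D : List DBinder) (γ : Label → B) (s : Role) :
    Global V → LocalP B → Prop
  | comm (p : Role) (l : Label) (qs : Finset Role) (G : Global V) (P P₁ P₂ : LocalP B) :
      Proj ty D γ s G P → ProjRecv D γ s qs l P P₁ → ProjSend D γ s p l P₁ P₂ →
      Proj ty D γ s (.comm p l qs G) P₂
  | msg (l : Label) (v : V) (qs : Finset Role) (G : Global V) (P P₁ : LocalP B) :
      ty v = γ l → Proj ty D γ s G P → ProjRecv D γ s qs l P P₁ →
      Proj ty D γ s (.msg l v qs G) P₁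
  | mu (X : RecVar) (G : Global V) (P : LocalP B) :
      Proj ty D γ s G P → Proj ty D γ s (.mu X G) (.mu X P)
  | var (X : RecVar) : Proj ty D γ s (.var X) (.var X)
  | done : Proj ty D γ s .done .done

end LocalProtocols

/-! ## Type extraction for base components -/

section BaseExtraction

variable {V : Type u} {B : Type v} {ty : V → B}

/-- Number of values available for `x`: the length `j` of the initial segment of stores defined at
`x` if no later store is defined at `x`, and `0` otherwise. -/
def count (x : Port) (q : List (Store V)) : ℕ :=
  if (q.dropWhile fun σ => (σ x).isSome).all (fun σ => (σ x).isNone) then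
    (q.takeWhile fun σ => (σ x).isSome).length
  else 0

/-- The constraint for the output port of a local binder. -/
def LocalBinder.constraint (γ : Port → B) (b : LocalBinder ty) : Constraint ℕ B where
  ty := γ b.out
  bound := ⊤
  deps x := if x ∈ b.params then some (.per (count x b.queue)) else none

/-- `γ` is consistent with the function, the ports and the stored values of a local binder. -/
def LocalBinder.Consistent (xs : List Port) (γ : Port → B) (b : LocalBinder ty) : Prop :=
  (∀ x ∈ b.params, x ∈ xs) ∧ b.fn.dom = b.params.map γ ∧ b.fn.cod = γ b.out ∧
  ∀ σ ∈ b.queue, ∀ x v, σ x = some v → ty v = γ x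

def baseType (xs : List Port) (L : List (LocalBinder ty)) (γ : Port → B) : CType ℕ B where
  inputs x := if x ∈ xs then some (γ x) else none
  con y := (L.find? fun b => b.out = y).map fun b => b.constraint γ

/-- `T` is extracted from the base component `[xs > ys]{L}`; there is one local binder for each
output port and there are no others. -/
def BaseExtracts (xs ys : List Port) (L : List (LocalBinder ty)) (T : CType ℕ B) : Prop :=
  (L.map LocalBinder.out).Perm ys ∧
  ∃ γ : Port → B, (∀ b ∈ L, b.Consistent xs γ) ∧ T = baseType xs L γ

end BaseExtraction

/-! ## Type extraction for composite components -/

section CompositeExtraction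

variable {B : Type v}

/-- Direct dependencies of the inner output port `y`. -/
def Direct (C : Port → Option (Constraint ℕ B)) (F : List Fwd) (y x : Port) (M : Dep ℕ) : Prop :=
  (∃ c, C y = some c ∧ c.deps x = some M) ∧ x ∈ innerIn F ∧ y ∈ innerOut F

/-- The common condition for transitive dependencies: `y` depends on `x'` with kind `M'`, and `y'`
depends on `x` with kind `M`, for distinct constraints, where `x` and `y` are external. -/
def Chain (C : Port → Option (Constraint ℕ B)) (F : List Fwd) (y x' y' x : Port)
    (M' M : Dep ℕ) : Prop :=
  y ≠ y' ∧ (∃ c, C y = some c ∧ c.deps x' = some M') ∧ (∃ c, C y' = some c ∧ c.deps x = some M) ∧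
  x ∈ innerIn F ∧ y ∈ innerOut F

/-- `M > 0`, which holds only for a positive number of available values. -/
def Dep.Positive (M : Dep ℕ) : Prop := ∃ n, M = .per n ∧ 0 < n

/-- Transitive dependencies of the inner output port `y`. -/
inductive Transitive (C : Port → Option (Constraint ℕ B)) (F : List Fwd) (P : LocalP B)
    (y : Port) : Port → Dep ℕ → Prop
  | once (x' y' x : Port) (M' M : Dep ℕ) :
      Chain C F y x' y' x M' M → (P.Rel1 y' x' ∨ P.Rel2 y' x') → ¬ M.Positive →
      Transitive C F P y x .initial
  | initial (x' y' x : Port) (M' M : Dep ℕ) :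
      Chain C F y x' y' x M' M → P.Rel3 y' x' →
      (M = .initial ∨ (M' = .initial ∧ M = .per 0 ∧ P.vf x' y' = 0)) →
      Transitive C F P y x .initial
  | per (x' y' x : Port) (n' n : ℕ) :
      Chain C F y x' y' x (.per n') (.per n) → P.Rel3 y' x' →
      Transitive C F P y x (.per (n + n' + P.vf x' y'))

/-- `deps` is the prioritised collection of the dependencies in `S`: per each value dependencies come
first. It exists only if for each port all collected numbers of available values agree. -/
def Prioritised (S : Port → Dep ℕ → Prop) (deps : Port → Option (Dep ℕ)) : Prop :=
  ∀ x, (∀ n, deps x = some (.per n) ↔ S x (.per n)) ∧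
    (deps x = some .initial ↔ S x .initial ∧ ∀ n, ¬ S x (.per n))

/-- The boundary of an output port whose constraint in the type of the interfacing component is
`c`. -/
noncomputable def boundary (F : List Fwd) (P : LocalP B) (c : Constraint ℕ B) : ℕ∞ :=
  sInf ({c.bound} ∪
    {m | ∃ (x' : Port) (n : ℕ), c.deps x' = some (.per n) ∧
        x' ∉ P.fp ∧ x' ∉ innerIn F ∧ m = (n : ℕ∞)} ∪
    {m | ∃ x' : Port, c.deps x' = some .initial ∧ x' ∉ P.fp ∧ x' ∉ innerIn F ∧ m = 0} ∪
    {m | ∃ (x' : Port) (n : ℕ), c.deps x' = some (.per n) ∧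
        x' ∈ P.fp ∧ x' ∉ P.rep ∧ x' ∉ innerIn F ∧ m = (n : ℕ∞) + 1})

/-- `T₁` is obtained from the type `T` of the interfacing component and its local protocol `P`,
before renaming. -/
structure InnerExtracts (F : List Fwd) (P : LocalP B) (T T₁ : CType ℕ B) : Prop where
  inputs : ∀ x, T₁.inputs x = if x ∈ innerIn F then T.inputs x else none
  con_out : ∀ y ∈ innerOut F, Option.Rel
    (fun c c₁ : Constraint ℕ B => c₁.ty = c.ty ∧ c₁.bound = boundary F P c ∧
      Prioritised (fun x M => Direct T.con F y x M ∨ Transitive T.con F P y x M) c₁.deps)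
    (T.con y) (T₁.con y)
  con_none : ∀ y, y ∉ innerOut F → T₁.con y = none

/-- `T₂` is `T₁` with the inner ports renamed to the outer ones along the forwarders. -/
structure Renames (F : List Fwd) (T₁ T₂ : CType ℕ B) : Prop where
  inputs : ∀ x b, T₂.inputs x = some b ↔ ∃ z, Fwd.inp z x ∈ F ∧ T₁.inputs z = some b
  con : ∀ y c₂, T₂.con y = some c₂ ↔ ∃ z c₁, Fwd.out y z ∈ F ∧ T₁.con z = some c₁ ∧
    c₂.ty = c₁.ty ∧ c₂.bound = c₁.bound ∧
    ∀ x M, c₂.deps x = some M ↔ ∃ w, Fwd.inp w x ∈ F ∧ c₁.deps w = some M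

/-- `T'` is the type extracted from the local protocol `P` and the type `T` of the interfacing
component. -/
def CompositeExtracts (F : List Fwd) (P : LocalP B) (T T' : CType ℕ B) : Prop :=
  ∃ T₁, InnerExtracts F P T T₁ ∧ Renames F T₁ T'

end CompositeExtraction

/-! ## Conformance -/

section Conformance

variable {B : Type v}

/-- The modified type: dependencies on the ports in `Fⁱ` are unbounded if per each value, and dropped
if initial. Without forwarders the type is merely read as a modified type. -/
def modified (F : List Fwd) (T : CType ℕ B) : CType ℕ∞ B where
  inputs := T.inputs
  con y := (T.con y).map fun c =>
    { ty := c.ty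
      bound := c.bound
      deps := fun x => match c.deps x with
        | none => none
        | some (.per n) => if x ∈ innerIn F then some (.per ⊤) else some (.per (n : ℕ∞))
        | some .initial => if x ∈ innerIn F then none else some .initial }

/-- `T' ≤ T`: the modified type `T'` evolves to `T` by inputs. -/
def CType.Le (T' T : CType ℕ∞ B) : Prop :=
  Relation.ReflTransGen (fun T₁ T₂ => ∃ x b, CType.Step T₁ (.inp x b) T₂) T' T

/-- Conformance `Γ ⊢ T ⋈ P`. -/
inductive Conforms : (RecVar → Option (CType ℕ∞ B)) → CType ℕ∞ B → LocalP B → Prop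
  | recv (Γ : RecVar → Option (CType ℕ∞ B)) (T T' : CType ℕ∞ B) (x : Port) (b : B)
      (P : LocalP B) :
      CType.Step T (.inp x b) T' → Conforms Γ T' P → Conforms Γ T (.recv x b P)
  | send (Γ : RecVar → Option (CType ℕ∞ B)) (T T' : CType ℕ∞ B) (y : Port) (b : B)
      (P : LocalP B) :
      CType.Step T (.out y b) T' → Conforms Γ T' P → Conforms Γ T (.send y b P)
  | done (Γ : RecVar → Option (CType ℕ∞ B)) (T : CType ℕ∞ B) : Conforms Γ T .done
  | var (Γ : RecVar → Option (CType ℕ∞ B)) (T T' : CType ℕ∞ B) (X : RecVar) :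
      Γ X = some T' → CType.Le T' T → Conforms Γ T (.var X)
  | mu (Γ : RecVar → Option (CType ℕ∞ B)) (T : CType ℕ∞ B) (X : RecVar) (P : LocalP B) :
      Conforms (Function.update Γ X (some T)) T P → Conforms Γ T (.mu X P)

end Conformance

/-! ## Well-typed components -/

section Typing

variable {V : Type u} {B : Type v} {ty : V → B}

/-- `K ⇓ T`. -/
inductive HasType : Component ty → CType ℕ B → Prop
  | base (xs ys : List Port) (L : List (LocalBinder ty)) (T : CType ℕ B) :
      BaseExtracts xs ys L T → HasType (.base xs ys L) T
  | composite (xs ys : List Port) (G : Global V) (n : ℕ) (role : Fin n → Role)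
      (sub : Fin n → Component ty) (D : List DBinder) (r : Role) (F : List Fwd)
      (γ : Label → B) (Ts : Fin n → CType ℕ B) (Ps : Fin n → LocalP B) (i₁ : Fin n)
      (T : CType ℕ B) :
      role i₁ = r →
      (∀ i, HasType (sub i) (Ts i)) →
      (∀ i, Proj ty D γ (role i) G (Ps i)) →
      CompositeExtracts F (Ps i₁) (Ts i₁) T →
      (∀ i, Conforms (fun _ => none) (modified (if role i = r then F else []) (Ts i)) (Ps i)) →
      HasType (.composite xs ys G n role sub D r F) T

end Typing

end GC

/-! An action determines the target of a type step, so the candidate for $T'$ is known in advance,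
and what has to be shown is that the new component has this type. For a base component the reason is
an invariant of the queues: for each port, the stores with an entry for it form an initial segment.
Then `count` is an honest counter, which an input raises by one and an emission lowers by one
(`base_step`).

For a composite component both conformance and extraction have to survive. A runtime protocol has
the normal form of a sequence of communications and messages followed by a fixed tail, and a
protocol step edits one item of that sequence after some unfolding of the recursion
(`Global.Step.items`). Each role sees a word of events. Conformance says that its modified type can
run this word and then the body of the recursion, coming back to the same type up to extra inputs
(`conforms_iff`). It is stable because steps of modified types commute, except for two outputs on
one port (`CType.step_diamond`), and because forwarded inputs do not change a modified type at all.

Extraction rests on a conservation law. If `y` depends on `x'`, if `y'` precedes `x'` in the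
recursion, and if `y'` depends on `x`, then $N+N'+\mathit{vf}$ counts the values of `x` that are
available for `y'`, those already passed on to `y`, and the one in between. An internal output on
`y'` moves a unit from $N$ to $\mathit{vf}$, and an internal input on `x'` moves it from
$\mathit{vf}$ to $N'$; hence the extracted type does not change (`Interface.extracts_send`,
`Interface.extracts_recv`). The $N+1$ in the boundary plays the same part for inputs that occur
once. A forwarded input raises $N$ and a forwarded output lowers $N'$, which are the steps of the
extracted type (`Interface.extracts_input`, `Interface.extracts_output`).

Initial dependencies obey no such law by themselves. One has to know that a positive number comes
from an earlier input, and that a port which has already emitted has no initial dependency left.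
These facts concern the past and are where reachability from an initial component enters once more.
They are proved by induction on nesting in `Trace.typeHistory`, with the combinatorics of unrolled
words (`Unrolled`) deciding which protocol events have happened and which are pending. -/

namespace GC

universe u v

/-! ### Steps of types as functions -/

section
variable {N : Type u} {B : Type v}

/-- The value `none` stands for the removal of an initial dependency, so that a single `bind` covers
all rules for an input. -/
def Dep.incr [Add N] [One N] : Dep N → Option (Dep N)
  | .per n => some (.per (n + 1))
  | .initial => none

def Constraint.input [Add N] [One N] (x : Port) (c : Constraint N B) : Constraint N B :=
  { c with deps := fun z => if z = x then (c.deps z).bind Dep.incr else c.deps z }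

def CType.input [Add N] [One N] (x : Port) (T : CType N B) : CType N B :=
  { T with con := fun y => (T.con y).map (Constraint.input x) }

def Constraint.output [Sub N] [One N] (c : Constraint N B) : Constraint N B :=
  { c with bound := c.bound - 1, deps := fun x => (c.deps x).map Dep.decr }

def CType.output [Sub N] [One N] (y : Port) (T : CType N B) : CType N B :=
  { T with con := Function.update T.con y ((T.con y).map Constraint.output) }

def Constraint.Ready [One N] [LE N] (c : Constraint N B) : Prop :=
  0 < c.bound ∧ ∀ x d, c.deps x = some d → ∃ n, d = .per n ∧ 1 ≤ n

/-- The three rules for an input exclude one another and cover every case, so the relation is the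
graph of a function. -/
theorem Constraint.inp_iff [Add N] [One N] (x : Port) (c c' : Constraint N B) :
    Constraint.Inp x c c' ↔ c' = c.input x := by
  constructor
  · intro h
    cases h with
    | discard h =>
      obtain ⟨t, b, d⟩ := c
      simp only [input, Constraint.mk.injEq, true_and]
      funext z
      split_ifs with hz
      · subst hz; simp_all
      · rfl
    | drop h =>
      simp only [input, Constraint.mk.injEq, true_and]
      funext z
      by_cases hz : z = x
      · subst hz; simp [h, Dep.incr]
      · simp [hz]
    | incr n h =>
      simp only [input, Constraint.mk.injEq, true_and]
      funext z
      by_cases hz : z = x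
      · subst hz; simp [h, Dep.incr]
      · simp [hz]
  · rintro rfl
    rcases h : c.deps x with _ | (n | _)
    · have : c.input x = c := by
        obtain ⟨t, b, d⟩ := c
        simp only [input, Constraint.mk.injEq, true_and]
        funext z
        split_ifs with hz
        · subst hz; simp_all
        · rfl
      rw [this]; exact .discard c h
    · have : c.input x = { c with deps := Function.update c.deps x (some (.per (n + 1))) } := by
        simp only [input, Constraint.mk.injEq, true_and]
        funext z
        by_cases hz : z = x
        · subst hz; simp [h, Dep.incr]
        · simp [hz]
      rw [this]; exact .incr c n h
    · have : c.input x = { c with deps := Function.update c.deps x none } := by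
        simp only [input, Constraint.mk.injEq, true_and]
        funext z
        by_cases hz : z = x
        · subst hz; simp [h, Dep.incr]
        · simp [hz]
      rw [this]; exact .drop c h

variable [Add N] [Sub N] [One N] [LE N]

theorem CType.step_inp_iff (T T' : CType N B) (x : Port) (b : B) :
    CType.Step T (.inp x b) T' ↔ T.inputs x = some b ∧ T' = T.input x := by
  constructor
  · intro h
    cases h with
    | inp _ _ C' h1 h2 =>
      refine ⟨h1, ?_⟩
      simp only [input, CType.mk.injEq, true_and]
      funext y
      have := h2 y
      generalize T.con y = o, C' y = o' at this
      cases this with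
      | none => rfl
      | some h => rw [(Constraint.inp_iff _ _ _).1 h]; rfl
  · rintro ⟨h1, rfl⟩
    refine .inp T x b _ h1 fun y => ?_
    cases h : T.con y with
    | none => exact .none
    | some c => exact .some ((Constraint.inp_iff _ _ _).2 rfl)

theorem CType.step_out_iff (T T' : CType N B) (y : Port) (b : B) :
    CType.Step T (.out y b) T' ↔
      ∃ c, T.con y = some c ∧ c.ty = b ∧ c.Ready ∧ T' = T.output y := by
  constructor
  · intro h
    generalize ha : Act.out y b = a at h
    cases h with
    | tau => cases ha
    | inp => cases ha
    | out z c h1 h2 h3 =>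
      cases ha
      exact ⟨c, h1, rfl, ⟨h2, h3⟩, by simp [output, h1, Constraint.output]⟩
  · rintro ⟨c, h1, rfl, ⟨h2, h3⟩, rfl⟩
    have := CType.Step.out T y c h1 h2 h3
    simpa [output, h1, Constraint.output] using this

theorem CType.step_tau_iff (T T' : CType N B) : CType.Step T .tau T' ↔ T' = T := by
  constructor
  · intro h; cases h; rfl
  · rintro rfl; exact .tau _

theorem CType.Step.deterministic {T T₁ T₂ : CType N B} {a : Act B}
    (h₁ : CType.Step T a T₁) (h₂ : CType.Step T a T₂) : T₁ = T₂ := by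
  cases a with
  | inp x b => rw [step_inp_iff] at h₁ h₂; rw [h₁.2, h₂.2]
  | out y b =>
    rw [step_out_iff] at h₁ h₂
    obtain ⟨_, _, _, _, rfl⟩ := h₁
    obtain ⟨_, _, _, _, rfl⟩ := h₂
    rfl
  | tau => rw [step_tau_iff] at h₁ h₂; rw [h₁, h₂]

end

theorem Constraint.input_comm {N : Type u} {B : Type v} [Add N] [One N] (x x' : Port) (c : Constraint N B) :
    (c.input x).input x' = (c.input x').input x := by
  simp only [input, Constraint.mk.injEq, true_and]
  funext z
  by_cases hx : x = x'
  · rw [hx]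
  · by_cases h : z = x
    · subst h; simp [hx]
    · by_cases h' : z = x'
      · subst h'; simp [h]
      · simp [h, h']

theorem CType.input_comm {N : Type u} {B : Type v} [Add N] [One N] (x x' : Port) (T : CType N B) :
    (T.input x).input x' = (T.input x').input x := by
  simp only [input, CType.mk.injEq, true_and]
  funext y
  simp only [Option.map_map]
  congr 1
  funext c
  exact c.input_comm x x'

theorem CType.output_comm {N : Type u} {B : Type v} [Sub N] [One N] {y y' : Port} (h : y ≠ y') (T : CType N B) :
    (T.output y).output y' = (T.output y').output y := by
  simp only [output, CType.mk.injEq, true_and]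
  rw [Function.update_of_ne h.symm, Function.update_of_ne h, Function.update_comm h.symm]

/-! ### Commuting steps and runs of modified types -/

section ENat
variable {B : Type v}

theorem Constraint.Ready.input {c : Constraint ℕ∞ B} (h : c.Ready) (x : Port) :
    (c.input x).Ready := by
  refine ⟨h.1, fun z d hd => ?_⟩
  simp only [Constraint.input] at hd
  split_ifs at hd with hz
  · cases hc : c.deps z with
    | none => simp [hc] at hd
    | some d' =>
      obtain ⟨n, rfl, hn⟩ := h.2 z d' hc
      simp only [hc, Option.bind_some, Dep.incr, Option.some.injEq] at hd
      exact ⟨n + 1, hd.symm, le_add_left le_rfl⟩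
  · exact h.2 z d hd

/-- Truncated subtraction commutes with adding one because readiness makes every number at least 1.
Readiness also excludes initial dependencies, which an input would remove. -/
theorem Constraint.Ready.input_output {c : Constraint ℕ∞ B} (h : c.Ready) (x : Port) :
    (c.input x).output = c.output.input x := by
  simp only [Constraint.input, Constraint.output, Constraint.mk.injEq, true_and]
  funext z
  split_ifs with hz
  · cases hc : c.deps z with
    | none => rfl
    | some d' =>
      obtain ⟨n, rfl, hn⟩ := h.2 z d' hc
      have : n - 1 + 1 = n := tsub_add_cancel_of_le hn
      have h' : n + 1 - 1 = n := by
        cases n with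
        | top => rfl
        | coe k => norm_cast
      simp [Dep.incr, Dep.decr, this, h']
  · rfl

theorem Constraint.Ready.output_input {c : Constraint ℕ∞ B} (h : c.Ready) (y x : Port)
    (T : CType ℕ∞ B) (hc : T.con y = some c) :
    (T.output y).input x = (T.input x).output y := by
  simp only [CType.input, CType.output, CType.mk.injEq, true_and]
  funext z
  by_cases hz : z = y
  · subst hz; simp [hc, h.input_output]
  · simp [hz]

/-- Inputs only raise numbers or remove initial dependencies, so they never disable an output;
outputs on different ports touch different constraints. Two outputs on the same port are excluded,
since the first may use up what the second needs. -/
theorem CType.step_diamond {T T₁ T₂ : CType ℕ∞ B} {a a' : Act B}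
    (h₁ : CType.Step T a T₁) (h₂ : CType.Step T a' T₂)
    (h : ∀ y b b', a = .out y b → a' ≠ .out y b') :
    ∃ T₃, CType.Step T₁ a' T₃ ∧ CType.Step T₂ a T₃ := by
  cases a with
  | tau => rw [step_tau_iff] at h₁; subst h₁; exact ⟨T₂, h₂, .tau _⟩
  | inp x b =>
    rw [step_inp_iff] at h₁
    obtain ⟨hx, rfl⟩ := h₁
    cases a' with
    | tau => rw [step_tau_iff] at h₂; subst h₂; exact ⟨_, .tau _, (step_inp_iff _ _ _ _).2 ⟨hx, rfl⟩⟩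
    | inp x' b' =>
      rw [step_inp_iff] at h₂
      obtain ⟨hx', rfl⟩ := h₂
      exact ⟨_, (step_inp_iff _ _ _ _).2 ⟨hx', rfl⟩,
        (step_inp_iff _ _ _ _).2 ⟨hx, input_comm _ _ _⟩⟩
    | out y' b' =>
      rw [step_out_iff] at h₂
      obtain ⟨c, hc, hb, hr, rfl⟩ := h₂
      exact ⟨(T.input x).output y',
        (step_out_iff _ _ _ _).2 ⟨c.input x, by simp [CType.input, hc], hb, hr.input x, rfl⟩,
        (step_inp_iff _ _ _ _).2 ⟨hx, (Constraint.Ready.output_input hr _ _ _ hc).symm⟩⟩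
  | out y b =>
    rw [step_out_iff] at h₁
    obtain ⟨c, hc, hb, hr, rfl⟩ := h₁
    cases a' with
    | tau =>
      rw [step_tau_iff] at h₂; subst h₂
      exact ⟨_, .tau _, (step_out_iff _ _ _ _).2 ⟨c, hc, hb, hr, rfl⟩⟩
    | inp x' b' =>
      rw [step_inp_iff] at h₂
      obtain ⟨hx', rfl⟩ := h₂
      exact ⟨(T.input x').output y,
        (step_inp_iff _ _ _ _).2 ⟨hx', (Constraint.Ready.output_input hr _ _ _ hc).symm⟩,
        (step_out_iff _ _ _ _).2 ⟨c.input x', by simp [CType.input, hc], hb, hr.input x', rfl⟩⟩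
    | out y' b' =>
      have hy : y ≠ y' := by
        rintro rfl
        exact h y b b' rfl rfl
      rw [step_out_iff] at h₂
      obtain ⟨c', hc', hb', hr', rfl⟩ := h₂
      exact ⟨_, (step_out_iff _ _ _ _).2 ⟨c', by simp [output, hy.symm, hc'], hb', hr', rfl⟩,
        (step_out_iff _ _ _ _).2 ⟨c, by simp [output, hy, hc], hb, hr, output_comm hy _⟩⟩

/-- `T` evolves to `T'` by the actions of a list. -/
def CType.Run : List (Act B) → CType ℕ∞ B → CType ℕ∞ B → Prop
  | [], T, T' => T' = T
  | a :: w, T, T' => ∃ T₁, CType.Step T a T₁ ∧ CType.Run w T₁ T'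

theorem CType.run_append {w w' : List (Act B)} {T T' : CType ℕ∞ B} :
    CType.Run (w ++ w') T T' ↔ ∃ T₁, CType.Run w T T₁ ∧ CType.Run w' T₁ T' := by
  induction w generalizing T with
  | nil => simp [Run]
  | cons a w ih =>
    simp only [List.cons_append, Run, ih]
    constructor
    · rintro ⟨T₁, h, T₂, h', h''⟩; exact ⟨T₂, ⟨T₁, h, h'⟩, h''⟩
    · rintro ⟨T₂, ⟨T₁, h, h'⟩, h''⟩; exact ⟨T₁, h, T₂, h', h''⟩

theorem CType.run_diamond {w : List (Act B)} {T T₁ T₂ : CType ℕ∞ B} {a : Act B}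
    (h₁ : CType.Step T a T₁) (h₂ : CType.Run w T T₂)
    (h : ∀ y b b', a = .out y b → Act.out y b' ∉ w) :
    ∃ T₃, CType.Run w T₁ T₃ ∧ CType.Step T₂ a T₃ := by
  induction w generalizing T T₁ with
  | nil => cases h₂; exact ⟨T₁, rfl, h₁⟩
  | cons a' w ih =>
    obtain ⟨T', h', hr⟩ := h₂
    obtain ⟨T'', h3, h4⟩ := step_diamond h₁ h' fun y b b' e e' => h y b b' e (by simp [e'])
    obtain ⟨T₃, h5, h6⟩ := ih h4 hr fun y b b' e e' => h y b b' e (by simp [e'])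
    exact ⟨T₃, ⟨_, h3, h5⟩, h6⟩

/-- Extra inputs commute with every step, so whatever is possible before them remains possible after
them. This is what makes the body of a recursion repeatable. -/
theorem CType.Le.run {w : List (Act B)} {T T₁ T₂ : CType ℕ∞ B}
    (h₁ : CType.Le T T₁) (h₂ : CType.Run w T T₂) :
    ∃ T₃, CType.Run w T₁ T₃ ∧ CType.Le T₂ T₃ := by
  induction h₁ with
  | refl => exact ⟨T₂, h₂, .refl⟩
  | tail _ hs ih =>
    obtain ⟨T₃, h3, h4⟩ := ih
    obtain ⟨x, b, hs⟩ := hs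
    obtain ⟨T₄, h5, h6⟩ := run_diamond hs h3 (by simp)
    exact ⟨T₄, h5, h4.tail ⟨x, b, h6⟩⟩

theorem CType.Le.step {T T₁ T₂ : CType ℕ∞ B} {a : Act B}
    (h₁ : CType.Le T T₁) (h₂ : CType.Step T a T₂) :
    ∃ T₃, CType.Step T₁ a T₃ ∧ CType.Le T₂ T₃ := by
  obtain ⟨T₃, ⟨T', h3, h4⟩, h5⟩ := h₁.run (w := [a]) ⟨T₂, h₂, rfl⟩
  cases h4
  exact ⟨_, h3, h5⟩

/-- No step changes the declared inputs, so a declaration that is needed late in a run is there from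
the start. -/
theorem CType.run_inputs {w : List (Act B)} {T T' : CType ℕ∞ B} (h : CType.Run w T T')
    {x : Port} {b : B} (hx : Act.inp x b ∈ w) : T.inputs x = some b := by
  induction w generalizing T with
  | nil => simp at hx
  | cons a w ih =>
    obtain ⟨T₁, h1, h2⟩ := h
    rcases List.mem_cons.1 hx with rfl | hx
    · exact ((step_inp_iff _ _ _ _).1 h1).1
    · rw [← ih h2 hx]
      cases a with
      | tau => rw [(step_tau_iff _ _).1 h1]
      | inp => rw [((step_inp_iff _ _ _ _).1 h1).2]; rfl
      | out => obtain ⟨_, _, _, _, rfl⟩ := (step_out_iff _ _ _ _).1 h1; rfl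

theorem CType.run_con {w : List (Act B)} {T T' : CType ℕ∞ B} (h : CType.Run w T T')
    {y : Port} {b : B} (hy : Act.out y b ∈ w) : ∃ c, T.con y = some c ∧ c.ty = b := by
  induction w generalizing T with
  | nil => simp at hy
  | cons a w ih =>
    obtain ⟨T₁, h1, h2⟩ := h
    rcases List.mem_cons.1 hy with rfl | hy
    · obtain ⟨c, hc, hb, _⟩ := (step_out_iff _ _ _ _).1 h1
      exact ⟨c, hc, hb⟩
    · obtain ⟨c, hc, hb⟩ := ih h2 hy
      cases a with
      | tau => rw [(step_tau_iff _ _).1 h1] at hc; exact ⟨c, hc, hb⟩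
      | inp =>
        rw [((step_inp_iff _ _ _ _).1 h1).2] at hc
        simp only [input, Option.map_eq_some_iff] at hc
        obtain ⟨c', hc', rfl⟩ := hc
        exact ⟨c', hc', hb⟩
      | out z =>
        obtain ⟨c', hc', _, _, rfl⟩ := (step_out_iff _ _ _ _).1 h1
        by_cases hz : y = z
        · subst hz
          simp only [output, hc', Function.update_self, Option.map_some, Option.some.injEq] at hc
          subst hc
          exact ⟨c', hc', hb⟩
        · simp only [output, Function.update_of_ne hz] at hc
          exact ⟨c, hc, hb⟩

/-- The modification of a dependency by forwarders. -/
def modDep (F : List Fwd) (x : Port) : Dep ℕ → Option (Dep ℕ∞)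
  | .per n => if x ∈ innerIn F then some (.per ⊤) else some (.per (n : ℕ∞))
  | .initial => if x ∈ innerIn F then none else some .initial

def modConstraint (F : List Fwd) (c : Constraint ℕ B) : Constraint ℕ∞ B where
  ty := c.ty
  bound := c.bound
  deps x := (c.deps x).bind (modDep F x)

theorem modified_eq (F : List Fwd) (T : CType ℕ B) :
    modified F T = { inputs := T.inputs, con := fun y => (T.con y).map (modConstraint F) } := by
  unfold modified
  congr 1
  funext y
  congr 1
  funext c
  unfold modConstraint
  congr 1
  funext x
  rcases c.deps x with _ | (n | _) <;> rfl

theorem modConstraint_input (F : List Fwd) (c : Constraint ℕ B) (x : Port) :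
    modConstraint F (c.input x) = (modConstraint F c).input x := by
  simp only [modConstraint, Constraint.input, Constraint.mk.injEq, true_and]
  funext z
  split_ifs with hz
  · rcases c.deps z with _ | (n | _)
    · rfl
    · by_cases h : z ∈ innerIn F <;> simp [Dep.incr, modDep, h]
    · by_cases h : z ∈ innerIn F <;> simp [Dep.incr, modDep, h]
  · rfl

/-- The number ∞ absorbs the increment, and initial dependencies on forwarded ports have been
dropped already. Hence forwarded inputs are invisible to conformance. -/
theorem modConstraint_input_of_mem {F : List Fwd} {x : Port} (hx : x ∈ innerIn F)
    (c : Constraint ℕ B) : modConstraint F (c.input x) = modConstraint F c := by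
  simp only [modConstraint, Constraint.input, Constraint.mk.injEq, true_and]
  funext z
  split_ifs with hz
  · subst hz
    rcases c.deps z with _ | (n | _) <;> simp [Dep.incr, modDep, hx]
  · rfl

theorem modConstraint_output (F : List Fwd) (c : Constraint ℕ B) (h : c.Ready) :
    modConstraint F c.output = (modConstraint F c).output := by
  simp only [modConstraint, Constraint.output, Constraint.mk.injEq, true_and]
  funext z
  cases hc : c.deps z with
  | none => rfl
  | some d =>
    obtain ⟨n, rfl, hn⟩ := h.2 z d hc
    by_cases h : z ∈ innerIn F <;> simp [Dep.decr, modDep, h]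

theorem modConstraint_ready {F : List Fwd} {c : Constraint ℕ B} (h : c.Ready) :
    (modConstraint F c).Ready := by
  refine ⟨h.1, fun z d hd => ?_⟩
  simp only [modConstraint] at hd
  cases hc : c.deps z with
  | none => simp [hc] at hd
  | some d' =>
    obtain ⟨n, rfl, hn⟩ := h.2 z d' hc
    by_cases h : z ∈ innerIn F
    · simp [hc, modDep, h] at hd; exact ⟨⊤, hd.symm, le_top⟩
    · simp [hc, modDep, h] at hd; exact ⟨n, hd.symm, by exact_mod_cast hn⟩

/-- Subcomponents step with their plain types, whereas conformance speaks of modified types; this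
links the two. -/
theorem modified_step (F : List Fwd) {T T' : CType ℕ B} {a : Act B} (h : CType.Step T a T') :
    CType.Step (modified F T) a (modified F T') := by
  cases a with
  | tau => rw [CType.step_tau_iff] at h; subst h; exact .tau _
  | inp x b =>
    rw [CType.step_inp_iff] at h
    obtain ⟨hx, rfl⟩ := h
    rw [CType.step_inp_iff]
    refine ⟨hx, ?_⟩
    simp only [modified_eq, CType.input, Option.map_map, CType.mk.injEq, true_and]
    funext y
    congr 1
    funext c
    exact modConstraint_input F c x
  | out y b =>
    rw [CType.step_out_iff] at h
    obtain ⟨c, hc, hb, hr, rfl⟩ := h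
    rw [CType.step_out_iff]
    refine ⟨modConstraint F c, by simp [modified_eq, hc], hb, modConstraint_ready hr, ?_⟩
    simp only [modified_eq, CType.output, CType.mk.injEq, true_and]
    funext z
    by_cases hz : z = y
    · subst hz; simp [hc, modConstraint_output F c hr]
    · simp [hz]

theorem modified_input_of_mem {F : List Fwd} {x : Port} (hx : x ∈ innerIn F) (T : CType ℕ B) :
    modified F (T.input x) = modified F T := by
  simp only [modified_eq, CType.input, Option.map_map, CType.mk.injEq, true_and]
  funext y
  congr 1
  funext c
  exact modConstraint_input_of_mem hx c

end ENat

/-! ### Queues and base components -/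

section
variable {V : Type u} {B : Type v} {ty : V → B}

/-- The stores with an entry for `x` form an initial segment of the queue. -/
def Segmented (x : Port) (q : List (Store V)) : Prop :=
  ((q.dropWhile fun σ => (σ x).isSome).all fun σ => (σ x).isNone) = true

theorem segmented_cons {x : Port} {σ : Store V} {q : List (Store V)} :
    Segmented x (σ :: q) ↔ (σ x ≠ none ∧ Segmented x q) ∨ (∀ τ ∈ σ :: q, τ x = none) := by
  cases h : σ x with
  | none => simp [Segmented, h]
  | some v =>
    simp [Segmented, h]

theorem segmented_of_none {x : Port} {q : List (Store V)} (h : ∀ τ ∈ q, τ x = none) :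
    Segmented x q := by
  cases q with
  | nil => rfl
  | cons σ q => exact segmented_cons.2 (.inr h)

theorem Segmented.tail {x : Port} {σ : Store V} {q : List (Store V)}
    (h : Segmented x (σ :: q)) : Segmented x q := by
  rcases segmented_cons.1 h with h | h
  · exact h.2
  · exact segmented_of_none fun τ hτ => h τ (List.mem_cons_of_mem _ hτ)

theorem count_of_none {x : Port} {q : List (Store V)} (h : ∀ τ ∈ q, τ x = none) :
    count x q = 0 := by
  cases q with
  | nil => rfl
  | cons σ q => simp [count, h σ (by simp)]

theorem count_cons {x : Port} {σ : Store V} {q : List (Store V)} (h : Segmented x (σ :: q))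
    (hσ : σ x ≠ none) : count x (σ :: q) = count x q + 1 := by
  obtain ⟨v, hv⟩ := Option.ne_none_iff_exists'.1 hσ
  have h1 := h.tail
  unfold Segmented at h h1
  simp only [count, h, h1, if_true]
  simp [hv]

theorem enqueue_of_none {x : Port} {v : V} {q : List (Store V)} (h : ∀ τ ∈ q, τ x = none) :
    ∃ σ q', enqueue x v q = σ :: q' ∧ σ x = some v ∧ ∀ τ ∈ q', τ x = none := by
  cases q with
  | nil => exact ⟨_, _, rfl, by simp, by simp⟩
  | cons σ q =>
    simp only [enqueue, h σ (by simp), if_true]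
    exact ⟨_, _, rfl, by simp, fun τ hτ => h τ (List.mem_cons_of_mem _ hτ)⟩

/-- The first store without an entry for `x` is the one right behind the initial segment, so the
segment grows by exactly one. -/
theorem Segmented.enqueue_self {x : Port} {q : List (Store V)} (h : Segmented x q) (v : V) :
    Segmented x (enqueue x v q) ∧ count x (enqueue x v q) = count x q + 1 := by
  have key : ∀ q : List (Store V), (∀ τ ∈ q, τ x = none) →
      Segmented x (enqueue x v q) ∧ count x (enqueue x v q) = count x q + 1 := by
    intro q h
    obtain ⟨σ, q', he, hσ, hq⟩ := enqueue_of_none (v := v) h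
    have hs : Segmented x (σ :: q') :=
      segmented_cons.2 (.inl ⟨by simp [hσ], segmented_of_none hq⟩)
    rw [he, count_cons hs (by simp [hσ]), count_of_none hq, count_of_none h]
    exact ⟨hs, rfl⟩
  induction q with
  | nil => exact key _ (by simp)
  | cons σ q ih =>
    rcases segmented_cons.1 h with h' | h'
    · obtain ⟨h1, h2⟩ := ih h'.2
      have hs : Segmented x (σ :: enqueue x v q) := segmented_cons.2 (.inl ⟨h'.1, h1⟩)
      simp only [enqueue, h'.1, if_false]
      rw [count_cons hs h'.1, h2, count_cons h h'.1]
      exact ⟨hs, rfl⟩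
    · exact key _ h'

theorem enqueue_other_none {x z : Port} (hz : z ≠ x) (v : V) {q : List (Store V)}
    (h : ∀ τ ∈ q, τ z = none) : ∀ τ ∈ enqueue x v q, τ z = none := by
  induction q with
  | nil => simp [enqueue, hz]
  | cons σ q ih =>
    simp only [enqueue]
    split_ifs
    · intro τ hτ
      rcases List.mem_cons.1 hτ with rfl | hτ
      · simp [hz, h σ]
      · exact h τ (by simp [hτ])
    · intro τ hτ
      rcases List.mem_cons.1 hτ with rfl | hτ
      · exact h _ (by simp)
      · exact ih (fun τ hτ => h τ (by simp [hτ])) τ hτ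

/-- The entries for `z` stay as they are; at most a store without an entry for `z` is appended at
the end. -/
theorem Segmented.enqueue_other {x z : Port} (hz : z ≠ x) {q : List (Store V)}
    (h : Segmented z q) (v : V) :
    Segmented z (enqueue x v q) ∧ count z (enqueue x v q) = count z q := by
  induction q with
  | nil =>
    have := enqueue_other_none hz v (q := []) (by simp)
    exact ⟨segmented_of_none this, by rw [count_of_none this]; rfl⟩
  | cons σ q ih =>
    rcases segmented_cons.1 h with h' | h'
    · obtain ⟨h1, h2⟩ := ih h'.2
      simp only [enqueue]
      split_ifs
      · have hu : Function.update σ x (some v) z ≠ none := by simpa [hz] using h'.1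
        have hs : Segmented z (Function.update σ x (some v) :: q) :=
          segmented_cons.2 (.inl ⟨hu, h'.2⟩)
        rw [count_cons hs hu, count_cons h h'.1]
        exact ⟨hs, rfl⟩
      · have hs : Segmented z (σ :: enqueue x v q) := segmented_cons.2 (.inl ⟨h'.1, h1⟩)
        rw [count_cons hs h'.1, h2, count_cons h h'.1]
        exact ⟨hs, rfl⟩
    · have := enqueue_other_none hz v h'
      exact ⟨segmented_of_none this, by rw [count_of_none this, count_of_none h']⟩

theorem mem_enqueue {x z : Port} {v w : V} {q : List (Store V)} {τ : Store V}
    (h : τ ∈ enqueue x v q) (hw : τ z = some w) :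
    (z = x ∧ w = v) ∨ ∃ σ ∈ q, σ z = some w := by
  induction q with
  | nil =>
    simp only [enqueue, List.mem_singleton] at h
    subst h
    by_cases hz : z = x
    · simp [hz] at hw; exact .inl ⟨hz, hw.symm⟩
    · simp [hz] at hw
  | cons σ q ih =>
    simp only [enqueue] at h
    split_ifs at h
    · rcases List.mem_cons.1 h with rfl | h
      · by_cases hz : z = x
        · subst hz; simp at hw; exact .inl ⟨rfl, hw.symm⟩
        · simp [hz] at hw; exact .inr ⟨σ, by simp, hw⟩
      · exact .inr ⟨τ, by simp [h], hw⟩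
    · rcases List.mem_cons.1 h with rfl | h
      · exact .inr ⟨τ, by simp, hw⟩
      · rcases ih h with h | ⟨σ', h, h'⟩
        · exact .inl h
        · exact .inr ⟨σ', by simp [h], h'⟩

/-- The invariant of the queues of a base component. -/
def QueuesSegmented (L : List (LocalBinder ty)) : Prop :=
  ∀ b ∈ L, ∀ x, Segmented x b.queue

theorem LocalBinder.recv_out (b : LocalBinder ty) (x : Port) (v : V) :
    (b.recv x v).out = b.out := by
  unfold recv; split_ifs <;> rfl

theorem LocalBinder.recv_params (b : LocalBinder ty) (x : Port) (v : V) :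
    (b.recv x v).params = b.params := by
  unfold recv; split_ifs <;> rfl

theorem LocalBinder.recv_fn (b : LocalBinder ty) (x : Port) (v : V) :
    (b.recv x v).fn = b.fn := by
  unfold recv; split_ifs <;> rfl

theorem LocalBinder.recv_segmented {b : LocalBinder ty} (h : ∀ z, Segmented z b.queue)
    (x : Port) (v : V) (z : Port) : Segmented z (b.recv x v).queue := by
  unfold recv
  split_ifs
  · by_cases hz : z = x
    · subst hz; exact ((h z).enqueue_self v).1
    · exact ((h z).enqueue_other hz v).1
  · exact h z

theorem LocalBinder.constraint_recv {b : LocalBinder ty} (h : ∀ z, Segmented z b.queue)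
    (γ : Port → B) (x : Port) (v : V) :
    (b.recv x v).constraint γ = (b.constraint γ).input x := by
  simp only [constraint, Constraint.input, recv_out, recv_params, Constraint.mk.injEq, true_and]
  funext z
  unfold recv
  by_cases hb : z ∈ b.params
  · by_cases hz : z = x
    · subst hz
      simp [hb, ((h z).enqueue_self v).2, Dep.incr]
    · by_cases hx : x ∈ b.params
      · simp [hb, hz, hx, ((h z).enqueue_other hz v).2]
      · simp [hb, hz, hx]
  · simp [hb]

theorem BindersStep.inp_eq {L L' : List (LocalBinder ty)} {x : Port} {v : V}
    (h : BindersStep L (.inp x v) L') : L' = L.map fun b => b.recv x v := by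
  cases h; rfl

theorem BindersStep.out_cases {L L' : List (LocalBinder ty)} {y : Port} {v : V}
    (h : BindersStep L (.out y v) L') : ∃ L₁ L₂ b b', L = L₁ ++ b :: L₂ ∧ L' = L₁ ++ b' :: L₂ ∧
      b.out = y ∧ b.Emit v b' := by
  generalize ha : Act.out y v = a at h
  cases h with
  | inp => cases ha
  | out L₁ L₂ b b' v' h => cases ha; exact ⟨L₁, L₂, b, b', rfl, rfl, rfl, h⟩

theorem LocalBinder.Emit.out_eq {b b' : LocalBinder ty} {v : V} (h : b.Emit v b') :
    b'.out = b.out := by cases h <;> rfl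

theorem LocalBinder.Emit.params_eq {b b' : LocalBinder ty} {v : V} (h : b.Emit v b') :
    b'.params = b.params := by cases h <;> rfl

theorem LocalBinder.Emit.mem_queue {b b' : LocalBinder ty} {v : V} (h : b.Emit v b')
    {σ : Store V} (hσ : σ ∈ b'.queue) : σ ∈ b.queue := by
  cases h with
  | nullary => exact hσ
  | complete τ q vs h1 h2 h3 => rw [h2]; exact List.mem_cons_of_mem _ hσ

theorem LocalBinder.Emit.segmented {b b' : LocalBinder ty} {v : V} (h : b.Emit v b')
    (hs : ∀ x, Segmented x b.queue) (x : Port) : Segmented x b'.queue := by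
  cases h with
  | nullary => exact hs x
  | complete τ q vs h1 h2 h3 => have := hs x; rw [h2] at this; exact this.tail

theorem QueuesSegmented.step {L L' : List (LocalBinder ty)} {a : Act V}
    (h : QueuesSegmented L) (hs : BindersStep L a L') : QueuesSegmented L' := by
  cases a with
  | inp x v =>
    rw [hs.inp_eq]
    intro b hb
    obtain ⟨b', hb', rfl⟩ := List.mem_map.1 hb
    exact LocalBinder.recv_segmented (h b' hb') x v
  | out y v =>
    obtain ⟨L₁, L₂, b, b', rfl, rfl, _, he⟩ := hs.out_cases
    intro c hc
    rcases List.mem_append.1 hc with hc | hc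
    · exact h c (by simp [hc])
    · rcases List.mem_cons.1 hc with rfl | hc
      · exact he.segmented (h b (by simp))
      · exact h c (by simp [hc])
  | tau => cases hs

theorem map_some_defined {σ : Store V} {l : List Port} {vs : List V}
    (h : l.map σ = vs.map some) {x : Port} (hx : x ∈ l) : ∃ v, σ x = some v := by
  have : σ x ∈ vs.map some := by rw [← h]; exact List.mem_map_of_mem hx
  obtain ⟨v, _, hv⟩ := List.mem_map.1 this
  exact ⟨v, hv.symm⟩

theorem map_ty_of_map_some {σ : Store V} {γ : Port → B} (hσ : ∀ x v, σ x = some v → ty v = γ x) :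
    ∀ {l : List Port} {vs : List V}, l.map σ = vs.map some → vs.map ty = l.map γ
  | [], [], _ => rfl
  | [], _ :: _, h => by simp at h
  | _ :: _, [], h => by simp at h
  | x :: l, v :: vs, h => by
    simp only [List.map_cons, List.cons.injEq] at h
    simp only [List.map_cons, hσ x v h.1, map_ty_of_map_some hσ h.2]

theorem LocalBinder.Emit.ty_eq {b b' : LocalBinder ty} {v : V} (h : b.Emit v b')
    {xs : List Port} {γ : Port → B} (hc : b.Consistent xs γ) : ty v = γ b.out := by
  rw [← hc.2.2.1]
  cases h with
  | nullary hp => exact b.fn.eval_ty _ (by simp [hc.2.1, hp])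
  | complete τ q vs h1 h2 h3 =>
    refine b.fn.eval_ty _ ?_
    rw [hc.2.1]
    exact map_ty_of_map_some (hc.2.2.2 τ (by simp [h2])) h3

theorem LocalBinder.Emit.consistent {b b' : LocalBinder ty} {v : V} (h : b.Emit v b')
    {xs : List Port} {γ : Port → B} (hc : b.Consistent xs γ) : b'.Consistent xs γ := by
  refine ⟨?_, ?_, ?_, fun σ hσ => hc.2.2.2 σ (h.mem_queue hσ)⟩
  · rw [h.params_eq]; exact hc.1
  · cases h <;> exact hc.2.1
  · cases h <;> exact hc.2.2.1

/-- An emission removes a store with an entry for every parameter, so every count drops by one. On a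
queue that is not segmented, `count` would be the default 0 and the constraint could not be ready.
-/
theorem LocalBinder.Emit.constraint_eq {b b' : LocalBinder ty} {v : V} (h : b.Emit v b')
    (hs : ∀ x, Segmented x b.queue) (γ : Port → B) :
    (b.constraint γ).Ready ∧ b'.constraint γ = (b.constraint γ).output := by
  cases h with
  | nullary hp =>
    refine ⟨⟨by simp [constraint], by simp [constraint, hp]⟩, ?_⟩
    simp [constraint, Constraint.output, hp]
  | complete τ q vs h1 h2 h3 =>
    have key : ∀ x ∈ b.params, count x b.queue = count x q + 1 := by
      intro x hx
      obtain ⟨w, hw⟩ := map_some_defined h3 hx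
      have := hs x
      rw [h2] at this ⊢
      exact count_cons this (by simp [hw])
    refine ⟨⟨by simp [constraint], ?_⟩, ?_⟩
    · intro x d hd
      simp only [constraint] at hd
      split_ifs at hd with hx
      cases hd
      exact ⟨_, rfl, by rw [key x hx]; exact Nat.le_add_left _ _⟩
    · simp only [constraint, Constraint.output, Constraint.mk.injEq, true_and]
      refine ⟨rfl, ?_⟩
      funext x
      by_cases hx : x ∈ b.params
      · simp [hx, key x hx, Dep.decr]
      · simp [hx]

theorem LocalBinder.Consistent.recv {b : LocalBinder ty} {xs : List Port} {γ : Port → B}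
    (h : b.Consistent xs γ) {x : Port} {v : V} (hv : ty v = γ x) :
    (b.recv x v).Consistent xs γ := by
  refine ⟨by rw [recv_params]; exact h.1, by rw [recv_fn, recv_params]; exact h.2.1,
    by rw [recv_fn, recv_out]; exact h.2.2.1, ?_⟩
  intro σ hσ z w hz
  unfold LocalBinder.recv at hσ
  split_ifs at hσ
  · rcases mem_enqueue hσ hz with ⟨rfl, rfl⟩ | ⟨τ, hτ, hz⟩
    · exact hv
    · exact h.2.2.2 τ hτ z w hz
  · exact h.2.2.2 σ hσ z w hz

theorem find_out_eq {L₁ L₂ : List (LocalBinder ty)} {b : LocalBinder ty}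
    (h : ((L₁ ++ b :: L₂).map LocalBinder.out).Nodup) :
    (L₁ ++ b :: L₂).find? (fun c => c.out = b.out) = some b := by
  rw [List.find?_append]
  have : L₁.find? (fun c => decide (c.out = b.out)) = none := by
    rw [List.find?_eq_none]
    intro c hc
    simp only [decide_eq_true_eq]
    intro he
    simp only [List.map_append, List.map_cons] at h
    exact (List.nodup_append.1 h).2.2 c.out (List.mem_map_of_mem hc) b.out (by simp) he
  rw [this]
  simp

/-- An input acts on all binders and on all constraints alike. An output concerns a single binder,
which is the one that `find?` selects because the output ports are distinct. -/
theorem base_step {xs ys : List Port} {L L' : List (LocalBinder ty)} {T : CType ℕ B} {a : Act V}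
    (hn : ys.Nodup) (hq : QueuesSegmented L) (hT : BaseExtracts xs ys L T)
    (hs : BindersStep L a L') (hx : ∀ x v, a = .inp x v → x ∈ xs)
    (hv : ∀ x v, a = .inp x v → ∀ b, T.inputs x = some b → ty v = b) :
    ∃ T', CType.Step T (a.map ty) T' ∧ BaseExtracts xs ys L' T' := by
  obtain ⟨hp, γ, hc, rfl⟩ := hT
  cases a with
  | tau => cases hs
  | inp x v =>
    have hxs := hx x v rfl
    have hty : ty v = γ x := hv x v rfl _ (by simp [baseType, hxs])
    rw [hs.inp_eq]
    refine ⟨(baseType xs L γ).input x,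
      (CType.step_inp_iff _ _ _ _).2 ⟨by simp [baseType, hxs, hty], rfl⟩, ?_, γ, ?_, ?_⟩
    · rw [List.map_map]
      convert hp using 2
      funext b
      exact b.recv_out x v
    · intro b hb
      obtain ⟨c, hcL, rfl⟩ := List.mem_map.1 hb
      exact (hc c hcL).recv hty
    · simp only [baseType, CType.input, CType.mk.injEq, true_and]
      funext y
      rw [List.find?_map, Option.map_map, Option.map_map]
      have : ((fun b : LocalBinder ty => decide (b.out = y)) ∘
          fun b : LocalBinder ty => b.recv x v) =
          fun b : LocalBinder ty => decide (b.out = y) := by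
        funext b; simp [LocalBinder.recv_out]
      rw [this]
      cases h : L.find? fun b => decide (b.out = y) with
      | none => rfl
      | some b =>
        simp only [Option.map_some, Function.comp]
        rw [LocalBinder.constraint_recv (hq b (List.mem_of_find?_eq_some h))]
  | out y v =>
    obtain ⟨L₁, L₂, b, b', rfl, rfl, rfl, he⟩ := hs.out_cases
    have hb : b ∈ L₁ ++ b :: L₂ := by simp
    have hnd := hp.nodup_iff.2 hn
    have hf := find_out_eq hnd
    obtain ⟨hr, ho⟩ := he.constraint_eq (hq b hb) γ
    refine ⟨(baseType xs (L₁ ++ b :: L₂) γ).output b.out,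
      (CType.step_out_iff _ _ _ _).2 ⟨b.constraint γ, by simp only [baseType, hf]; rfl,
        (he.ty_eq (hc b hb)).symm, hr, rfl⟩, ?_, γ, ?_, ?_⟩
    · simpa [he.out_eq] using hp
    · intro c hcL
      rcases List.mem_append.1 hcL with h | h
      · exact hc c (by simp [h])
      · rcases List.mem_cons.1 h with rfl | h
        · exact he.consistent (hc b hb)
        · exact hc c (by simp [h])
    · have hnd' : ((L₁ ++ b' :: L₂).map LocalBinder.out).Nodup := by simpa [he.out_eq] using hnd
      have hf' := find_out_eq hnd'
      rw [he.out_eq] at hf'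
      simp only [baseType, CType.output, CType.mk.injEq, true_and]
      funext y
      by_cases hy : y = b.out
      · subst hy
        simp only [hf, hf', Function.update_self, Option.map_some]
        rw [ho]
      · rw [Function.update_of_ne hy]
        congr 1
        simp [List.find?_append, he.out_eq, Ne.symm hy]

end

/-! ### Protocols as sequences of items with a fixed tail -/

section
variable {V : Type u} {B : Type v}

/-- The events that a role has in a protocol. -/
inductive Ev
  | send (l : Label)
  | recv (l : Label)

def Ev.label : Ev → Label
  | .send l => l
  | .recv l => l

/-- A communication or a message in transit. -/
inductive Item (V : Type u)
  | comm (p : Role) (l : Label) (qs : Finset Role)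
  | msg (l : Label) (v : V) (qs : Finset Role)

def Item.fill : Item V → Global V → Global V
  | .comm p l qs, G => .comm p l qs G
  | .msg l v qs, G => .msg l v qs G

def Item.label : Item V → Label
  | .comm _ l _ => l
  | .msg l _ _ => l

def Item.view (s : Role) : Item V → List Ev
  | .comm p l qs => (if s = p then [.send l] else []) ++ (if s ∈ qs then [.recv l] else [])
  | .msg l _ qs => if s ∈ qs then [.recv l] else []

def fillG (I : List (Item V)) (R : Global V) : Global V := I.foldr Item.fill R

/-- The events of role `s` in a sequence of items. -/
def view (s : Role) (I : List (Item V)) : List Ev := I.flatMap (Item.view s)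

theorem view_cons (s : Role) (i : Item V) (I : List (Item V)) :
    view s (i :: I) = i.view s ++ view s I := rfl

theorem view_append (s : Role) (I J : List (Item V)) : view s (I ++ J) = view s I ++ view s J := by
  simp [view]

/-- The end of a protocol with at most one recursion. -/
inductive Tail (V : Type u)
  | done
  | var (X : RecVar)
  | loop (X : RecVar) (body : List (Item V))

def Tail.global : Tail V → Global V
  | .done => .done
  | .var X => .var X
  | .loop X b => .mu X (fillG b (.var X))

def Tail.body : Tail V → List (Item V)
  | .done => []
  | .var _ => []
  | .loop _ b => b

/-- `m` copies of a list. -/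
def copies {α : Type*} (m : ℕ) (l : List α) : List α := (List.replicate m l).flatten

theorem copies_succ {α : Type*} (m : ℕ) (l : List α) : copies (m + 1) l = l ++ copies m l := rfl

theorem copies_add {α : Type*} (m k : ℕ) (l : List α) :
    copies (m + k) l = copies m l ++ copies k l := by
  rw [copies, List.replicate_add, List.flatten_append]; rfl

theorem copies_succ' {α : Type*} (m : ℕ) (l : List α) : copies (m + 1) l = copies m l ++ l := by
  rw [copies_add]; simp [copies]

theorem mem_copies {α : Type*} {m : ℕ} {l : List α} {a : α} (h : a ∈ copies m l) : a ∈ l := by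
  simp only [copies, List.mem_flatten, List.mem_replicate] at h
  obtain ⟨l', ⟨_, rfl⟩, h⟩ := h
  exact h

theorem view_copies (s : Role) (m : ℕ) (I : List (Item V)) :
    view s (copies m I) = copies m (view s I) := by
  induction m with
  | zero => rfl
  | succ m ih => rw [copies_succ, copies_succ, view_append, ih]

/-- The variable stands only at the end of the body, so unfolding the recursion amounts to putting
one more copy of the body in front of it. -/
theorem subst_fillG (b : List (Item V)) (X : RecVar) (H : Global V) :
    (fillG b (.var X)).subst X H = fillG b H := by
  induction b with
  | nil => simp [fillG, Global.subst]
  | cons i b ih => cases i <;> simpa [fillG, Item.fill, Global.subst] using ih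

def GAct.ev : GAct V → Ev
  | .snd _ l _ => .send l
  | .rcv _ l _ => .recv l

/-- A message that has still to be received by `qs`. -/
def transitItems (l : Label) (v : V) (qs : Finset Role) : List (Item V) :=
  if qs = ∅ then [] else [.msg l v qs]

theorem view_transitItems (s : Role) (l : Label) (v : V) (qs : Finset Role) :
    view s (transitItems l v qs) = if s ∈ qs then [.recv l] else [] := by
  unfold transitItems
  split_ifs with h h' h'
  · simp [h] at h'
  · rfl
  · simp [view, Item.view, h']
  · simp [view, Item.view, h']

/-- Steps of sequences of items. -/
inductive ItemStep : List (Item V) → GAct V → List (Item V) → Prop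
  | snd (I J : List (Item V)) (p : Role) (l : Label) (qs : Finset Role) (v : V) :
      view p I = [] → ItemStep (I ++ .comm p l qs :: J) (.snd p l v) (I ++ .msg l v qs :: J)
  | rcv (I J : List (Item V)) (q : Role) (l : Label) (v : V) (qs : Finset Role) :
      view q I = [] → q ∈ qs →
      ItemStep (I ++ .msg l v qs :: J) (.rcv q l v) (I ++ (transitItems l v (qs.erase q) ++ J))

theorem ItemStep.cons {I I' : List (Item V)} {a : GAct V} (h : ItemStep I a I') (i : Item V)
    (hi : i.view a.subj = []) : ItemStep (i :: I) a (i :: I') := by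
  cases h with
  | snd I J p l qs v h =>
    exact .snd (i :: I) J p l qs v (by rw [view_cons, h, List.append_nil]; exact hi)
  | rcv I J q l v qs h hq =>
    exact .rcv (i :: I) J q l v qs (by rw [view_cons, h, List.append_nil]; exact hi) hq

/-- The acting role is absent from all items before the one where it acts, so it consumes the head
of its own word. No other role can tell a communication from the message that it becomes. -/
theorem ItemStep.view_eq {I I' : List (Item V)} {a : GAct V} (h : ItemStep I a I') (s : Role) :
    view s I = (if s = a.subj then [a.ev] else []) ++ view s I' := by
  cases h with
  | snd I J p l qs v h =>
    simp only [view_append, view_cons, Item.view, GAct.subj, GAct.ev]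
    by_cases hs : s = p
    · subst hs; simp [h]
    · simp [hs]
  | rcv I J q l v qs h hq =>
    simp only [view_append, view_cons, Item.view, GAct.subj, GAct.ev, view_transitItems]
    by_cases hs : s = q
    · subst hs; simp [h, hq]
    · simp [hs]

/-- A role may act ahead of communications in which it has no part, even whole rounds ahead, so the
number `m` of unfoldings depends on the step. The tail is the same before and after, which keeps the
normal form along executions. -/
theorem Global.Step.items {G G' : Global V} {a : GAct V} (h : Global.Step G a G') (R : Tail V) :
    ∀ I, G = fillG I R.global →
      ∃ m I', G' = fillG I' R.global ∧ ItemStep (I ++ copies m R.body) a I' := by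
  have nil : ∀ G : Global V, R.global = G → (∀ p l qs H, G ≠ .comm p l qs H) ∧
      (∀ l v qs H, G ≠ .msg l v qs H) := by
    rintro _ rfl
    cases R <;> simp [Tail.global]
  induction h with
  | snd p l qs G v =>
    rintro (_ | ⟨i, I⟩) hI
    · exact absurd rfl ((nil _ hI.symm).1 _ _ _ _)
    · cases i with
      | comm p' l' qs' =>
        simp only [fillG, List.foldr, Item.fill, Global.comm.injEq] at hI
        obtain ⟨rfl, rfl, rfl, rfl⟩ := hI
        refine ⟨0, .msg l v qs :: I, rfl, ?_⟩
        simpa [copies] using ItemStep.snd [] I p l qs v rfl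
      | msg => simp [fillG, Item.fill] at hI
  | rcv q l v qs G hq =>
    rintro (_ | ⟨i, I⟩) hI
    · exact absurd rfl ((nil _ hI.symm).2 _ _ _ _)
    · cases i with
      | comm => simp [fillG, Item.fill] at hI
      | msg l' v' qs' =>
        simp only [fillG, List.foldr, Item.fill, Global.msg.injEq] at hI
        obtain ⟨rfl, rfl, rfl, rfl⟩ := hI
        refine ⟨0, transitItems l v (qs.erase q) ++ I, ?_, ?_⟩
        · unfold Global.transit transitItems
          split_ifs <;> rfl
        · simpa [copies] using ItemStep.rcv [] I q l v qs rfl hq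
  | unfold X G G' a _ ih =>
    rintro (_ | ⟨i, I⟩) hI
    · cases R with
      | done => simp [fillG, Tail.global] at hI
      | var => simp [fillG, Tail.global] at hI
      | loop Y b =>
        simp only [fillG, List.foldr, Tail.global, Global.mu.injEq] at hI
        obtain ⟨rfl, rfl⟩ := hI
        obtain ⟨m, I', h1, h2⟩ := ih b (subst_fillG b X _)
        -- The body followed by `m` further copies is, by definition, `m + 1` copies after the empty
        -- sequence.
        exact ⟨m + 1, I', h1, h2⟩
    · cases i <;> simp [fillG, Item.fill] at hI
  | underComm p l qs G G' a h1 h2 _ ih =>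
    rintro (_ | ⟨i, I⟩) hI
    · exact absurd rfl ((nil _ hI.symm).1 _ _ _ _)
    · cases i with
      | comm p' l' qs' =>
        simp only [fillG, List.foldr, Item.fill, Global.comm.injEq] at hI
        obtain ⟨rfl, rfl, rfl, rfl⟩ := hI
        obtain ⟨m, I', h3, h4⟩ := ih I rfl
        exact ⟨m, .comm p l qs :: I', by rw [h3]; rfl,
          h4.cons _ (by simp [Item.view, h1, h2])⟩
      | msg => simp [fillG, Item.fill] at hI
  | underMsg l v qs G G' a h2 _ ih =>
    rintro (_ | ⟨i, I⟩) hI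
    · exact absurd rfl ((nil _ hI.symm).2 _ _ _ _)
    · cases i with
      | comm => simp [fillG, Item.fill] at hI
      | msg l' v' qs' =>
        simp only [fillG, List.foldr, Item.fill, Global.msg.injEq] at hI
        obtain ⟨rfl, rfl, rfl, rfl⟩ := hI
        obtain ⟨m, I', h3, h4⟩ := ih I rfl
        exact ⟨m, .msg l v qs :: I', by rw [h3]; rfl, h4.cons _ (by simp [Item.view, h2])⟩

theorem labels_fillG (I : List (Item V)) (R : Global V) :
    (fillG I R).labels = I.map Item.label ++ R.labels := by
  induction I with
  | nil => rfl
  | cons i I ih => cases i <;> simpa [fillG, Item.fill, Global.labels, Item.label] using ih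

theorem exists_items_of_recCount_zero (G : Global V) (h : G.recCount = 0) :
    ∃ I : List (Item V), G = fillG I .done ∨ ∃ X, G = fillG I (.var X) := by
  induction G with
  | comm p l qs G ih =>
    obtain ⟨I, h | ⟨X, h⟩⟩ := ih h
    · exact ⟨.comm p l qs :: I, .inl (by rw [h]; rfl)⟩
    · exact ⟨.comm p l qs :: I, .inr ⟨X, by rw [h]; rfl⟩⟩
  | msg l v qs G ih =>
    obtain ⟨I, h | ⟨X, h⟩⟩ := ih h
    · exact ⟨.msg l v qs :: I, .inl (by rw [h]; rfl)⟩
    · exact ⟨.msg l v qs :: I, .inr ⟨X, by rw [h]; rfl⟩⟩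
  | mu => simp [Global.recCount] at h
  | var X => exact ⟨[], .inr ⟨X, rfl⟩⟩
  | done => exact ⟨[], .inl rfl⟩

theorem occurs_fillG (X : RecVar) (I : List (Item V)) (R : Global V) :
    (fillG I R).Occurs X ↔ R.Occurs X := by
  induction I with
  | nil => rfl
  | cons i I ih => cases i <;> simpa [fillG, Item.fill, Global.Occurs] using ih

/-- With at most one recursion, its body contains no other one; and since its variable has to occur
free, the body ends in that variable. -/
theorem exists_items (G : Global V) (hs : G.Static) (h : G.recCount ≤ 1) :
    ∃ (I : List (Item V)) (R : Tail V), G = fillG I R.global := by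
  induction G with
  | comm p l qs G ih =>
    obtain ⟨I, R, h⟩ := ih hs.2 h
    exact ⟨.comm p l qs :: I, R, by rw [h]; rfl⟩
  | msg l v qs G ih => exact hs.elim
  | mu X G ih =>
    simp only [Global.recCount, add_le_iff_nonpos_left, nonpos_iff_eq_zero] at h
    obtain ⟨I, h | ⟨Y, h⟩⟩ := exists_items_of_recCount_zero G h
    · have := hs.1
      rw [h, occurs_fillG] at this
      exact this.elim
    · have := hs.1
      rw [h, occurs_fillG] at this
      have hY : Y = X := this
      subst hY
      exact ⟨[], .loop Y I, by rw [h]; rfl⟩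
  | var X => exact ⟨[], .var X, rfl⟩
  | done => exact ⟨[], .done, rfl⟩

theorem labels_global (R : Tail V) : R.global.labels = R.body.map Item.label := by
  cases R with
  | done => rfl
  | var => rfl
  | loop X b => simp [Tail.global, Tail.body, Global.labels, labels_fillG]

theorem mem_view_label {s : Role} {I : List (Item V)} {e : Ev} (h : e ∈ view s I) :
    e.label ∈ I.map Item.label := by
  simp only [view, List.mem_flatMap] at h
  obtain ⟨i, hi, he⟩ := h
  refine List.mem_map.2 ⟨i, hi, ?_⟩
  cases i with
  | comm p l qs =>
    simp only [Item.view, List.mem_append] at he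
    rcases he with he | he <;> split_ifs at he <;> simp at he <;> subst he <;> rfl
  | msg l v qs =>
    simp only [Item.view] at he
    split_ifs at he <;> simp at he
    subst he; rfl

/-- A label contributes twice only if its sender is also a receiver, and then it contributes two
different events. -/
theorem view_nodup (s : Role) {I : List (Item V)} (h : (I.map Item.label).Nodup) :
    (view s I).Nodup := by
  induction I with
  | nil => simp [view]
  | cons i I ih =>
    simp only [List.map_cons, List.nodup_cons] at h
    rw [view_cons, List.nodup_append]
    refine ⟨?_, ih h.2, ?_⟩
    · cases i with
      | comm p l qs => simp only [Item.view]; split_ifs <;> simp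
      | msg l v qs => simp only [Item.view]; split_ifs <;> simp
    · rintro e he e' he' rfl
      have h1 := mem_view_label (s := s) (I := [i]) (e := e) (by simpa [view] using he)
      have h2 := mem_view_label he'
      simp only [List.map_cons, List.map_nil, List.mem_singleton] at h1
      exact h.1 (h1 ▸ h2)

/-! ### Projection -/

/-- The event `e` of role `s` uses the port `x`. -/
def Ev.On (D : List DBinder) (s : Role) : Ev → Port → Prop
  | .send l, y => SendsOn D s l y
  | .recv l, x => RecvsOn D s l x

open Classical in
/-- The port of an event of role `s`. -/
noncomputable def portOf (D : List DBinder) (s : Role) (e : Ev) : Port :=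
  if h : ∃ x, e.On D s x then h.choose else 0

/-- Unique binders make the chosen port the only one; the default 0 of `portOf` is never used for an
event that has a port. -/
theorem Ev.On.port_eq {D : List DBinder} (hD : UniqueBinders D) {s : Role} {e : Ev} {x : Port}
    (h : e.On D s x) : portOf D s e = x := by
  have hx : ∃ x, e.On D s x := ⟨x, h⟩
  have h' := hx.choose_spec
  rw [portOf, dif_pos hx]
  generalize hx.choose = z at h'
  cases e with
  | send l =>
    obtain ⟨d, hd, h1, h2, h3⟩ := h
    obtain ⟨d', hd', h1', h2', h3'⟩ := h'
    rw [← h3, ← h3']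
    exact (hD d' hd' d hd).1 (by rw [h1, h1']) (by rw [h2, h2'])
  | recv l =>
    obtain ⟨d, hd, h1, h2, h3⟩ := h
    obtain ⟨d', hd', h1', h2', h3'⟩ := h'
    rw [← h3, ← h3']
    exact (hD d' hd' d hd).2.1 (by rw [h1, h1']) (by rw [h2, h2'])

theorem recvsOn_label {D : List DBinder} (hD : UniqueBinders D) {s : Role} {l l' : Label}
    {x : Port} (h : RecvsOn D s l x) (h' : RecvsOn D s l' x) : l = l' := by
  obtain ⟨d, hd, h1, h2, h3⟩ := h
  obtain ⟨d', hd', h1', h2', h3'⟩ := h'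
  rw [← h1, ← h1']
  exact (hD d hd d' hd').2.2.2 (by rw [h2, h2']) (by rw [h3, h3'])

theorem sendsOn_label {D : List DBinder} (hD : UniqueBinders D) {s : Role} {l l' : Label}
    {x : Port} (h : SendsOn D s l x) (h' : SendsOn D s l' x) : l = l' := by
  obtain ⟨d, hd, h1, h2, h3⟩ := h
  obtain ⟨d', hd', h1', h2', h3'⟩ := h'
  rw [← h1, ← h1']
  exact (hD d hd d' hd').2.2.1 (by rw [h2, h2']) (by rw [h3, h3'])

/-- The prefix of a local protocol for an event. -/
def Ev.pre (σ : Ev → Port) (γ : Label → B) : Ev → LocalP B → LocalP B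
  | .send l, P => .send (σ (.send l)) (γ l) P
  | .recv l, P => .recv (σ (.recv l)) (γ l) P

def Ev.act (σ : Ev → Port) (γ : Label → B) : Ev → Act B
  | .send l => .out (σ (.send l)) (γ l)
  | .recv l => .inp (σ (.recv l)) (γ l)

def fillP (σ : Ev → Port) (γ : Label → B) (w : List Ev) (Q : LocalP B) : LocalP B :=
  w.foldr (Ev.pre σ γ) Q

theorem fillP_append (σ : Ev → Port) (γ : Label → B) (w w' : List Ev) (Q : LocalP B) :
    fillP σ γ (w ++ w') Q = fillP σ γ w (fillP σ γ w' Q) := by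
  simp [fillP]

def Tail.proj (σ : Ev → Port) (γ : Label → B) (s : Role) : Tail V → LocalP B
  | .done => .done
  | .var X => .var X
  | .loop X b => .mu X (fillP σ γ (view s b) (.var X))

/-- The values of messages in transit have the types of their labels. -/
def Item.Typed (ty : V → B) (γ : Label → B) : Item V → Prop
  | .comm _ _ _ => True
  | .msg l v _ => ty v = γ l

theorem ItemStep.typed {I I' : List (Item V)} {a : GAct V} (h : ItemStep I a I') {ty : V → B}
    {γ : Label → B} (hI : ∀ i ∈ I, i.Typed ty γ)
    (ha : ∀ p l v, a = .snd p l v → ty v = γ l) : ∀ i ∈ I', i.Typed ty γ := by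
  cases h with
  | snd I J p l qs v _ =>
    intro i hi
    simp only [List.mem_append, List.mem_cons] at hi hI
    rcases hi with hi | rfl | hi
    · exact hI i (.inl hi)
    · exact ha _ _ _ rfl
    · exact hI i (.inr (.inr hi))
  | rcv I J q l v qs _ _ =>
    intro i hi
    simp only [List.mem_append, List.mem_cons] at hi hI
    rcases hi with hi | hi | hi
    · exact hI i (.inl hi)
    · unfold transitItems at hi
      split_ifs at hi
      · simp at hi
      · simp only [List.mem_singleton] at hi
        subst hi
        exact hI (.msg l v qs) (.inr (.inl rfl))
    · exact hI i (.inr (.inr hi))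

theorem ItemStep.rcv_typed {I I' : List (Item V)} {q : Role} {l : Label} {v : V}
    (h : ItemStep I (.rcv q l v) I') {ty : V → B} {γ : Label → B}
    (hI : ∀ i ∈ I, i.Typed ty γ) : ty v = γ l := by
  cases h with
  | rcv I J q l v qs _ _ => exact hI (.msg l v qs) (by simp)

variable {ty : V → B} {D : List DBinder} {γ : Label → B} {s : Role}

theorem projSend_iff (hD : UniqueBinders D) (p : Role) (l : Label) (P P' : LocalP B) :
    ProjSend D γ s p l P P' ↔
      (∀ e ∈ (if s = p then [Ev.send l] else []), ∃ x, e.On D s x) ∧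
      P' = fillP (portOf D s) γ (if s = p then [.send l] else []) P := by
  unfold ProjSend
  by_cases h : s = p
  · simp only [h, true_and, if_true, List.mem_singleton, forall_eq, fillP, List.foldr, Ev.pre,
      ne_eq, not_true, false_and, or_false]
    constructor
    · rintro ⟨y, hy, rfl⟩
      exact ⟨⟨y, hy⟩, by rw [Ev.On.port_eq hD (e := .send l) hy]⟩
    · rintro ⟨⟨y, hy⟩, rfl⟩
      exact ⟨y, hy, by rw [Ev.On.port_eq hD (e := .send l) hy]⟩
  · simp [h, fillP]

theorem projRecv_iff (hD : UniqueBinders D) (qs : Finset Role) (l : Label) (P P' : LocalP B) :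
    ProjRecv D γ s qs l P P' ↔
      (∀ e ∈ (if s ∈ qs then [Ev.recv l] else []), ∃ x, e.On D s x) ∧
      P' = fillP (portOf D s) γ (if s ∈ qs then [.recv l] else []) P := by
  unfold ProjRecv
  by_cases h : s ∈ qs
  · simp only [h, true_and, if_true, List.mem_singleton, forall_eq, fillP, List.foldr, Ev.pre,
      not_true, false_and, or_false]
    constructor
    · rintro ⟨y, hy, rfl⟩
      exact ⟨⟨y, hy⟩, by rw [Ev.On.port_eq hD (e := .recv l) hy]⟩
    · rintro ⟨⟨y, hy⟩, rfl⟩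
      exact ⟨y, hy, by rw [Ev.On.port_eq hD (e := .recv l) hy]⟩
  · simp [h, fillP]

theorem proj_fillG_iff (hD : UniqueBinders D) (I : List (Item V)) (R : Global V) (P : LocalP B) :
    Proj ty D γ s (fillG I R) P ↔ (∀ e ∈ view s I, ∃ x, e.On D s x) ∧
      (∀ i ∈ I, i.Typed ty γ) ∧ ∃ Q, Proj ty D γ s R Q ∧ P = fillP (portOf D s) γ (view s I) Q := by
  induction I generalizing P with
  | nil => simp [fillG, view, fillP]
  | cons i I ih =>
    have key : Proj ty D γ s (fillG (i :: I) R) P ↔ (∀ e ∈ i.view s, ∃ x, e.On D s x) ∧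
        i.Typed ty γ ∧ ∃ P', Proj ty D γ s (fillG I R) P' ∧
          P = fillP (portOf D s) γ (i.view s) P' := by
      cases i with
      | comm p l qs =>
        constructor
        · intro h
          cases h with
          | comm _ _ _ _ P' P₁ _ h1 h2 h3 =>
            rw [projRecv_iff hD] at h2
            rw [projSend_iff hD] at h3
            refine ⟨?_, trivial, P', h1, ?_⟩
            · intro e he
              rcases List.mem_append.1 he with he | he
              · exact h3.1 e he
              · exact h2.1 e he
            · rw [h3.2, h2.2]; simp only [Item.view, fillP_append]
        · rintro ⟨h1, _, P', h2, rfl⟩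
          refine .comm p l qs _ P' (fillP (portOf D s) γ (if s ∈ qs then [.recv l] else []) P') _ h2
            ((projRecv_iff hD _ _ _ _).2 ⟨fun e he => h1 e ?_, rfl⟩)
            ((projSend_iff hD _ _ _ _).2 ⟨fun e he => h1 e ?_, ?_⟩)
          · exact List.mem_append_right _ he
          · exact List.mem_append_left _ he
          · simp only [Item.view, fillP_append]
      | msg l v qs =>
        constructor
        · intro h
          cases h with
          | msg _ _ _ _ P' _ h0 h1 h2 =>
            rw [projRecv_iff hD] at h2
            exact ⟨h2.1, h0, P', h1, h2.2⟩
        · rintro ⟨h1, h0, P', h2, rfl⟩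
          exact .msg l v qs _ P' _ h0 h2 ((projRecv_iff hD _ _ _ _).2 ⟨h1, rfl⟩)
    rw [key]
    constructor
    · rintro ⟨h1, h2, P', h3, rfl⟩
      obtain ⟨h4, h5, Q, h6, rfl⟩ := (ih _).1 h3
      refine ⟨?_, ?_, Q, h6, ?_⟩
      · intro e he
        rcases List.mem_append.1 he with he | he
        · exact h1 e he
        · exact h4 e he
      · simpa using ⟨h2, h5⟩
      · rw [view_cons, fillP_append]
    · rintro ⟨h1, h2, Q, h3, rfl⟩
      rw [view_cons] at h1
      refine ⟨fun e he => h1 e (List.mem_append_left _ he), h2 i (by simp), _,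
        (ih _).2 ⟨fun e he => h1 e (List.mem_append_right _ he),
          fun j hj => h2 j (by simp [hj]), Q, h3, rfl⟩, ?_⟩
      rw [view_cons, fillP_append]

theorem proj_tail_iff (hD : UniqueBinders D) (R : Tail V) (Q : LocalP B) :
    Proj ty D γ s R.global Q ↔ (∀ e ∈ view s R.body, ∃ x, e.On D s x) ∧
      (∀ i ∈ R.body, i.Typed ty γ) ∧ Q = R.proj (portOf D s) γ s := by
  cases R with
  | done =>
    constructor
    · intro h; cases h; simp [Tail.body, view, Tail.proj]
    · rintro ⟨_, _, rfl⟩; exact .done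
  | var X =>
    constructor
    · intro h; cases h; simp [Tail.body, view, Tail.proj]
    · rintro ⟨_, _, rfl⟩; exact .var X
  | loop X b =>
    have hv : ∀ Q, Proj ty D γ s (.var X) Q ↔ Q = .var X := by
      intro Q
      constructor
      · intro h; cases h; rfl
      · rintro rfl; exact .var X
    constructor
    · intro h
      cases h with
      | mu _ _ P h =>
        obtain ⟨h1, h2, Q, h3, rfl⟩ := (proj_fillG_iff hD _ _ _).1 h
        rw [(hv _).1 h3]
        exact ⟨h1, h2, rfl⟩
    · rintro ⟨h1, h2, rfl⟩
      exact .mu X _ _ ((proj_fillG_iff hD _ _ _).2 ⟨h1, h2, _, (hv _).2 rfl, rfl⟩)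

/-- The local protocol of a role is a function of its words of events. Hence a protocol step affects
projection only through `view` and the typing of messages in transit. -/
theorem proj_iff (hD : UniqueBinders D) (I : List (Item V)) (R : Tail V) (P : LocalP B) :
    Proj ty D γ s (fillG I R.global) P ↔
      (∀ e ∈ view s I ++ view s R.body, ∃ x, e.On D s x) ∧ (∀ i ∈ I ++ R.body, i.Typed ty γ) ∧
      P = fillP (portOf D s) γ (view s I) (R.proj (portOf D s) γ s) := by
  rw [proj_fillG_iff hD]
  simp only [proj_tail_iff hD, List.mem_append, or_imp, forall_and]
  constructor
  · rintro ⟨h1, h2, Q, ⟨h3, h4, rfl⟩, rfl⟩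
    exact ⟨⟨h1, h3⟩, ⟨h2, h4⟩, rfl⟩
  · rintro ⟨⟨h1, h3⟩, ⟨h2, h4⟩, rfl⟩
    exact ⟨h1, h2, _, ⟨h3, h4, rfl⟩, rfl⟩

/-! ### Conformance of closed protocols -/

theorem conforms_fillP_iff (σ : Ev → Port) (γ : Label → B) (w : List Ev) (Q : LocalP B)
    (Γ : RecVar → Option (CType ℕ∞ B)) (T : CType ℕ∞ B) :
    Conforms Γ T (fillP σ γ w Q) ↔
      ∃ T₁, CType.Run (w.map (Ev.act σ γ)) T T₁ ∧ Conforms Γ T₁ Q := by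
  induction w generalizing T with
  | nil => simp [fillP, CType.Run]
  | cons e w ih =>
    cases e with
    | send l =>
      simp only [fillP, List.foldr, Ev.pre, List.map_cons, CType.Run, Ev.act]
      constructor
      · intro h
        cases h with
        | send _ _ T' _ _ _ h1 h2 =>
          obtain ⟨T₁, h3, h4⟩ := (ih T').1 h2
          exact ⟨T₁, ⟨T', h1, h3⟩, h4⟩
      · rintro ⟨T₁, ⟨T', h1, h3⟩, h4⟩
        exact .send _ _ T' _ _ _ h1 ((ih T').2 ⟨T₁, h3, h4⟩)
    | recv l =>
      simp only [fillP, List.foldr, Ev.pre, List.map_cons, CType.Run, Ev.act]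
      constructor
      · intro h
        cases h with
        | recv _ _ T' _ _ _ h1 h2 =>
          obtain ⟨T₁, h3, h4⟩ := (ih T').1 h2
          exact ⟨T₁, ⟨T', h1, h3⟩, h4⟩
      · rintro ⟨T₁, ⟨T', h1, h3⟩, h4⟩
        exact .recv _ _ T' _ _ _ h1 ((ih T').2 ⟨T₁, h3, h4⟩)

/-- `T` can carry out `w` and then repeat `b`. -/
def Loops (w b : List (Act B)) (T : CType ℕ∞ B) : Prop :=
  ∃ T₁ T₂, CType.Run w T T₁ ∧ CType.Run b T₁ T₂ ∧ CType.Le T₁ T₂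

/-- The environment is consulted only at the end of the loop, where it holds the type from the
beginning of the loop. For `done` the body is empty and looping is trivial; a protocol that ends in
a free variable admits no type. -/
theorem conforms_iff (σ : Ev → Port) (γ : Label → B) (s : Role) (w : List Ev) (R : Tail V)
    (T : CType ℕ∞ B) :
    Conforms (fun _ => none) T (fillP σ γ w (R.proj σ γ s)) ↔
      (∀ X, R ≠ .var X) ∧ Loops (w.map (Ev.act σ γ)) ((view s R.body).map (Ev.act σ γ)) T := by
  rw [conforms_fillP_iff]
  cases R with
  | done =>
    constructor
    · rintro ⟨T₁, h1, h2⟩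
      exact ⟨by simp, T₁, T₁, h1, rfl, .refl⟩
    · rintro ⟨_, T₁, T₂, h1, h2, h3⟩
      exact ⟨T₁, h1, .done _ _⟩
  | var X =>
    constructor
    · rintro ⟨T₁, h1, h2⟩
      cases h2 with
      | var _ _ _ _ h => simp at h
    · rintro ⟨h, _⟩
      exact absurd rfl (h X)
  | loop X b =>
    constructor
    · rintro ⟨T₁, h1, h2⟩
      refine ⟨by simp, T₁, ?_⟩
      cases h2 with
      | mu _ _ _ _ h =>
        obtain ⟨T₂, h3, h4⟩ := (conforms_fillP_iff _ _ _ _ _ _).1 h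
        cases h4 with
        | var _ _ T' _ h5 h6 =>
          simp only [Function.update_self, Option.some.injEq] at h5
          subst h5
          exact ⟨T₂, h1, h3, h6⟩
    · rintro ⟨_, T₁, T₂, h1, h2, h3⟩
      exact ⟨T₁, h1, .mu _ _ _ _ ((conforms_fillP_iff _ _ _ _ _ _).2
        ⟨T₂, h2, .var _ _ T₁ X (by simp) h3⟩)⟩

/-- The type after a round arises from the one before it by extra inputs, so `CType.Le.run` provides
the next round together with the same comparison. -/
theorem Loops.unfold {w b : List (Act B)} {T : CType ℕ∞ B} (h : Loops w b T) (m : ℕ) :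
    Loops (w ++ copies m b) b T := by
  induction m with
  | zero => simpa [copies] using h
  | succ m ih =>
    obtain ⟨T₁, T₂, h1, h2, h3⟩ := ih
    obtain ⟨T₃, h4, h5⟩ := h3.run h2
    refine ⟨T₂, T₃, ?_, h4, h5⟩
    rw [copies_succ', ← List.append_assoc, CType.run_append]
    exact ⟨T₁, h1, h2⟩

theorem Loops.step {w b : List (Act B)} {a : Act B} {T T' : CType ℕ∞ B} (h : Loops (a :: w) b T)
    (hs : CType.Step T a T') : Loops w b T' := by
  obtain ⟨T₁, T₂, ⟨T'', h1, h1'⟩, h2, h3⟩ := h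
  cases hs.deterministic h1
  exact ⟨T₁, T₂, h1', h2, h3⟩

/-- An output outside the protocol commutes with the run and with the loop. -/
theorem Loops.other_out {w b : List (Act B)} {y : Port} {c : B} {T T' : CType ℕ∞ B}
    (h : Loops w b T) (hs : CType.Step T (.out y c) T') (hw : ∀ c, Act.out y c ∉ w ++ b) :
    Loops w b T' := by
  obtain ⟨T₁, T₂, h1, h2, h3⟩ := h
  obtain ⟨T₁', h4, h5⟩ := CType.run_diamond hs h1 (by
    rintro _ _ b' ⟨rfl, rfl⟩ h; exact hw b' (List.mem_append_left _ h))
  obtain ⟨T₂', h6, h7⟩ := CType.run_diamond h5 h2 (by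
    rintro _ _ b' ⟨rfl, rfl⟩ h; exact hw b' (List.mem_append_right _ h))
  obtain ⟨T₂'', h8, h9⟩ := h3.step h5
  -- Pushing the output through the comparison and through the body leads to the same type, by
  -- determinism.
  cases h8.deterministic h7
  exact ⟨T₁', _, h4, h6, h9⟩

end

/-! ### Words obtained by unrolling a repetition -/

section words
variable {α : Type*}

/-- Some `b` is preceded by neither `a` nor `b`. -/
def Flows (a b : α) (w : List α) : Prop :=
  ∃ c q, w = c ++ b :: q ∧ b ∉ c ∧ a ∉ c

open Classical in
-- Only the letters `a` and `b` matter: deleting all others turns the condition into one on a first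
-- letter.
theorem flows_iff (a b : α) (w : List α) :
    Flows a b w ↔ (w.filter fun e => e = a ∨ e = b).head? = some b := by
  constructor
  · rintro ⟨c, q, rfl, hb, ha⟩
    have : c.filter (fun e => decide (e = a ∨ e = b)) = [] := by
      rw [List.filter_eq_nil_iff]
      intro e he
      simp only [decide_eq_true_eq]
      rintro (rfl | rfl)
      · exact ha he
      · exact hb he
    rw [List.filter_append, this]
    simp
  · intro h
    obtain ⟨q, hq⟩ : ∃ q, w.filter (fun e => decide (e = a ∨ e = b)) = b :: q := by
      cases hf : w.filter (fun e => decide (e = a ∨ e = b)) with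
      | nil => rw [hf] at h; simp at h
      | cons c q =>
        rw [hf] at h
        simp only [List.head?_cons, Option.some.injEq] at h
        exact ⟨q, by rw [h]⟩
    rw [List.filter_eq_cons_iff] at hq
    obtain ⟨c, q', rfl, hc, _, _⟩ := hq
    refine ⟨c, q', rfl, fun hb => ?_, fun ha => ?_⟩
    · simpa using hc b hb
    · simpa using hc a ha

theorem ne_of_pair_sublist {a b : α} {l : List α} (hl : l.Nodup) (h : [a, b].Sublist l) :
    a ≠ b := by
  have := h.nodup hl
  simpa using this

open Classical in
theorem filter_pair {a b : α} {l : List α} (hl : l.Nodup) (h : [a, b].Sublist l) :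
    l.filter (fun e => e = a ∨ e = b) = [a, b] := by
  have h1 := h.filter (fun e => decide (e = a ∨ e = b))
  rw [List.filter_eq_self.2 (by simp)] at h1
  refine (h1.eq_of_length_le ?_).symm
  have h2 : (l.filter (fun e => decide (e = a ∨ e = b))) ⊆ [a, b] := by
    intro e he
    simp only [List.mem_filter, decide_eq_true_eq] at he
    simpa using he.2
  exact ((hl.filter _).subperm h2).length_le

theorem filter_copies (p : α → Bool) (m : ℕ) (l : List α) :
    (copies m l).filter p = copies m (l.filter p) := by
  induction m with
  | zero => rfl
  | succ m ih => rw [copies_succ, copies_succ, List.filter_append, ih]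

theorem split_copies {a b : α} : ∀ {m : ℕ} {d f : List α}, d ++ f = copies m [a, b] →
    (∃ i j, d = copies i [a, b] ∧ f = copies j [a, b]) ∨
    (∃ i j, d = copies i [a, b] ++ [a] ∧ f = b :: copies j [a, b])
  | m, [], f, h => .inl ⟨0, m, rfl, h⟩
  | 0, x :: d, f, h => by simp [copies] at h
  | m + 1, [x], f, h => by
    simp only [copies_succ, List.cons_append, List.nil_append, List.cons.injEq] at h
    exact .inr ⟨0, m, by rw [h.1]; rfl, h.2⟩
  | m + 1, x :: y :: d, f, h => by
    simp only [copies_succ, List.cons_append, List.nil_append, List.cons.injEq] at h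
    obtain ⟨rfl, rfl, h⟩ := h
    rcases split_copies h with ⟨i, j, rfl, rfl⟩ | ⟨i, j, rfl, rfl⟩
    · exact .inl ⟨i + 1, j, rfl, rfl⟩
    · exact .inr ⟨i + 1, j, rfl, rfl⟩

theorem head_copies_ne {a b : α} (h : a ≠ b) (j : ℕ) : (copies j [a, b]).head? ≠ some b := by
  cases j with
  | zero => simp [copies]
  | succ j => simpa [copies_succ] using h

/-- `d ++ w` is an execution of `A` and then of some copies of `Bd`. -/
structure Unrolled (A Bd d w : List α) : Prop where
  nodup : (A ++ Bd).Nodup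
  eq : ∃ m, A ++ copies m Bd = d ++ w

namespace Unrolled
variable {A Bd d w : List α} {a b : α}

theorem body_nodup (h : Unrolled A Bd d w) : Bd.Nodup := (List.nodup_append.1 h.nodup).2.1

theorem disjoint (h : Unrolled A Bd d w) {e : α} (h₁ : e ∈ A) (h₂ : e ∈ Bd) : False :=
  (List.nodup_append.1 h.nodup).2.2 e h₁ e h₂ rfl

theorem mem_or (h : Unrolled A Bd d w) {e : α} (he : e ∈ d ++ w) : e ∈ A ∨ e ∈ Bd := by
  obtain ⟨m, hm⟩ := h.eq
  rw [← hm] at he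
  rcases List.mem_append.1 he with he | he
  · exact .inl he
  · exact .inr (mem_copies he)

theorem unfold (h : Unrolled A Bd d w) (k : ℕ) : Unrolled A Bd d (w ++ copies k Bd) := by
  obtain ⟨m, hm⟩ := h.eq
  exact ⟨h.nodup, m + k, by rw [copies_add, ← List.append_assoc, hm, List.append_assoc]⟩

theorem step {e : α} (h : Unrolled A Bd d (e :: w)) : Unrolled A Bd (d ++ [e]) w := by
  obtain ⟨m, hm⟩ := h.eq
  exact ⟨h.nodup, m, by simpa using hm⟩

open Classical in
-- As the letters are distinct, each copy of `Bd` keeps just $ab$ and `A` keeps nothing, so the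
-- whole execution restricts to $(ab)^m$. The facts below about `Flows` are read off from whether
-- the cut falls between two pairs or inside one.
theorem filter_split (h : Unrolled A Bd d w) (hab : [a, b].Sublist Bd) :
    (∃ i j, d.filter (fun e => e = a ∨ e = b) = copies i [a, b] ∧
      w.filter (fun e => e = a ∨ e = b) = copies j [a, b]) ∨
    (∃ i j, d.filter (fun e => e = a ∨ e = b) = copies i [a, b] ++ [a] ∧
      w.filter (fun e => e = a ∨ e = b) = b :: copies j [a, b]) := by
  obtain ⟨m, hm⟩ := h.eq
  have hA : A.filter (fun e => decide (e = a ∨ e = b)) = [] := by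
    rw [List.filter_eq_nil_iff]
    intro e he
    simp only [decide_eq_true_eq]
    rintro (rfl | rfl)
    · exact h.disjoint he (hab.subset (by simp))
    · exact h.disjoint he (hab.subset (by simp))
  have h1 := congrArg (List.filter fun e => decide (e = a ∨ e = b)) hm
  rw [List.filter_append, List.filter_append, hA, filter_copies,
    filter_pair h.body_nodup hab] at h1
  exact split_copies h1.symm

/-- If `b` comes first in the rest, the cut lies inside a pair whose `a` is already done. -/
theorem mem_of_flows (h : Unrolled A Bd d w) (hab : [a, b].Sublist Bd) (hf : Flows a b w) :
    a ∈ d := by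
  classical
  rw [flows_iff] at hf
  rcases h.filter_split hab with ⟨i, j, h1, h2⟩ | ⟨i, j, h1, h2⟩
  · rw [h2] at hf
    exact absurd hf (head_copies_ne (ne_of_pair_sublist h.body_nodup hab) j)
  · have : a ∈ d.filter (fun e => decide (e = a ∨ e = b)) := by rw [h1]; simp
    exact List.mem_of_mem_filter this

theorem mem_of_mem (h : Unrolled A Bd d w) (hab : [a, b].Sublist Bd) (hb : b ∈ d) : a ∈ d := by
  classical
  have hb' : b ∈ d.filter (fun e => decide (e = a ∨ e = b)) := by simp [hb]
  suffices a ∈ d.filter (fun e => decide (e = a ∨ e = b)) from List.mem_of_mem_filter this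
  rcases h.filter_split hab with ⟨i, j, h1, h2⟩ | ⟨i, j, h1, h2⟩
  · rw [h1] at hb' ⊢
    cases i with
    | zero => simp [copies] at hb'
    | succ i => simp [copies_succ]
  · rw [h1]; simp

/-- Further copies matter only if neither letter is left in the rest, and then they contribute an
`a` first. -/
theorem flows_unfold (h : Unrolled A Bd d w) (hab : [a, b].Sublist Bd) (k : ℕ) :
    Flows a b (w ++ copies k Bd) ↔ Flows a b w := by
  classical
  rw [flows_iff, flows_iff, List.filter_append, filter_copies, filter_pair h.body_nodup hab]
  have hne := ne_of_pair_sublist h.body_nodup hab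
  cases hf : w.filter (fun e => decide (e = a ∨ e = b)) with
  | nil => simpa using head_copies_ne hne k
  | cons => simp

theorem not_flows_tail (h : Unrolled A Bd d (b :: w)) (hab : [a, b].Sublist Bd) :
    ¬ Flows a b w := by
  classical
  rw [flows_iff]
  have hne := ne_of_pair_sublist h.body_nodup hab
  rcases h.filter_split hab with ⟨i, j, h1, h2⟩ | ⟨i, j, h1, h2⟩
  · have := congrArg List.head? h2
    simp only [List.filter_cons, or_true, decide_true, if_true, List.head?_cons] at this
    exact absurd this.symm (head_copies_ne hne j)
  · simp only [List.filter_cons, or_true, decide_true, if_true, List.cons.injEq, true_and] at h2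
    rw [h2]
    exact head_copies_ne hne j

theorem flows_tail (h : Unrolled A Bd d (a :: w)) (hab : [a, b].Sublist Bd) : Flows a b w := by
  classical
  rw [flows_iff]
  have hne := ne_of_pair_sublist h.body_nodup hab
  rcases h.filter_split hab with ⟨i, j, h1, h2⟩ | ⟨i, j, h1, h2⟩
  · cases j with
    | zero => simp [copies] at h2
    | succ j =>
      simp only [List.filter_cons, true_or, decide_true, if_true, copies_succ, List.cons_append,
        List.cons.injEq, true_and] at h2
      rw [h2]; rfl
  · simp [hne] at h2

/-- An event outside the repetition occurs once in the execution, so it cannot be both done and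
pending. -/
theorem not_mem_of_mem {e : α} (h : Unrolled A Bd d w) (he : e ∈ w) (hB : e ∉ Bd) : e ∉ d := by
  intro hd
  have hA : e ∈ A := (h.mem_or (List.mem_append_left _ hd)).resolve_right hB
  obtain ⟨m, hm⟩ := h.eq
  classical
  have h1 := congrArg (List.count e) hm
  rw [List.count_append, List.count_append,
    List.count_eq_one_of_mem (List.nodup_append.1 h.nodup).1 hA,
    List.count_eq_zero_of_not_mem (l := copies m Bd) fun h => hB (mem_copies h)] at h1
  have h2 := List.count_pos_iff.2 hd
  have h3 := List.count_pos_iff.2 he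
  omega

/-- Nothing is repeated before the last event outside of the repetition. -/
theorem not_mem_of_pending {e : α} (h : Unrolled A Bd d w) (ha : a ∈ w) (hB : a ∉ Bd)
    (he : e ∈ Bd) : e ∉ d := by
  intro hd
  obtain ⟨m, hm⟩ := h.eq
  -- Either the cut lies behind `A`, so that the rest consists of repeated events only, or the done
  -- part is a piece of `A`.
  rcases List.append_eq_append_iff.1 hm with ⟨c, rfl, h2⟩ | ⟨c, h1, rfl⟩
  · have : a ∈ copies m Bd := by rw [h2]; exact List.mem_append_right _ ha
    exact hB (mem_copies this)
  · exact h.disjoint (by rw [h1]; exact List.mem_append_left _ hd) he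

end Unrolled
end words

/-! ### Relations on local protocols in terms of words -/

section
variable {V : Type u} {B : Type v} {σ : Ev → Port} {γ : Label → B} {s : Role}
variable {w : List Ev} {R : Tail V}

theorem fp_fillP (w : List Ev) (Q : LocalP B) : (fillP σ γ w Q).fp = w.map σ ++ Q.fp := by
  induction w with
  | nil => rfl
  | cons e w ih => cases e <;> simpa [fillP, Ev.pre, LocalP.fp] using ih

theorem rep_fillP (w : List Ev) (Q : LocalP B) : (fillP σ γ w Q).rep = Q.rep := by
  induction w with
  | nil => rfl
  | cons e w ih => cases e <;> simpa [fillP, Ev.pre, LocalP.rep] using ih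

theorem fp_proj : (R.proj σ γ s).fp = (view s R.body).map σ := by
  cases R <;> simp [Tail.proj, Tail.body, LocalP.fp, fp_fillP, view]

theorem rep_proj : (R.proj σ γ s).rep = (view s R.body).map σ := by
  cases R <;> simp [Tail.proj, Tail.body, LocalP.fp, LocalP.rep, fp_fillP, view]

/-- Neither an input nor an output comes first. -/
def LocalP.Atomic : LocalP B → Prop
  | .recv _ _ _ => False
  | .send _ _ _ => False
  | _ => True

theorem atomic_proj : (R.proj σ γ s).Atomic := by
  cases R <;> trivial

/-- Contexts contain no recursion and `Q` starts with neither an input nor an output, so the hole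
cannot lie beyond the prefix `w`. -/
theorem fill_split {C : Ctx B} {Q Z : LocalP B} (hQ : Q.Atomic) (h : fillP σ γ w Q = C.fill Z) :
    ∃ w₁ w₂, w = w₁ ++ w₂ ∧ Z = fillP σ γ w₂ Q ∧ C.fp = w₁.map σ := by
  induction C generalizing w with
  | hole => exact ⟨[], w, rfl, h.symm, rfl⟩
  | recv x b C ih =>
    cases w with
    | nil => simp only [fillP, List.foldr] at h; subst h; exact hQ.elim
    | cons e w =>
      cases e with
      | send => simp [fillP, Ev.pre, Ctx.fill] at h
      | recv l =>
        simp only [fillP, List.foldr, Ev.pre, Ctx.fill, LocalP.recv.injEq] at h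
        obtain ⟨w₁, w₂, rfl, h2, h3⟩ := ih h.2.2
        exact ⟨.recv l :: w₁, w₂, rfl, h2, by simp [Ctx.fp, h3, h.1]⟩
  | send x b C ih =>
    cases w with
    | nil => simp only [fillP, List.foldr] at h; subst h; exact hQ.elim
    | cons e w =>
      cases e with
      | recv => simp [fillP, Ev.pre, Ctx.fill] at h
      | send l =>
        simp only [fillP, List.foldr, Ev.pre, Ctx.fill, LocalP.send.injEq] at h
        obtain ⟨w₁, w₂, rfl, h2, h3⟩ := ih h.2.2
        exact ⟨.send l :: w₁, w₂, rfl, h2, by simp [Ctx.fp, h3, h.1]⟩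

theorem exists_ctx (w : List Ev) : ∃ C : Ctx B, (∀ Z, fillP σ γ w Z = C.fill Z) ∧
    C.fp = w.map σ := by
  induction w with
  | nil => exact ⟨.hole, fun _ => rfl, rfl⟩
  | cons e w ih =>
    obtain ⟨C, h1, h2⟩ := ih
    cases e with
    | send l =>
      exact ⟨.send (σ (.send l)) (γ l) C, fun Z => by simp [Ctx.fill, ← h1]; rfl,
        by simp [Ctx.fp, h2]⟩
    | recv l =>
      exact ⟨.recv (σ (.recv l)) (γ l) C, fun Z => by simp [Ctx.fill, ← h1]; rfl,
        by simp [Ctx.fp, h2]⟩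

theorem fillP_eq_send {Q Z : LocalP B} {y : Port} {b : B} (hQ : Q.Atomic)
    (h : LocalP.send y b Z = fillP σ γ w Q) :
    ∃ l w', w = .send l :: w' ∧ y = σ (.send l) ∧ Z = fillP σ γ w' Q := by
  rcases w with _ | ⟨_ | _, w⟩
  · simp only [fillP, List.foldr] at h; subst h; exact hQ.elim
  · simp only [fillP, List.foldr, Ev.pre, LocalP.send.injEq] at h
    exact ⟨_, w, rfl, h.1, h.2.2⟩
  · simp [fillP, Ev.pre] at h

theorem fillP_eq_recv {Q Z : LocalP B} {y : Port} {b : B} (hQ : Q.Atomic)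
    (h : LocalP.recv y b Z = fillP σ γ w Q) :
    ∃ l w', w = .recv l :: w' ∧ y = σ (.recv l) ∧ Z = fillP σ γ w' Q := by
  rcases w with _ | ⟨_ | _, w⟩
  · simp only [fillP, List.foldr] at h; subst h; exact hQ.elim
  · simp [fillP, Ev.pre] at h
  · simp only [fillP, List.foldr, Ev.pre, LocalP.recv.injEq] at h
    exact ⟨_, w, rfl, h.1, h.2.2⟩

theorem fillP_eq_mu {Z : LocalP B} {X : RecVar}
    (h : LocalP.mu X Z = fillP σ γ w (R.proj σ γ s)) :
    w = [] ∧ Z = fillP σ γ (view s R.body) (.var X) := by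
  rcases w with _ | ⟨_ | _, w⟩
  · cases R with
    | done => simp [fillP, Tail.proj] at h
    | var => simp [fillP, Tail.proj] at h
    | loop Y b =>
      simp only [fillP, List.foldr, Tail.proj, LocalP.mu.injEq] at h
      obtain ⟨rfl, rfl⟩ := h
      exact ⟨rfl, rfl⟩
  · simp [fillP, Ev.pre] at h
  · simp [fillP, Ev.pre] at h

theorem pair_sublist_iff {α : Type*} {a b : α} {l : List α} :
    [a, b].Sublist l ↔ ∃ l₁ l₂ l₃, l = l₁ ++ a :: (l₂ ++ b :: l₃) := by
  constructor
  · intro h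
    obtain ⟨r₁, r₂, rfl, h1, h2⟩ := List.cons_sublist_iff.1 h
    obtain ⟨s₁, s₂, rfl⟩ := List.append_of_mem h1
    obtain ⟨t₁, t₂, rfl⟩ := List.append_of_mem (List.singleton_sublist.1 h2)
    exact ⟨s₁, s₂ ++ t₁, t₂, by simp⟩
  · rintro ⟨l₁, l₂, l₃, rfl⟩
    refine List.Sublist.trans ?_ (List.sublist_append_right _ _)
    refine List.Sublist.cons_cons _ ?_
    exact List.singleton_sublist.2 (by simp)

theorem fill_pair_iff {Q : LocalP B} (hQ : Q.Atomic) (y x : Port) :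
    (∃ (C C' : Ctx B) (b b' : B) (Z : LocalP B),
      fillP σ γ w Q = C.fill (.send y b' (C'.fill (.recv x b Z)))) ↔
    ∃ l' l, y = σ (.send l') ∧ x = σ (.recv l) ∧ [Ev.send l', Ev.recv l].Sublist w := by
  constructor
  · rintro ⟨C, C', b, b', Z, h⟩
    obtain ⟨w₁, w₂, rfl, h1, _⟩ := fill_split hQ h
    obtain ⟨l', w₃, rfl, hy, h2⟩ := fillP_eq_send hQ h1
    obtain ⟨w₄, w₅, rfl, h3, _⟩ := fill_split hQ h2.symm
    obtain ⟨l, w₆, rfl, hx, _⟩ := fillP_eq_recv hQ h3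
    exact ⟨l', l, hy, hx, pair_sublist_iff.2 ⟨_, _, _, rfl⟩⟩
  · rintro ⟨l', l, rfl, rfl, h⟩
    obtain ⟨w₁, w₂, w₃, rfl⟩ := pair_sublist_iff.1 h
    obtain ⟨C, hC, _⟩ := exists_ctx (σ := σ) (γ := γ) w₁
    obtain ⟨C', hC', _⟩ := exists_ctx (σ := σ) (γ := γ) w₂
    refine ⟨C, C', γ l, γ l', fillP σ γ w₃ Q, ?_⟩
    rw [← hC, ← hC', fillP_append]
    congr 1
    simp only [fillP, List.foldr_cons, List.foldr_append, Ev.pre]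

theorem mem_fp_iff {x : Port} : x ∈ (fillP σ γ w (R.proj σ γ s)).fp ↔
    x ∈ w.map σ ∨ x ∈ (view s R.body).map σ := by
  rw [fp_fillP, fp_proj, List.mem_append]

theorem rep_eq : (fillP σ γ w (R.proj σ γ s)).rep = (view s R.body).map σ := by
  rw [rep_fillP, rep_proj]

theorem rel1_iff {y x : Port} : (fillP σ γ w (R.proj σ γ s)).Rel1 y x ↔
    (∃ l' l, y = σ (.send l') ∧ x = σ (.recv l) ∧ [Ev.send l', Ev.recv l].Sublist w) ∧
      x ∉ (view s R.body).map σ ∧ y ∉ (view s R.body).map σ := by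
  unfold LocalP.Rel1
  rw [rep_eq, fill_pair_iff atomic_proj]

theorem rel2_iff {y x : Port} : (fillP σ γ w (R.proj σ γ s)).Rel2 y x ↔
    (∃ l' l, y = σ (.send l') ∧ x = σ (.recv l) ∧ Ev.send l' ∈ w ∧ Ev.recv l ∈ view s R.body) ∧
      y ∉ (view s R.body).map σ := by
  unfold LocalP.Rel2
  rw [rep_eq]
  refine and_congr_left fun _ => ?_
  constructor
  · rintro ⟨C, C', C'', X, b, b', Z, h⟩
    obtain ⟨w₁, w₂, rfl, h1, _⟩ := fill_split atomic_proj h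
    obtain ⟨l', w₃, rfl, hy, h2⟩ := fillP_eq_send atomic_proj h1
    obtain ⟨w₄, w₅, rfl, h3, _⟩ := fill_split atomic_proj h2.symm
    obtain ⟨rfl, h4⟩ := fillP_eq_mu h3
    obtain ⟨w₆, w₇, h5, h6, _⟩ := fill_split (Q := .var X) trivial h4.symm
    obtain ⟨l, w₈, rfl, hx, _⟩ := fillP_eq_recv (Q := .var X) trivial h6
    exact ⟨l', l, hy, hx, by simp, by rw [h5]; simp⟩
  · rintro ⟨l', l, rfl, rfl, h1, h2⟩
    cases R with
    | done => simp [Tail.body, view] at h2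
    | var => simp [Tail.body, view] at h2
    | loop X b =>
      simp only [Tail.body] at h2
      obtain ⟨w₁, w₂, rfl⟩ := List.append_of_mem h1
      obtain ⟨w₃, w₄, h3⟩ := List.append_of_mem h2
      obtain ⟨C, hC, _⟩ := exists_ctx (σ := σ) (γ := γ) w₁
      obtain ⟨C', hC', _⟩ := exists_ctx (σ := σ) (γ := γ) w₂
      obtain ⟨C'', hC'', _⟩ := exists_ctx (σ := σ) (γ := γ) w₃
      refine ⟨C, C', C'', X, γ l, γ l', fillP σ γ w₄ (.var X), ?_⟩
      rw [← hC, ← hC', ← hC'', fillP_append]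
      congr 1
      simp only [Tail.proj, h3]
      simp only [fillP, List.foldr_cons, List.foldr_append, Ev.pre]

theorem rel3_iff {y x : Port} : (fillP σ γ w (R.proj σ γ s)).Rel3 y x ↔
    ∃ l' l, y = σ (.send l') ∧ x = σ (.recv l) ∧
      [Ev.send l', Ev.recv l].Sublist (view s R.body) := by
  unfold LocalP.Rel3
  constructor
  · rintro ⟨C, C', C'', X, b, b', Z, h⟩
    obtain ⟨w₁, w₂, rfl, h1, _⟩ := fill_split atomic_proj h
    obtain ⟨rfl, h2⟩ := fillP_eq_mu h1
    exact (fill_pair_iff (Q := .var X) trivial y x).1 ⟨C', C'', b, b', Z, h2.symm⟩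
  · intro h
    cases R with
    | done => obtain ⟨_, _, _, _, h⟩ := h; simp [Tail.body, view] at h
    | var => obtain ⟨_, _, _, _, h⟩ := h; simp [Tail.body, view] at h
    | loop X b =>
      obtain ⟨C', C'', c, c', Z, h1⟩ :=
        (fill_pair_iff (σ := σ) (γ := γ) (Q := LocalP.var X) trivial y x).2 h
      obtain ⟨C, hC, _⟩ := exists_ctx (σ := σ) (γ := γ) w
      refine ⟨C, C', C'', X, c, c', Z, ?_⟩
      simp only [Tail.body] at h1
      rw [← hC, ← h1]
      rfl

/-- Different events use different ports. -/
def InjOn (σ : Ev → Port) (l : List Ev) : Prop :=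
  ∀ e ∈ l, ∀ e' ∈ l, σ e = σ e' → e = e'

open Classical in
-- The value `vf` speaks of ports and `Flows` of events; injectivity of the port assignment is what
-- identifies them.
theorem vf_eq (hσ : InjOn σ (w ++ view s R.body)) {l' l : Label}
    (h : [Ev.send l', Ev.recv l].Sublist (view s R.body)) :
    (fillP σ γ w (R.proj σ γ s)).vf (σ (.recv l)) (σ (.send l')) =
      if Flows (.send l') (.recv l) w then 1 else 0 := by
  unfold LocalP.vf
  congr 1
  rw [eq_iff_iff]
  unfold LocalP.Flowing
  rw [and_iff_right (rel3_iff.2 ⟨l', l, rfl, rfl, h⟩)]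
  have hx : Ev.recv l ∈ w ++ view s R.body := List.mem_append_right _ (h.subset (by simp))
  have hy : Ev.send l' ∈ w ++ view s R.body := List.mem_append_right _ (h.subset (by simp))
  constructor
  · rintro ⟨C, b, Z, h1, h2, h3⟩
    obtain ⟨w₁, w₂, rfl, h4, h5⟩ := fill_split atomic_proj h1
    obtain ⟨l₁, w₃, rfl, h6, _⟩ := fillP_eq_recv atomic_proj h4
    have := hσ _ hx (.recv l₁) (by simp) h6
    cases this
    rw [h5] at h2 h3
    exact ⟨w₁, w₃, rfl, fun h => h2 (List.mem_map_of_mem h), fun h => h3 (List.mem_map_of_mem h)⟩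
  · rintro ⟨w₁, w₂, rfl, h2, h3⟩
    obtain ⟨C, hC, hfp⟩ := exists_ctx (σ := σ) (γ := γ) w₁
    refine ⟨C, γ l, fillP σ γ w₂ (R.proj σ γ s), ?_, ?_, ?_⟩
    · rw [← hC, fillP_append]; rfl
    · rw [hfp]
      intro hm
      obtain ⟨e, he, he'⟩ := List.mem_map.1 hm
      rw [hσ e (by simp [he]) _ hx he'] at he
      exact h2 he
    · rw [hfp]
      intro hm
      obtain ⟨e, he, he'⟩ := List.mem_map.1 hm
      rw [hσ e (by simp [he]) _ hy he'] at he
      exact h3 he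

end

/-! ### Executions and the pasts of subcomponents -/

section
variable {V : Type u} {B : Type v} {ty : V → B}

/-- Executions of components with their actions. -/
inductive Trace : Component ty → List (Act V) → Component ty → Prop
  | nil (K : Component ty) : Trace K [] K
  | snoc {K K' K'' : Component ty} {t : List (Act V)} {a : Act V} :
      Trace K t K' → Component.Step K' a K'' → Trace K (t ++ [a]) K''

theorem Component.Runtime.exists_trace {K : Component ty} (h : K.Runtime) :
    ∃ K₀ t, K₀.Initial ∧ Trace K₀ t K := by
  obtain ⟨K₀, h0, h⟩ := h
  suffices ∃ t, Trace K₀ t K by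
    obtain ⟨t, ht⟩ := this
    exact ⟨K₀, t, h0, ht⟩
  induction h with
  | refl => exact ⟨[], .nil _⟩
  | tail _ hs ih =>
    obtain ⟨t, ht⟩ := ih
    obtain ⟨a, ha⟩ := hs
    exact ⟨t ++ [a], ht.snoc ha⟩

def InpIn (x : Port) (t : List (Act V)) : Prop := ∃ v, Act.inp x v ∈ t

def OutIn (y : Port) (t : List (Act V)) : Prop := ∃ v, Act.out y v ∈ t

theorem InpIn.append {x : Port} {t : List (Act V)} (h : InpIn x t) (u : List (Act V)) :
    InpIn x (t ++ u) := h.imp fun _ h => List.mem_append_left _ h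

theorem OutIn.append {x : Port} {t : List (Act V)} (h : OutIn x t) (u : List (Act V)) :
    OutIn x (t ++ u) := h.imp fun _ h => List.mem_append_left _ h

theorem inpIn_snoc {x : Port} {t : List (Act V)} {a : Act V} :
    InpIn x (t ++ [a]) ↔ InpIn x t ∨ ∃ v, a = .inp x v := by
  simp [InpIn, exists_or, eq_comm]

theorem outIn_snoc {x : Port} {t : List (Act V)} {a : Act V} :
    OutIn x (t ++ [a]) ↔ OutIn x t ∨ ∃ v, a = .out x v := by
  simp [OutIn, exists_or, eq_comm]

/-- What the past `t` of a base component says about its local binders. -/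
structure BaseHistory (t : List (Act V)) (L : List (LocalBinder ty)) : Prop where
  segmented : QueuesSegmented L
  stored : ∀ b ∈ L, ∀ σ ∈ b.queue, ∀ x w, σ x = some w → InpIn x t
  emitted : ∀ y, OutIn y t → ∃ b ∈ L, b.out = y ∧ ∀ x ∈ b.params, InpIn x t

theorem BaseHistory.step {t : List (Act V)} {L L' : List (LocalBinder ty)} {a : Act V}
    (h : BaseHistory t L) (hs : BindersStep L a L') : BaseHistory (t ++ [a]) L' := by
  refine ⟨h.segmented.step hs, ?_, ?_⟩
  · cases a with
    | tau => cases hs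
    | inp x v =>
      rw [hs.inp_eq]
      intro b hb σ hσ z w hz
      obtain ⟨c, hc, rfl⟩ := List.mem_map.1 hb
      unfold LocalBinder.recv at hσ
      split_ifs at hσ
      · rcases mem_enqueue hσ hz with ⟨rfl, _⟩ | ⟨τ, hτ, hz⟩
        · exact inpIn_snoc.2 (.inr ⟨v, rfl⟩)
        · exact (h.stored c hc τ hτ z w hz).append _
      · exact (h.stored c hc σ hσ z w hz).append _
    | out y v =>
      obtain ⟨L₁, L₂, b, b', rfl, rfl, rfl, he⟩ := hs.out_cases
      intro c hc σ hσ z w hz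
      refine InpIn.append ?_ _
      rcases List.mem_append.1 hc with hc | hc
      · exact h.stored c (by simp [hc]) σ hσ z w hz
      · rcases List.mem_cons.1 hc with rfl | hc
        · exact h.stored b (by simp) σ (he.mem_queue hσ) z w hz
        · exact h.stored c (by simp [hc]) σ hσ z w hz
  · cases a with
    | tau => cases hs
    | inp x v =>
      rw [hs.inp_eq]
      intro y hy
      rcases outIn_snoc.1 hy with hy | ⟨w, hw⟩
      · obtain ⟨b, hb, rfl, h2⟩ := h.emitted y hy
        refine ⟨b.recv x v, List.mem_map_of_mem hb, b.recv_out x v, fun z hz => ?_⟩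
        rw [LocalBinder.recv_params] at hz
        exact (h2 z hz).append _
      · cases hw
    | out y v =>
      obtain ⟨L₁, L₂, b, b', rfl, rfl, rfl, he⟩ := hs.out_cases
      have hb : ∀ x ∈ b.params, InpIn x t := by
        cases he with
        | nullary h0 => simp [h0]
        | complete σ q vs h1 h2 h3 =>
          intro x hx
          obtain ⟨w, hw⟩ := map_some_defined h3 hx
          exact h.stored b (by simp) σ (by simp [h2]) x w hw
      have hb' : ∀ x ∈ b'.params, InpIn x (t ++ [Act.out b.out v]) := by
        rw [he.params_eq]
        exact fun x hx => (hb x hx).append _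
      intro z hz
      rcases outIn_snoc.1 hz with hz | ⟨w, hw⟩
      · obtain ⟨c, hc, rfl, h2⟩ := h.emitted z hz
        rcases List.mem_append.1 hc with hc | hc
        · exact ⟨c, by simp [hc], rfl, fun x hx => (h2 x hx).append _⟩
        · rcases List.mem_cons.1 hc with rfl | hc
          · exact ⟨b', by simp, he.out_eq, hb'⟩
          · exact ⟨c, by simp [hc], rfl, fun x hx => (h2 x hx).append _⟩
      · simp only [Act.out.injEq] at hw
        exact ⟨b', by simp, by rw [he.out_eq, hw.1], hb'⟩

theorem Trace.base {xs ys : List Port} {L₀ : List (LocalBinder ty)} {t : List (Act V)}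
    {K : Component ty} (h0 : (Component.base xs ys L₀).Initial)
    (h : Trace (.base xs ys L₀) t K) : ∃ L, K = .base xs ys L ∧ BaseHistory t L := by
  generalize hK : Component.base xs ys L₀ = K₀ at h
  induction h with
  | nil =>
    subst hK
    refine ⟨L₀, rfl, ?_, ?_, ?_⟩
    · intro b hb x; rw [h0.2 b hb]; rfl
    · intro b hb σ hσ; simp [h0.2 b hb] at hσ
    · rintro y ⟨v, hv⟩; simp at hv
  | snoc _ hs ih =>
    obtain ⟨L, rfl, hL⟩ := ih
    cases hs with
    | outBase _ _ _ L' y v h _ => exact ⟨L', rfl, hL.step h⟩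
    | inpBase _ _ _ L' y v h _ => exact ⟨L', rfl, hL.step h⟩

/-- What the past `t` of a composite component says about its subcomponent `K` with role `s`:
it has the past `τ`, and it has carried out the part `d` of the protocol. -/
structure RoleHistory (D : List DBinder) (r : Role) (F : List Fwd) (A : List (Item V))
    (R : Tail V) (t : List (Act V)) (I : List (Item V)) (s : Role) (K₀ K : Component ty)
    (τ : List (Act V)) (d : List Ev) : Prop where
  trace : Trace K₀ τ K
  unrolled : Unrolled (view s A) (view s R.body) d (view s I)
  inp : ∀ x, InpIn x τ → (∃ l, Ev.recv l ∈ d ∧ RecvsOn D s l x) ∨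
    (s = r ∧ ∃ X, InpIn X t ∧ Fwd.inp x X ∈ F)
  send : ∀ l, Ev.send l ∈ d → ∃ y, SendsOn D s l y ∧ OutIn y τ
  out : s = r → ∀ Y, OutIn Y t → ∃ z, Fwd.out Y z ∈ F ∧ OutIn z τ

variable {D : List DBinder} {r s : Role} {F : List Fwd} {A I I' : List (Item V)} {R : Tail V}
  {t τ : List (Act V)} {K₀ K K' : Component ty} {d : List Ev}

theorem RoleHistory.idle (h : RoleHistory D r F A R t I s K₀ K τ d) (a : Act V)
    (ha : s = r → ∀ Y v, a ≠ .out Y v) : RoleHistory D r F A R (t ++ [a]) I s K₀ K τ d := by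
  refine ⟨h.trace, h.unrolled, fun x hx => ?_, h.send, fun hs Y hY => ?_⟩
  · rcases h.inp x hx with h | ⟨h, X, hX, hF⟩
    · exact .inl h
    · exact .inr ⟨h, X, hX.append _, hF⟩
  · rcases outIn_snoc.1 hY with hY | ⟨v, hv⟩
    · exact h.out hs Y hY
    · exact absurd hv (ha hs Y v)

/-- The action of another role may unfold the recursion, but what this role has done and still has
to do is the same word, unrolled further. -/
theorem RoleHistory.skip (h : RoleHistory D r F A R t I s K₀ K τ d) {m : ℕ} {a : GAct V}
    (hi : ItemStep (I ++ copies m R.body) a I') (ha : s ≠ a.subj) :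
    RoleHistory D r F A R t I' s K₀ K τ d := by
  refine ⟨h.trace, ?_, h.inp, h.send, h.out⟩
  have h1 := h.unrolled.unfold m
  rw [← view_copies, ← view_append, hi.view_eq s, if_neg ha, List.nil_append] at h1
  exact h1

theorem RoleHistory.internal (h : RoleHistory D r F A R t I s K₀ K τ d)
    (hs : Component.Step K .tau K') : RoleHistory D r F A R t I s K₀ K' (τ ++ [.tau]) d := by
  refine ⟨h.trace.snoc hs, h.unrolled, fun x hx => ?_, fun l hl => ?_, fun hr Y hY => ?_⟩
  · rcases inpIn_snoc.1 hx with hx | ⟨v, hv⟩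
    · exact h.inp x hx
    · cases hv
  · obtain ⟨y, hy, ho⟩ := h.send l hl
    exact ⟨y, hy, ho.append _⟩
  · obtain ⟨z, hz, ho⟩ := h.out hr Y hY
    exact ⟨z, hz, ho.append _⟩

/-- The event leaves the head of the pending word and joins the done part. The last two hypotheses
tie the action of the subcomponent to that event. -/
theorem RoleHistory.act (h : RoleHistory D r F A R t I s K₀ K τ d) {m : ℕ} {g : GAct V}
    (hi : ItemStep (I ++ copies m R.body) g I') (hg : s = g.subj) {b : Act V}
    (hs : Component.Step K b K')
    (hb : ∀ x v, b = .inp x v → ∃ l, g.ev = .recv l ∧ RecvsOn D s l x)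
    (hg' : ∀ l, g.ev = .send l → ∃ y v, SendsOn D s l y ∧ b = .out y v) :
    RoleHistory D r F A R t I' s K₀ K' (τ ++ [b]) (d ++ [g.ev]) := by
  refine ⟨h.trace.snoc hs, ?_, fun x hx => ?_, fun l hl => ?_, fun hr Y hY => ?_⟩
  · have h1 := h.unrolled.unfold m
    rw [← view_copies, ← view_append, hi.view_eq s, if_pos hg] at h1
    exact h1.step
  · rcases inpIn_snoc.1 hx with hx | ⟨v, hv⟩
    · rcases h.inp x hx with ⟨l, hl, hx⟩ | h
      · exact .inl ⟨l, List.mem_append_left _ hl, hx⟩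
      · exact .inr h
    · obtain ⟨l, hl, hx⟩ := hb x v hv
      exact .inl ⟨l, by simp [hl], hx⟩
  · rcases List.mem_append.1 hl with hl | hl
    · obtain ⟨y, hy, ho⟩ := h.send l hl
      exact ⟨y, hy, ho.append _⟩
    · simp only [List.mem_singleton] at hl
      obtain ⟨y, v, hy, rfl⟩ := hg' l hl.symm
      exact ⟨y, hy, outIn_snoc.2 (.inr ⟨v, rfl⟩)⟩
  · obtain ⟨z, hz, ho⟩ := h.out hr Y hY
    exact ⟨z, hz, ho.append _⟩

theorem RoleHistory.forward_inp (h : RoleHistory D r F A R t I s K₀ K τ d) (hr : s = r)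
    {x z : Port} {v : V} (hs : Component.Step K (.inp z v) K') (hF : Fwd.inp z x ∈ F) :
    RoleHistory D r F A R (t ++ [.inp x v]) I s K₀ K' (τ ++ [.inp z v]) d := by
  have h' := h.idle (.inp x v) (by simp)
  refine ⟨h.trace.snoc hs, h.unrolled, fun x' hx => ?_, fun l hl => ?_, fun hr Y hY => ?_⟩
  · rcases inpIn_snoc.1 hx with hx | ⟨w, hw⟩
    · exact h'.inp x' hx
    · simp only [Act.inp.injEq] at hw
      exact .inr ⟨hr, x, inpIn_snoc.2 (.inr ⟨v, rfl⟩), hw.1 ▸ hF⟩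
  · obtain ⟨y, hy, ho⟩ := h.send l hl
    exact ⟨y, hy, ho.append _⟩
  · obtain ⟨z, hz, ho⟩ := h'.out hr Y hY
    exact ⟨z, hz, ho.append _⟩

theorem RoleHistory.forward_out (h : RoleHistory D r F A R t I s K₀ K τ d)
    {y z : Port} {v : V} (hs : Component.Step K (.out z v) K') (hF : Fwd.out y z ∈ F) :
    RoleHistory D r F A R (t ++ [.out y v]) I s K₀ K' (τ ++ [.out z v]) d := by
  refine ⟨h.trace.snoc hs, h.unrolled, fun x' hx => ?_, fun l hl => ?_, fun hr Y hY => ?_⟩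
  · rcases inpIn_snoc.1 hx with hx | ⟨w, hw⟩
    · rcases h.inp x' hx with h | ⟨h, X, hX, hF⟩
      · exact .inl h
      · exact .inr ⟨h, X, hX.append _, hF⟩
    · cases hw
  · obtain ⟨y, hy, ho⟩ := h.send l hl
    exact ⟨y, hy, ho.append _⟩
  · rcases outIn_snoc.1 hY with hY | ⟨w, hw⟩
    · obtain ⟨z, hz, ho⟩ := h.out hr Y hY
      exact ⟨z, hz, ho.append _⟩
    · simp only [Act.out.injEq] at hw
      exact ⟨z, hw.1 ▸ hF, outIn_snoc.2 (.inr ⟨v, rfl⟩)⟩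

theorem forall_update {n : ℕ} {α : Type*} {f : Fin n → α} {i : Fin n} {a : α}
    {P : Fin n → α → Prop} (hi : P i a) (hj : ∀ j, j ≠ i → P j (f j)) :
    ∀ j, P j (Function.update f i a j) := by
  intro j
  by_cases h : j = i
  · subst h; simpa using hi
  · rw [Function.update_of_ne h]; exact hj j h

/-- The pasts of all subcomponents are tracked together, since a protocol step of one role may
unfold the recursion for all of them. -/
theorem Trace.composite {xs ys : List Port} {n : ℕ} {role : Fin n → Role}
    {sub₀ : Fin n → Component ty} (hrole : Function.Injective role)
    (hA : (A.map Item.label ++ R.body.map Item.label).Nodup)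
    (h : Trace (.composite xs ys (fillG A R.global) n role sub₀ D r F) t K) :
    ∃ sub I, K = .composite xs ys (fillG I R.global) n role sub D r F ∧
      ∀ i, ∃ τ d, RoleHistory D r F A R t I (role i) (sub₀ i) (sub i) τ d := by
  generalize hK : Component.composite xs ys (fillG A R.global) n role sub₀ D r F = K₀ at h
  induction h with
  | nil =>
    subst hK
    refine ⟨sub₀, A, rfl, fun i => ⟨[], [], .nil _, ⟨?_, 0, by simp [copies]⟩, ?_, by simp, ?_⟩⟩
    · rw [← view_append]
      exact view_nodup _ (by simpa using hA)
    · rintro x ⟨v, hv⟩; simp at hv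
    · rintro _ x ⟨v, hv⟩; simp at hv
  | snoc _ hs ih =>
    obtain ⟨sub, I, rfl, hH⟩ := ih
    have hsub : ∀ i j, j ≠ i → role j ≠ role i := fun i j h h' => h (hrole h')
    generalize hG : fillG I R.global = G at hs
    cases hs with
    | outComp _ _ _ _ _ _ _ _ _ i K' y z v hr hs hF _ =>
      subst hG
      refine ⟨_, I, rfl, forall_update (P := fun j K' => ∃ τ d,
        RoleHistory D r F A R _ I (role j) (sub₀ j) K' τ d) ?_ fun j hj => ?_⟩
      · obtain ⟨τ, d, h⟩ := hH i
        exact ⟨_, d, h.forward_out hs hF⟩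
      · obtain ⟨τ, d, h⟩ := hH j
        exact ⟨τ, d, h.idle _ fun h => absurd (h.trans hr.symm) (hsub i j hj)⟩
    | inpComp _ _ _ _ _ _ _ _ _ i K' x z v hr hs hF _ =>
      subst hG
      refine ⟨_, I, rfl, forall_update (P := fun j K' => ∃ τ d,
        RoleHistory D r F A R _ I (role j) (sub₀ j) K' τ d) ?_ fun j hj => ?_⟩
      · obtain ⟨τ, d, h⟩ := hH i
        exact ⟨_, d, h.forward_inp hr hs hF⟩
      · obtain ⟨τ, d, h⟩ := hH j
        exact ⟨τ, d, h.idle _ (by simp)⟩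
    | internal _ _ _ _ _ _ _ _ _ i K' hs =>
      subst hG
      refine ⟨_, I, rfl, forall_update (P := fun j K' => ∃ τ d,
        RoleHistory D r F A R _ I (role j) (sub₀ j) K' τ d) ?_ fun j hj => ?_⟩
      · obtain ⟨τ, d, h⟩ := hH i
        exact ⟨_, d, (h.internal hs).idle _ (by simp)⟩
      · obtain ⟨τ, d, h⟩ := hH j
        exact ⟨τ, d, h.idle _ (by simp)⟩
    | outChor _ _ _ G' _ _ _ _ _ _ i K' y l v hs hD hstep =>
      obtain ⟨m, I', rfl, hi⟩ := hstep.items R I hG.symm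
      refine ⟨_, I', rfl, forall_update (P := fun j K' => ∃ τ d,
        RoleHistory D r F A R _ I' (role j) (sub₀ j) K' τ d) ?_ fun j hj => ?_⟩
      · obtain ⟨τ, d, h⟩ := hH i
        refine ⟨_, _, (h.act hi rfl hs (by simp) ?_).idle _ (by simp)⟩
        rintro l' hl
        simp only [GAct.ev, Ev.send.injEq] at hl
        exact ⟨y, v, hl ▸ hD, rfl⟩
      · obtain ⟨τ, d, h⟩ := hH j
        exact ⟨τ, d, (h.skip hi (hsub i j hj)).idle _ (by simp)⟩
    | inpChor _ _ _ G' _ _ _ _ _ _ i K' x l v hs hD hstep =>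
      obtain ⟨m, I', rfl, hi⟩ := hstep.items R I hG.symm
      refine ⟨_, I', rfl, forall_update (P := fun j K' => ∃ τ d,
        RoleHistory D r F A R _ I' (role j) (sub₀ j) K' τ d) ?_ fun j hj => ?_⟩
      · obtain ⟨τ, d, h⟩ := hH i
        refine ⟨_, _, (h.act hi rfl hs ?_ (by simp [GAct.ev])).idle _ (by simp)⟩
        rintro x' v' hx
        simp only [Act.inp.injEq] at hx
        exact ⟨l, rfl, hx.1 ▸ hD⟩
      · obtain ⟨τ, d, h⟩ := hH j
        exact ⟨τ, d, (h.skip hi (hsub i j hj)).idle _ (by simp)⟩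

/-! ### What the past implies for types -/

/-- What the past of a component says about its type. -/
structure TypeHistory (t : List (Act V)) (T : CType ℕ B) : Prop where
  received : ∀ y c x n, T.con y = some c → c.deps x = some (.per n) → n ≠ 0 → InpIn x t
  emitted : ∀ y c x M, T.con y = some c → c.deps x = some M → OutIn y t →
    (∃ n, M = .per n) ∧ InpIn x t
  deps : ∀ y c x M, T.con y = some c → c.deps x = some M → T.inputs x ≠ none
  disjoint : ∀ x, T.inputs x ≠ none → T.con x = none

theorem count_eq_zero {x : Port} {q : List (Store V)} (h : ∀ σ ∈ q, ∀ w, σ x ≠ some w) :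
    count x q = 0 :=
  count_of_none fun σ hσ => Option.eq_none_iff_forall_ne_some.2 (h σ hσ)

/-- Base types have no initial dependencies, available values were received earlier, and an emission
presupposes a received value for every parameter. -/
theorem BaseHistory.type {xs ys : List Port} {L : List (LocalBinder ty)} {T : CType ℕ B}
    (h : BaseHistory t L) (hn : (xs ++ ys).Nodup) (hT : BaseExtracts xs ys L T) :
    TypeHistory t T := by
  obtain ⟨hp, γ, hc, rfl⟩ := hT
  have hnd := hp.nodup_iff.2 (List.nodup_append.1 hn).2.1
  have key : ∀ y c, (baseType xs L γ).con y = some c →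
      ∃ b ∈ L, b.out = y ∧ c = b.constraint γ := by
    intro y c hy
    simp only [baseType, Option.map_eq_some_iff] at hy
    obtain ⟨b, hb, rfl⟩ := hy
    exact ⟨b, List.mem_of_find?_eq_some hb, by simpa using List.find?_some hb, rfl⟩
  have key' : ∀ (b : LocalBinder ty) x M, (b.constraint γ).deps x = some M →
      x ∈ b.params ∧ M = .per (count x b.queue) := by
    intro b x M hM
    simp only [LocalBinder.constraint] at hM
    split_ifs at hM with hx
    exact ⟨hx, by simpa using hM.symm⟩
  refine ⟨?_, ?_, ?_, ?_⟩
  · intro y c x n hy hx hn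
    obtain ⟨b, hb, rfl, rfl⟩ := key y c hy
    obtain ⟨_, hM⟩ := key' b x _ hx
    simp only [Dep.per.injEq] at hM
    by_contra hcon
    exact hn (hM.trans (count_eq_zero fun σ hσ w hw => hcon (h.stored b hb σ hσ x w hw)))
  · intro y c x M hy hx ho
    obtain ⟨b, hb, rfl, rfl⟩ := key y c hy
    obtain ⟨hxp, rfl⟩ := key' b x _ hx
    obtain ⟨b', hb', hout, hin⟩ := h.emitted _ ho
    cases List.inj_on_of_nodup_map hnd hb' hb hout
    exact ⟨⟨_, rfl⟩, hin x hxp⟩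
  · intro y c x M hy hx
    obtain ⟨b, hb, rfl, rfl⟩ := key y c hy
    obtain ⟨hxp, rfl⟩ := key' b x _ hx
    simp [baseType, (hc b hb).1 x hxp]
  · intro x hx
    cases hcon : (baseType xs L γ).con x with
    | none => rfl
    | some c =>
      obtain ⟨b, hb, rfl, rfl⟩ := key x c hcon
      have h1 : b.out ∈ ys := hp.subset (List.mem_map_of_mem hb)
      have h2 : b.out ∈ xs := by
        by_contra h2
        simp [baseType, h2] at hx
      exact absurd rfl ((List.nodup_append.1 hn).2.2 _ h2 _ h1)

/-- The situation of the interfacing component: its type `T`, its past `τ`, the part `d` of the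
protocol that it has carried out, and the rest `w` up to the repetition of `Bd`. -/
structure Interface (D : List DBinder) (r : Role) (F : List Fwd) (A Bd w d : List Ev)
    (τ : List (Act V)) (T : CType ℕ B) : Prop where
  binders : UniqueBinders D
  apart : BindersApart D r F
  unrolled : Unrolled A Bd d w
  hist : TypeHistory τ T
  on : ∀ e ∈ w ++ Bd, ∃ x, e.On D r x
  inp : ∀ x, InpIn x τ → (∃ l, Ev.recv l ∈ d ∧ RecvsOn D r l x) ∨ ∃ X, Fwd.inp x X ∈ F
  send : ∀ l, Ev.send l ∈ d → ∃ y, SendsOn D r l y ∧ OutIn y τ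
  send_con : ∀ l, Ev.send l ∈ w ++ Bd → T.con (portOf D r (.send l)) ≠ none
  recv_inp : ∀ l, Ev.recv l ∈ w ++ Bd → T.inputs (portOf D r (.recv l)) ≠ none

theorem mem_innerIn {F : List Fwd} {z : Port} : z ∈ innerIn F ↔ ∃ x, Fwd.inp z x ∈ F := by
  simp only [innerIn, List.mem_filterMap]
  constructor
  · rintro ⟨f, hf, h⟩
    cases f <;> simp at h
    subst h; exact ⟨_, hf⟩
  · rintro ⟨x, h⟩; exact ⟨_, h, rfl⟩

theorem mem_innerOut {F : List Fwd} {z : Port} : z ∈ innerOut F ↔ ∃ y, Fwd.out y z ∈ F := by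
  simp only [innerOut, List.mem_filterMap]
  constructor
  · rintro ⟨f, hf, h⟩
    cases f <;> simp at h
    subst h; exact ⟨_, hf⟩
  · rintro ⟨x, h⟩; exact ⟨_, h, rfl⟩

theorem Ev.On.not_forwarded {e : Ev} {x : Port} (h : e.On D r x) (ha : BindersApart D r F) :
    x ∉ innerIn F ∧ x ∉ innerOut F := by
  have : x ∉ F.map Fwd.inner := by
    cases e with
    | send l => obtain ⟨b, hb, _, h2, rfl⟩ := h; exact (ha b hb).1 h2
    | recv l => obtain ⟨b, hb, _, h2, rfl⟩ := h; exact (ha b hb).2 h2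
  refine ⟨fun h => this ?_, fun h => this ?_⟩
  · obtain ⟨X, hX⟩ := mem_innerIn.1 h
    exact List.mem_map.2 ⟨_, hX, rfl⟩
  · obtain ⟨X, hX⟩ := mem_innerOut.1 h
    exact List.mem_map.2 ⟨_, hX, rfl⟩

namespace Interface
variable {A Bd w d : List Ev} {T : CType ℕ B}

theorem on_port (h : Interface D r F A Bd w d τ T) {e : Ev} (he : e ∈ w ++ Bd) :
    e.On D r (portOf D r e) := by
  obtain ⟨x, hx⟩ := h.on e he
  rwa [hx.port_eq h.binders]

/-- In one direction the port determines the label. An output port differs from an input port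
because no port has both a constraint and an input declaration. -/
theorem injOn (h : Interface D r F A Bd w d τ T) : InjOn (portOf D r) (w ++ Bd) := by
  intro e he e' he' heq
  have h1 := h.on_port he
  have h2 := h.on_port he'
  rw [heq] at h1
  cases e with
  | send l =>
    cases e' with
    | send l' => rw [sendsOn_label h.binders h1 h2]
    | recv l' => exact absurd (h.hist.disjoint _ (h.recv_inp l' he')) (heq ▸ h.send_con l he)
  | recv l =>
    cases e' with
    | send l' => exact absurd (h.hist.disjoint _ (h.recv_inp l he)) (heq ▸ h.send_con l' he')
    | recv l' => rw [recvsOn_label h.binders h1 h2]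

/-- A port of the protocol is never forwarded, so an input on it can only have been a reception of
the protocol. -/
theorem recv_mem (h : Interface D r F A Bd w d τ T) {l : Label} (hl : Ev.recv l ∈ w ++ Bd)
    (hi : InpIn (portOf D r (.recv l)) τ) : Ev.recv l ∈ d := by
  have h1 := h.on_port hl
  rcases h.inp _ hi with ⟨l', hl', h2⟩ | ⟨X, hX⟩
  · rwa [recvsOn_label h.binders h1 h2]
  · exact absurd (mem_innerIn.2 ⟨X, hX⟩) (h1.not_forwarded h.apart).1

theorem outIn (h : Interface D r F A Bd w d τ T) {l : Label} (hl : Ev.send l ∈ d) :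
    OutIn (portOf D r (.send l)) τ := by
  obtain ⟨y, hy, ho⟩ := h.send l hl
  rwa [Ev.On.port_eq h.binders (e := .send l) hy]

end Interface

variable {w d Aw : List Ev} {T : CType ℕ B} {γ : Label → B}

/-- The local protocol with remaining prefix `w`. -/
noncomputable abbrev localP (D : List DBinder) (γ : Label → B) (s : Role) (R : Tail V)
    (w : List Ev) : LocalP B :=
  fillP (portOf D s) γ w (R.proj (portOf D s) γ s)

/-- The dependencies that are collected for a forwarded port. -/
def Collected (F : List Fwd) (P : LocalP B) (T : CType ℕ B) (z x : Port) (M : Dep ℕ) : Prop :=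
  Direct T.con F z x M ∨ Transitive T.con F P z x M

namespace Interface

/-- For $\diamond_1$ the input lies outside the repetition and is still pending. For $\diamond_2$ a
pending output lies outside the repetition, so no event of the repetition has happened yet. -/
theorem not_inpIn_of_rel (h : Interface D r F Aw (view r R.body) w d τ T) {y' x' : Port}
    (hr : (localP D γ r R w).Rel1 y' x' ∨ (localP D γ r R w).Rel2 y' x') : ¬ InpIn x' τ := by
  intro hi
  rcases hr with hr | hr
  · obtain ⟨⟨l', l, rfl, rfl, hs⟩, hx, _⟩ := rel1_iff.1 hr
    have hl : Ev.recv l ∈ w := hs.subset (by simp)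
    exact h.unrolled.not_mem_of_mem hl (fun hB => hx (List.mem_map_of_mem hB))
      (h.recv_mem (List.mem_append_left _ hl) hi)
  · obtain ⟨⟨l', l, rfl, rfl, hl', hl⟩, hy⟩ := rel2_iff.1 hr
    exact h.unrolled.not_mem_of_pending hl' (fun hB => hy (List.mem_map_of_mem hB)) hl
      (h.recv_mem (List.mem_append_right _ hl) hi)

/-- In every round the output comes before the input. -/
theorem outIn_of_inpIn (h : Interface D r F Aw (view r R.body) w d τ T) {y' x' : Port}
    (hr : (localP D γ r R w).Rel3 y' x') (hi : InpIn x' τ) : OutIn y' τ := by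
  obtain ⟨l', l, rfl, rfl, hs⟩ := rel3_iff.1 hr
  exact h.outIn (h.unrolled.mem_of_mem hs
    (h.recv_mem (List.mem_append_right _ (hs.subset (by simp))) hi))

theorem outIn_of_vf (h : Interface D r F Aw (view r R.body) w d τ T) {y' x' : Port}
    (hr : (localP D γ r R w).Rel3 y' x') (hv : (localP D γ r R w).vf x' y' ≠ 0) :
    OutIn y' τ := by
  obtain ⟨l', l, rfl, rfl, hs⟩ := rel3_iff.1 hr
  rw [vf_eq h.injOn hs] at hv
  refine h.outIn (h.unrolled.mem_of_flows hs ?_)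
  by_contra hf
  simp [hf] at hv

/-- A positive sum $n+n'+\mathit{vf}$ has a positive term. If it is $n$, then `x` was received
directly; if it is $n'$ or $\mathit{vf}$, then `y'` has been output, which presupposes an input on
`x`. -/
theorem collected_received (h : Interface D r F Aw (view r R.body) w d τ T) {z x : Port} {n : ℕ}
    (hc : Collected F (localP D γ r R w) T z x (.per n)) (hn : n ≠ 0) : InpIn x τ := by
  rcases hc with ⟨⟨c, hc, hx⟩, _⟩ | hc
  · exact h.hist.received _ _ _ _ hc hx hn
  · cases hc with
    | per x' y' _ n' n hch hr =>
      obtain ⟨_, ⟨c, hc, hx'⟩, ⟨c', hc', hx⟩, _⟩ := hch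
      by_cases h1 : n = 0
      · have ho : OutIn y' τ := by
          by_cases h2 : n' = 0
          · refine h.outIn_of_vf hr fun h3 => hn ?_
            rw [h1, h2, h3]
          · exact h.outIn_of_inpIn hr (h.hist.received _ _ _ _ hc hx' h2)
        exact (h.hist.emitted _ _ _ _ hc' hx ho).2
      · exact h.hist.received _ _ _ _ hc' hx h1

/-- The input on `x'` has happened. This excludes $\diamond_1$ and $\diamond_2$, and under
$\diamond_3$ it means that `y'` has been output, so `y'` depends on `x` per each value and has
received it. -/
theorem collected_emitted (h : Interface D r F Aw (view r R.body) w d τ T) {z x : Port}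
    {M : Dep ℕ} (hc : Collected F (localP D γ r R w) T z x M)
    (hz : ∀ c x' M', T.con z = some c → c.deps x' = some M' → (∃ n, M' = .per n) ∧ InpIn x' τ) :
    (∃ n, M = .per n) ∧ InpIn x τ := by
  rcases hc with ⟨⟨c, hc, hx⟩, _⟩ | hc
  · exact hz _ _ _ hc hx
  · cases hc with
    | once x' y' _ M' M hch hr =>
      obtain ⟨_, ⟨c, hc, hx'⟩, _⟩ := hch
      exact absurd (hz _ _ _ hc hx').2 (h.not_inpIn_of_rel hr)
    | initial x' y' _ M' M hch hr hM =>
      obtain ⟨_, ⟨c, hc, hx'⟩, ⟨c', hc', hx⟩, _⟩ := hch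
      obtain ⟨⟨n, hn⟩, hi⟩ := hz _ _ _ hc hx'
      obtain ⟨⟨k, hk⟩, _⟩ := h.hist.emitted _ _ _ _ hc' hx (h.outIn_of_inpIn hr hi)
      rw [hn, hk] at hM
      simp at hM
    | per x' y' _ n' n hch hr =>
      obtain ⟨_, ⟨c, hc, hx'⟩, ⟨c', hc', hx⟩, _⟩ := hch
      obtain ⟨_, hi⟩ := hz _ _ _ hc hx'
      exact ⟨⟨_, rfl⟩, (h.hist.emitted _ _ _ _ hc' hx (h.outIn_of_inpIn hr hi)).2⟩

end Interface

theorem fwd_eq_of_inner (h : (F.map Fwd.inner).Nodup) {f g : Fwd} (hf : f ∈ F) (hg : g ∈ F)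
    (he : f.inner = g.inner) : f = g := List.inj_on_of_nodup_map h hf hg he

theorem fwd_eq_of_outer (h : (F.map Fwd.outer).Nodup) {f g : Fwd} (hf : f ∈ F) (hg : g ∈ F)
    (he : f.outer = g.outer) : f = g := List.inj_on_of_nodup_map h hf hg he

theorem modified_inputs (F : List Fwd) (T : CType ℕ B) : (modified F T).inputs = T.inputs := rfl

theorem modified_con_ne_none {F : List Fwd} {T : CType ℕ B} {y : Port}
    (h : (modified F T).con y ≠ none) : T.con y ≠ none := by
  intro h'
  simp [modified_eq, h'] at h

/-- The interfacing component of a well-typed component is in the situation above. -/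
theorem RoleHistory.interface (h : RoleHistory D r F A R t I r K₀ K τ d)
    (hD : UniqueBinders D) (ha : BindersApart D r F) (hT : TypeHistory τ T)
    (hon : ∀ e ∈ view r I ++ view r R.body, ∃ x, e.On D r x)
    (hconf : Loops ((view r I).map (Ev.act (portOf D r) γ))
      ((view r R.body).map (Ev.act (portOf D r) γ)) (modified F T)) :
    Interface D r F (view r A) (view r R.body) (view r I) d τ T := by
  obtain ⟨T₁, T₂, h1, h2, _⟩ := hconf
  have hrun : CType.Run ((view r I ++ view r R.body).map (Ev.act (portOf D r) γ))
      (modified F T) T₂ := by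
    rw [List.map_append, CType.run_append]; exact ⟨T₁, h1, h2⟩
  refine ⟨hD, ha, h.unrolled, hT, hon, fun x hx => ?_, h.send, fun l hl => ?_, fun l hl => ?_⟩
  · rcases h.inp x hx with h | ⟨_, X, _, hX⟩
    · exact .inl h
    · exact .inr ⟨X, hX⟩
  · obtain ⟨c, hc, _⟩ := CType.run_con hrun (y := portOf D r (.send l)) (b := γ l)
      (List.mem_map.2 ⟨_, hl, rfl⟩)
    exact modified_con_ne_none (by rw [hc]; simp)
  · have := CType.run_inputs hrun (x := portOf D r (.recv l)) (b := γ l)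
      (List.mem_map.2 ⟨_, hl, rfl⟩)
    rw [modified_inputs] at this
    rw [this]; simp

theorem Component.Initial.exists_items {xs ys : List Port} {G : Global V} {n : ℕ}
    {role : Fin n → Role} {sub : Fin n → Component ty}
    (h : (Component.composite xs ys G n role sub D r F).Initial) :
    ∃ (A : List (Item V)) (R : Tail V), G = fillG A R.global ∧
      (A.map Item.label ++ R.body.map Item.label).Nodup := by
  obtain ⟨_, ⟨h1, h2, h3⟩, _⟩ := h
  obtain ⟨A, R, rfl⟩ := GC.exists_items G h1 h2
  rw [labels_fillG, labels_global] at h3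
  exact ⟨A, R, rfl, h3⟩

theorem InnerExtracts.collected {P : LocalP B} {T T₁ : CType ℕ B} (h : InnerExtracts F P T T₁)
    {z : Port} {c₁ : Constraint ℕ B} (hc₁ : T₁.con z = some c₁) {x : Port} {M : Dep ℕ}
    (hM : c₁.deps x = some M) : Collected F P T z x M := by
  have hz : z ∈ innerOut F := by
    by_contra hz
    rw [h.con_none z hz] at hc₁
    cases hc₁
  have h1 := h.con_out z hz
  rw [hc₁] at h1
  generalize T.con z = o at h1
  cases h1 with
  | some h1 =>
    obtain ⟨_, _, hp⟩ := h1
    cases M with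
    | per n => exact ((hp x).1 n).1 hM
    | initial => exact ((hp x).2.1 hM).1

theorem Collected.mem {P : LocalP B} {T : CType ℕ B} {z x : Port} {M : Dep ℕ}
    (h : Collected F P T z x M) : x ∈ innerIn F ∧ ∃ y c, T.con y = some c ∧
      ∃ M', c.deps x = some M' := by
  rcases h with ⟨⟨c, hc, hx⟩, h, _⟩ | h
  · exact ⟨h, z, c, hc, _, hx⟩
  · cases h with
    | once x' y' _ M' M h _ _ =>
      obtain ⟨_, _, ⟨c, hc, hx⟩, h, _⟩ := h; exact ⟨h, y', c, hc, _, hx⟩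
    | initial x' y' _ M' M h _ _ =>
      obtain ⟨_, _, ⟨c, hc, hx⟩, h, _⟩ := h; exact ⟨h, y', c, hc, _, hx⟩
    | per x' y' _ M' M h _ =>
      obtain ⟨_, _, ⟨c, hc, hx⟩, h, _⟩ := h; exact ⟨h, y', c, hc, _, hx⟩

theorem RoleHistory.outer_inpIn (h : RoleHistory D r F A R t I r K₀ K τ d)
    (ha : BindersApart D r F) (hF : (F.map Fwd.inner).Nodup) {z x : Port}
    (hz : Fwd.inp z x ∈ F) (hi : InpIn z τ) : InpIn x t := by
  rcases h.inp z hi with ⟨l, _, hl⟩ | ⟨_, X, hX, hX'⟩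
  · exact absurd (mem_innerIn.2 ⟨x, hz⟩) (Ev.On.not_forwarded (e := .recv l) hl ha).1
  · cases fwd_eq_of_inner hF hz hX' rfl
    exact hX

theorem RoleHistory.compositeType {T T' : CType ℕ B}
    (h : RoleHistory D r F A R t I r K₀ K τ d)
    (hi : Interface D r F (view r A) (view r R.body) (view r I) d τ T)
    (hin : (F.map Fwd.inner).Nodup) (hout : (F.map Fwd.outer).Nodup)
    (hT : CompositeExtracts F (localP D γ r R (view r I)) T T') : TypeHistory t T' := by
  obtain ⟨T₁, h1, h2⟩ := hT
  have key : ∀ y c x M, T'.con y = some c → c.deps x = some M → ∃ z v, Fwd.out y z ∈ F ∧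
      Fwd.inp v x ∈ F ∧ Collected F (localP D γ r R (view r I)) T z v M := by
    intro y c x M hc hM
    obtain ⟨z, c₁, hz, hc₁, _, _, hd⟩ := (h2.con y c).1 hc
    obtain ⟨v, hv, hM⟩ := (hd x M).1 hM
    exact ⟨z, v, hz, hv, h1.collected hc₁ hM⟩
  refine ⟨?_, ?_, ?_, ?_⟩
  · intro y c x n hc hM hn
    obtain ⟨z, v, hz, hv, hcol⟩ := key y c x _ hc hM
    exact h.outer_inpIn hi.apart hin hv (hi.collected_received hcol hn)
  · intro y c x M hc hM ho
    obtain ⟨z, v, hz, hv, hcol⟩ := key y c x _ hc hM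
    obtain ⟨z', hz', ho'⟩ := h.out rfl y ho
    cases fwd_eq_of_outer hout hz hz' rfl
    obtain ⟨h3, h4⟩ := hi.collected_emitted hcol
      fun c x' M' hc hx => hi.hist.emitted _ _ _ _ hc hx ho'
    exact ⟨h3, h.outer_inpIn hi.apart hin hv h4⟩
  · intro y c x M hc hM
    obtain ⟨z, v, hz, hv, hcol⟩ := key y c x _ hc hM
    obtain ⟨hvF, y', c', hc', M', hM'⟩ := hcol.mem
    obtain ⟨b, hb⟩ := Option.ne_none_iff_exists'.1 (hi.hist.deps _ _ _ _ hc' hM')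
    have := (h2.inputs x b).2 ⟨v, hv, by rw [h1.inputs, if_pos hvF, hb]⟩
    rw [this]; simp
  · intro x hx
    obtain ⟨b, hb⟩ := Option.ne_none_iff_exists'.1 hx
    obtain ⟨z, hz, _⟩ := (h2.inputs x b).1 hb
    cases hc : T'.con x with
    | none => rfl
    | some c =>
      obtain ⟨z', c₁, hz', _⟩ := (h2.con x c).1 hc
      cases fwd_eq_of_outer hout hz hz' rfl

/-- By induction on nesting: the past of the interfacing component, with its type, gives these facts
for the extracted type. Conformance is used to know that the protocol ports are declared as inputs
and outputs. -/
theorem Trace.typeHistory (h0 : K₀.Initial) (h : Trace K₀ t K) (hT : HasType K T) :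
    TypeHistory t T := by
  induction K₀ generalizing t K T with
  | base xs ys L₀ =>
    obtain ⟨L, rfl, hL⟩ := h.base h0
    cases hT with
    | base _ _ _ _ hT => exact hL.type h0.1 hT
  | composite xs ys G n role sub₀ D r F ih =>
    obtain ⟨A, R, rfl, hA⟩ := h0.exists_items
    obtain ⟨_, _, hrole, hD, hin, hout, hap, hsub⟩ := h0
    obtain ⟨sub, I, rfl, hH⟩ := h.composite hrole hA
    generalize hG : fillG I R.global = G at hT
    cases hT with
    | composite _ _ _ _ _ _ _ _ _ γ Ts Ps k _ hk hTs hPs hE hC =>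
      subst hG hk
      obtain ⟨τ, d, hRH⟩ := hH k
      have hist := ih k (hsub k) hRH.trace (hTs k)
      obtain ⟨hon, _, hP⟩ := (proj_iff hD _ _ _).1 (hPs k)
      have hc := hC k
      rw [if_pos rfl, hP, conforms_iff] at hc
      rw [hP] at hE
      exact hRH.compositeType (hRH.interface hD hap hist hon hc.2) hin hout hE

end

/-! ### Collected dependencies and boundaries -/

section
variable {B : Type v} {F : List Fwd}

/-- The dependency of `y` on `x`. -/
def CType.dep {N : Type u} (T : CType N B) (y x : Port) : Option (Dep N) :=
  (T.con y).bind fun c => c.deps x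

theorem CType.dep_eq_some {N : Type u} {T : CType N B} {y x : Port} {M : Dep N} :
    T.dep y x = some M ↔ ∃ c, T.con y = some c ∧ c.deps x = some M := by
  simp [dep, Option.bind_eq_some_iff]

theorem CType.dep_input (T : CType ℕ B) (y x z : Port) :
    (T.input z).dep y x = if x = z then (T.dep y x).bind Dep.incr else T.dep y x := by
  simp only [dep, input]
  cases T.con y with
  | none => simp
  | some c => by_cases h : x = z <;> simp [Constraint.input, h]

theorem CType.dep_output (T : CType ℕ B) (y x z : Port) :
    (T.output z).dep y x = if y = z then (T.dep y x).map Dep.decr else T.dep y x := by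
  simp only [dep, output]
  by_cases h : y = z
  · subst h
    cases T.con y <;> simp [Constraint.output]
  · simp [h]

/-- A chain through the protocol `P` yields the dependency `M`. -/
def Yields (P : LocalP B) (y' x' : Port) (M' M₀ M : Dep ℕ) : Prop :=
  (M = .initial ∧ (P.Rel1 y' x' ∨ P.Rel2 y' x') ∧ ¬ M₀.Positive) ∨
  (M = .initial ∧ P.Rel3 y' x' ∧
    (M₀ = .initial ∨ (M' = .initial ∧ M₀ = .per 0 ∧ P.vf x' y' = 0))) ∨
  (P.Rel3 y' x' ∧ ∃ n' n, M' = .per n' ∧ M₀ = .per n ∧ M = .per (n + n' + P.vf x' y'))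

theorem collected_iff {P : LocalP B} {T : CType ℕ B} {z x : Port} {M : Dep ℕ} :
    Collected F P T z x M ↔ x ∈ innerIn F ∧ z ∈ innerOut F ∧ (T.dep z x = some M ∨
      ∃ x' y' M' M₀, z ≠ y' ∧ T.dep z x' = some M' ∧ T.dep y' x = some M₀ ∧
        Yields P y' x' M' M₀ M) := by
  simp only [CType.dep_eq_some]
  constructor
  · rintro (⟨h1, h2, h3⟩ | h)
    · exact ⟨h2, h3, .inl h1⟩
    · cases h with
      | once x' y' _ M' M h h1 h2 =>
        exact ⟨h.2.2.2.1, h.2.2.2.2, .inr ⟨x', y', M', M, h.1, h.2.1, h.2.2.1,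
          .inl ⟨rfl, h1, h2⟩⟩⟩
      | initial x' y' _ M' M h h1 h2 =>
        exact ⟨h.2.2.2.1, h.2.2.2.2, .inr ⟨x', y', M', M, h.1, h.2.1, h.2.2.1,
          .inr (.inl ⟨rfl, h1, h2⟩)⟩⟩
      | per x' y' _ n' n h h1 =>
        exact ⟨h.2.2.2.1, h.2.2.2.2, .inr ⟨x', y', _, _, h.1, h.2.1, h.2.2.1,
          .inr (.inr ⟨h1, n', n, rfl, rfl, rfl⟩)⟩⟩
  · rintro ⟨h2, h3, h1 | ⟨x', y', M', M₀, h4, h5, h6, h7⟩⟩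
    · exact .inl ⟨h1, h2, h3⟩
    · right
      have hc : Chain T.con F z x' y' x M' M₀ := ⟨h4, h5, h6, h2, h3⟩
      rcases h7 with ⟨rfl, h, h'⟩ | ⟨rfl, h, h'⟩ | ⟨h, n', n, rfl, rfl, rfl⟩
      · exact .once _ _ _ _ _ hc h h'
      · exact .initial _ _ _ _ _ hc h h'
      · exact .per _ _ _ _ _ hc h

/-- A dependency contributes the bound `m` to the boundary. -/
def Dep.Bounds (fp rep : Prop) : Dep ℕ → ℕ∞ → Prop
  | .per n, m => (¬ fp ∧ m = n) ∨ (fp ∧ ¬ rep ∧ m = (n : ℕ∞) + 1)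
  | .initial, m => ¬ fp ∧ m = 0

/-- The numbers whose minimum is the boundary. -/
def bounds (F : List Fwd) (P : LocalP B) (c : Constraint ℕ B) : Set ℕ∞ :=
  {m | m = c.bound ∨ ∃ x' M, c.deps x' = some M ∧ x' ∉ innerIn F ∧
    M.Bounds (x' ∈ P.fp) (x' ∈ P.rep) m}

theorem boundary_eq (F : List Fwd) (P : LocalP B) (c : Constraint ℕ B) :
    boundary F P c = sInf (bounds F P c) := by
  unfold boundary bounds
  congr 1
  ext m
  simp only [Set.mem_union, Set.mem_singleton_iff, Set.mem_ofPred_eq, or_assoc]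
  refine or_congr_right ?_
  constructor
  · rintro (⟨x', n, h1, h2, h3, h4⟩ | ⟨x', h1, h2, h3, h4⟩ | ⟨x', n, h1, h2, h3, h4, h5⟩)
    · exact ⟨x', _, h1, h3, .inl ⟨h2, h4⟩⟩
    · exact ⟨x', _, h1, h3, h2, h4⟩
    · exact ⟨x', _, h1, h4, .inr ⟨h2, h3, h5⟩⟩
  · rintro ⟨x', n | _, h1, h3, h4⟩
    · rcases h4 with ⟨h2, h4⟩ | ⟨h2, h3', h4⟩
      · exact .inl ⟨x', n, h1, h2, h3, h4⟩
      · exact .inr (.inr ⟨x', n, h1, h2, h3', h3, h4⟩)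
    · exact .inr (.inl ⟨x', h1, h4.1, h3, h4.2⟩)

/-- The condition compares contributed bounds and not dependencies, because an internal input
changes a number and the set of pending ports at the same time. -/
theorem boundary_congr {P P' : LocalP B} {c c' : Constraint ℕ B} (hb : c'.bound = c.bound)
    (h : ∀ x' ∉ innerIn F, ∀ m, (∃ M, c'.deps x' = some M ∧ M.Bounds (x' ∈ P'.fp) (x' ∈ P'.rep) m) ↔
      ∃ M, c.deps x' = some M ∧ M.Bounds (x' ∈ P.fp) (x' ∈ P.rep) m) :
    boundary F P' c' = boundary F P c := by
  rw [boundary_eq, boundary_eq]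
  congr 1
  ext m
  simp only [bounds, Set.mem_ofPred_eq, hb]
  refine or_congr_right (exists_congr fun x' => ?_)
  by_cases hx : x' ∈ innerIn F
  · simp [hx]
  · simpa [hx] using h x' hx m

/-- By readiness every contributed bound is at least 1 and drops by exactly 1. The minimum is
attained, so it drops by 1 as well. -/
theorem boundary_output {P : LocalP B} {c : Constraint ℕ B} (h : c.Ready) :
    0 < boundary F P c ∧ boundary F P c.output = boundary F P c - 1 := by
  have hmem : sInf (bounds F P c) ∈ bounds F P c := csInf_mem ⟨_, .inl rfl⟩
  have hpos : ∀ m ∈ bounds F P c, 1 ≤ m := by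
    rintro m (rfl | ⟨x', M, hM, hx, hm⟩)
    · exact Order.one_le_iff_pos.2 h.1
    · obtain ⟨n, rfl, hn⟩ := h.2 x' M hM
      rcases hm with ⟨_, rfl⟩ | ⟨_, _, rfl⟩
      · exact_mod_cast hn
      · exact le_add_left le_rfl
  have himg : bounds F P c.output = (fun m => m - 1) '' bounds F P c := by
    have cast : ∀ n : ℕ, 1 ≤ n → (((n - 1 : ℕ) : ℕ∞) + 1) = (n : ℕ∞) + 1 - 1 := by
      intro n hn
      norm_cast
      omega
    ext m
    constructor
    · rintro (rfl | ⟨x', M, hM, hx, hm⟩)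
      · exact ⟨c.bound, .inl rfl, rfl⟩
      · simp only [Constraint.output, Option.map_eq_some_iff] at hM
        obtain ⟨M, hM, rfl⟩ := hM
        obtain ⟨n, rfl, hn⟩ := h.2 x' M hM
        rcases hm with ⟨h1, rfl⟩ | ⟨h1, h2, rfl⟩
        · exact ⟨n, .inr ⟨x', _, hM, hx, .inl ⟨h1, rfl⟩⟩, by simp⟩
        · exact ⟨n + 1, .inr ⟨x', _, hM, hx, .inr ⟨h1, h2, rfl⟩⟩, (cast n hn).symm⟩
    · rintro ⟨m, rfl | ⟨x', M, hM, hx, hm⟩, rfl⟩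
      · exact .inl rfl
      · obtain ⟨n, rfl, hn⟩ := h.2 x' M hM
        refine .inr ⟨x', .per (n - 1), by simp [Constraint.output, hM, Dep.decr], hx, ?_⟩
        rcases hm with ⟨h1, rfl⟩ | ⟨h1, h2, rfl⟩
        · exact .inl ⟨h1, by simp⟩
        · exact .inr ⟨h1, h2, (cast n hn).symm⟩
  rw [boundary_eq, boundary_eq]
  refine ⟨lt_of_lt_of_le zero_lt_one (hpos _ hmem), ?_⟩
  rw [himg]
  refine IsLeast.csInf_eq ⟨⟨_, hmem, rfl⟩, ?_⟩
  rintro _ ⟨m, hm, rfl⟩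
  exact tsub_le_tsub_right (csInf_le' hm) 1

theorem Prioritised.congr {S S' : Port → Dep ℕ → Prop} {deps : Port → Option (Dep ℕ)}
    (h : Prioritised S deps) (hS : ∀ x M, S' x M ↔ S x M) : Prioritised S' deps := by
  have : S' = S := funext fun x => funext fun M => propext (hS x M)
  rwa [this]

/-- After the input nothing initial is collected for `z`, so there the priority of per each value
dependencies has nothing to decide. -/
theorem Prioritised.input {S S' : Port → Dep ℕ → Prop} {c : Constraint ℕ B} {z : Port}
    (h : Prioritised S c.deps) (hS : ∀ x M, x ≠ z → (S' x M ↔ S x M))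
    (hz : ∀ M, S' z M ↔ ∃ n, M = .per (n + 1) ∧ S z (.per n)) :
    Prioritised S' (c.input z).deps := by
  intro x
  by_cases hx : x = z
  · subst hx
    have h5 := h x
    simp only [hz, Constraint.input, if_true]
    refine ⟨fun n => ?_, ?_⟩
    · constructor
      · intro hn
        rcases hd : c.deps x with _ | (k | _)
        · simp [hd] at hn
        · simp only [hd, Option.bind_some, Dep.incr, Option.some.injEq] at hn
          exact ⟨k, hn.symm, (h5.1 k).1 hd⟩
        · simp [hd, Dep.incr] at hn
      · rintro ⟨k, hk, hc⟩
        rw [(h5.1 k).2 hc, hk]; rfl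
    · constructor
      · intro hn
        rcases hd : c.deps x with _ | (k | _) <;> simp [hd, Dep.incr] at hn
      · rintro ⟨⟨n, hn, _⟩, _⟩; cases hn
  · have h5 := h x
    simp only [Constraint.input, if_neg hx]
    refine ⟨fun n => (h5.1 n).trans (hS x _ hx).symm, h5.2.trans ?_⟩
    exact and_congr (hS x _ hx).symm (forall_congr' fun n => not_congr (hS x _ hx).symm)

theorem Prioritised.output {S S' : Port → Dep ℕ → Prop} {c : Constraint ℕ B}
    (h : Prioritised S c.deps) (hc : ∀ x M, c.deps x = some M → ∃ n, M = .per n)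
    (hz : ∀ x M, S' x M ↔ ∃ n, M = .per (n - 1) ∧ S x (.per n)) :
    Prioritised S' c.output.deps := by
  intro x
  have h5 := h x
  simp only [hz, Constraint.output, Option.map_eq_some_iff]
  refine ⟨fun n => ?_, ?_⟩
  · constructor
    · rintro ⟨M, hM, hn⟩
      obtain ⟨k, rfl⟩ := hc x M hM
      exact ⟨k, hn.symm, (h5.1 k).1 hM⟩
    · rintro ⟨k, hk, hc⟩
      exact ⟨_, (h5.1 k).2 hc, hk.symm⟩
  · constructor
    · rintro ⟨M, hM, hn⟩
      obtain ⟨k, rfl⟩ := hc x M hM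
      cases hn
    · rintro ⟨⟨n, hn, _⟩, _⟩; cases hn

/-- Made for internal steps, where the type of the interfacing component and its protocol change
together while the extracted type stays. -/
theorem InnerExtracts.congr {P P' : LocalP B} {T T' T₁ : CType ℕ B} (h : InnerExtracts F P T T₁)
    (f : Constraint ℕ B → Constraint ℕ B) (hi : T'.inputs = T.inputs)
    (hcon : ∀ z ∈ innerOut F, T'.con z = (T.con z).map f) (hty : ∀ c, (f c).ty = c.ty)
    (hb : ∀ z ∈ innerOut F, ∀ c, T.con z = some c → boundary F P' (f c) = boundary F P c)
    (hS : ∀ z ∈ innerOut F, ∀ x M, Collected F P' T' z x M ↔ Collected F P T z x M) :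
    InnerExtracts F P' T' T₁ := by
  refine ⟨fun x => by rw [hi]; exact h.inputs x, fun z hz => ?_, h.con_none⟩
  have h1 := h.con_out z hz
  have h2 := hb z hz
  rw [hcon z hz]
  generalize T.con z = o, T₁.con z = o₁ at h1 h2 ⊢
  cases h1 with
  | none => exact .none
  | some h1 =>
    refine .some ⟨?_, ?_, ?_⟩
    · rw [hty]; exact h1.1
    · rw [h2 _ rfl]; exact h1.2.1
    · intro x
      have h3 := h1.2.2 x
      refine ⟨fun n => (h3.1 n).trans (hS z hz x _).symm, h3.2.trans ?_⟩
      exact and_congr (hS z hz x _).symm (forall_congr' fun n => not_congr (hS z hz x _).symm)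

theorem collected_congr {P P' : LocalP B} {T T' : CType ℕ B} {z x : Port} {M : Dep ℕ}
    (h : x ∈ innerIn F → z ∈ innerOut F → T'.dep z x = T.dep z x ∧ ∀ x' y', z ≠ y' →
      ((∃ M' M₀, T'.dep z x' = some M' ∧ T'.dep y' x = some M₀ ∧ Yields P' y' x' M' M₀ M) ↔
        ∃ M' M₀, T.dep z x' = some M' ∧ T.dep y' x = some M₀ ∧ Yields P y' x' M' M₀ M)) :
    Collected F P' T' z x M ↔ Collected F P T z x M := by
  rw [collected_iff, collected_iff]
  refine and_congr_right fun hx => and_congr_right fun hz => ?_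
  obtain ⟨h1, h2⟩ := h hx hz
  rw [h1]
  refine or_congr_right (exists_congr fun x' => exists_congr fun y' => ?_)
  by_cases hy : z = y'
  · simp [hy]
  · simpa [hy] using h2 x' y' hy

theorem yields_congr {P P' : LocalP B} {y' x' : Port} {M' M₀ M : Dep ℕ}
    (h₁ : P'.Rel1 y' x' ↔ P.Rel1 y' x') (h₂ : P'.Rel2 y' x' ↔ P.Rel2 y' x')
    (h₃ : P'.Rel3 y' x' ↔ P.Rel3 y' x') (hv : P.Rel3 y' x' → P'.vf x' y' = P.vf x' y') :
    Yields P' y' x' M' M₀ M ↔ Yields P y' x' M' M₀ M := by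
  unfold Yields
  rw [h₁, h₂, h₃]
  refine or_congr_right (or_congr ?_ ?_)
  · refine and_congr_right fun _ => and_congr_right fun h => ?_
    rw [hv h]
  · refine and_congr_right fun h => ?_
    rw [hv h]

end

/-! ### Extraction under the steps of the interfacing component -/

section
variable {V : Type u} {B : Type v} {D : List DBinder} {r : Role} {F : List Fwd}
  {R : Tail V} {γ : Label → B} {A w d : List Ev} {τ : List (Act V)} {T T₁ : CType ℕ B}

theorem InjOn.mono {σ : Ev → Port} {l l' : List Ev} (h : InjOn σ l) (hl : l' ⊆ l) : InjOn σ l' :=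
  fun e he e' he' => h e (hl he) e' (hl he')

theorem pair_sublist_append {α : Type*} {a b : α} {l u : List α} (ha : a ∉ u) (hb : b ∉ u) :
    [a, b].Sublist (l ++ u) ↔ [a, b].Sublist l := by
  constructor
  · intro h
    obtain ⟨l₁, l₂, h1, h2, h3⟩ := List.sublist_append_iff.1 h
    have : l₂ = [] := by
      rw [List.eq_nil_iff_forall_not_mem]
      intro e he
      have : e ∈ [a, b] := by rw [h1]; exact List.mem_append_right _ he
      have hu := h3.subset he
      simp only [List.mem_cons, List.not_mem_nil, or_false] at this
      rcases this with rfl | rfl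
      · exact ha hu
      · exact hb hu
    rw [this, List.append_nil] at h1
    rw [h1]; exact h2
  · intro h
    exact h.trans (List.sublist_append_left _ _)

namespace Interface

theorem not_forwarded (h : Interface D r F A (view r R.body) w d τ T) {e : Ev}
    (he : e ∈ w ++ view r R.body) :
    portOf D r e ∉ innerIn F ∧ portOf D r e ∉ innerOut F :=
  (h.on_port he).not_forwarded h.apart

theorem fp_not_forwarded (h : Interface D r F A (view r R.body) w d τ T) {x : Port}
    (hx : x ∈ (localP D γ r R w).fp) : x ∉ innerIn F ∧ x ∉ innerOut F := by
  have : ∃ e ∈ w ++ view r R.body, portOf D r e = x := by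
    rcases mem_fp_iff.1 hx with hx | hx <;> obtain ⟨e, he, rfl⟩ := List.mem_map.1 hx
    · exact ⟨e, by simp [he], rfl⟩
    · exact ⟨e, by simp [he], rfl⟩
  obtain ⟨e, he, rfl⟩ := this
  exact h.not_forwarded he

/-- Both middle ports of a chain belong to the protocol, so a forwarded port never occurs in the
middle. -/
theorem yields_mem_fp {y' x' : Port} {M' M₀ M : Dep ℕ}
    (h : Yields (localP D γ r R w) y' x' M' M₀ M) :
    y' ∈ (localP D γ r R w).fp ∧ x' ∈ (localP D γ r R w).fp := by
  have h3 : (localP D γ r R w).Rel3 y' x' → y' ∈ (localP D γ r R w).fp ∧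
      x' ∈ (localP D γ r R w).fp := by
    intro h
    obtain ⟨l', l, rfl, rfl, hs⟩ := rel3_iff.1 h
    exact ⟨mem_fp_iff.2 (.inr (List.mem_map_of_mem (hs.subset (by simp)))),
      mem_fp_iff.2 (.inr (List.mem_map_of_mem (hs.subset (by simp))))⟩
  rcases h with ⟨_, h | h, _⟩ | ⟨_, h, _⟩ | ⟨h, _⟩
  · obtain ⟨⟨l', l, rfl, rfl, hs⟩, _⟩ := rel1_iff.1 h
    exact ⟨mem_fp_iff.2 (.inl (List.mem_map_of_mem (hs.subset (by simp)))),
      mem_fp_iff.2 (.inl (List.mem_map_of_mem (hs.subset (by simp))))⟩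
  · obtain ⟨⟨l', l, rfl, rfl, h, h'⟩, _⟩ := rel2_iff.1 h
    exact ⟨mem_fp_iff.2 (.inl (List.mem_map_of_mem h)),
      mem_fp_iff.2 (.inr (List.mem_map_of_mem h'))⟩
  · exact h3 h
  · exact h3 h

/-- Unfolding the recursion does not change the extracted type. -/
theorem extracts_unfold (h : Interface D r F A (view r R.body) w d τ T)
    (hT : InnerExtracts F (localP D γ r R w) T T₁) (k : ℕ) :
    InnerExtracts F (localP D γ r R (w ++ copies k (view r R.body))) T T₁ := by
  have hsub : (w ++ copies k (view r R.body)) ++ view r R.body ⊆ w ++ view r R.body := by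
    intro e he
    simp only [List.mem_append] at he ⊢
    rcases he with (he | he) | he
    · exact .inl he
    · exact .inr (mem_copies he)
    · exact .inr he
  refine hT.congr id rfl (by simp) (by simp) ?_ ?_
  · intro z _ c _
    refine boundary_congr rfl fun x' _ m => ?_
    have h1 : x' ∈ (localP D γ r R (w ++ copies k (view r R.body))).fp ↔
        x' ∈ (localP D γ r R w).fp := by
      rw [mem_fp_iff, mem_fp_iff]
      simp only [List.mem_map]
      constructor
      · rintro (⟨e, he, rfl⟩ | h)
        · rcases List.mem_append.1 he with he | he
          · exact .inl ⟨e, he, rfl⟩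
          · exact .inr ⟨e, mem_copies he, rfl⟩
        · exact .inr h
      · rintro (⟨e, he, rfl⟩ | h)
        · exact .inl ⟨e, List.mem_append_left _ he, rfl⟩
        · exact .inr h
    have h2 : (localP D γ r R (w ++ copies k (view r R.body))).rep = (localP D γ r R w).rep := by
      rw [rep_eq, rep_eq]
    rw [h1, h2]; rfl
  · intro z _ x M
    refine collected_congr fun _ _ => ⟨rfl, fun x' y' _ => ?_⟩
    refine exists_congr fun M' => exists_congr fun M₀ => and_congr_right fun _ =>
      and_congr_right fun _ => yields_congr ?_ ?_ ?_ ?_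
    · rw [rel1_iff, rel1_iff]
      refine and_congr_left fun hxy => exists_congr fun l' => exists_congr fun l => ?_
      refine and_congr_right ?_
      rintro rfl
      refine and_congr_right ?_
      rintro rfl
      -- Neither port of $\diamond_1$ is repetitive, so neither event occurs in the added copies.
      exact pair_sublist_append (fun h => hxy.2 (List.mem_map_of_mem (mem_copies h)))
        (fun h => hxy.1 (List.mem_map_of_mem (mem_copies h)))
    · rw [rel2_iff, rel2_iff]
      refine and_congr_left fun hy => exists_congr fun l' => exists_congr fun l => ?_
      refine and_congr_right ?_
      rintro rfl
      refine and_congr_right fun _ => and_congr_left fun _ => ?_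
      rw [List.mem_append]
      exact or_iff_left fun h => hy (List.mem_map_of_mem (mem_copies h))
    · rw [rel3_iff, rel3_iff]
    · intro h3
      obtain ⟨l', l, rfl, rfl, hs⟩ := rel3_iff.1 h3
      rw [vf_eq h.injOn hs, vf_eq (h.injOn.mono hsub) hs]
      classical exact if_congr (h.unrolled.flows_unfold hs k) rfl rfl

/-- An internal output does not change the extracted type. -/
theorem extracts_send {l : Label}
    (h : Interface D r F A (view r R.body) (.send l :: w) d τ T)
    (hT : InnerExtracts F (localP D γ r R (.send l :: w)) T T₁) {c : Constraint ℕ B}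
    (hc : T.con (portOf D r (.send l)) = some c) (hr : c.Ready) :
    InnerExtracts F (localP D γ r R w) (T.output (portOf D r (.send l))) T₁ := by
  have hl : Ev.send l ∈ Ev.send l :: w ++ view r R.body := by simp
  have hnf := h.not_forwarded hl
  have hne : ∀ z ∈ innerOut F, z ≠ portOf D r (.send l) := by
    rintro z hz rfl
    exact hnf.2 hz
  have hinj' : InjOn (portOf D r) (w ++ view r R.body) :=
    h.injOn.mono (by simp)
  have hport : ∀ l', Ev.send l' ∈ w ++ view r R.body →
      portOf D r (.send l') = portOf D r (.send l) → l' = l := by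
    intro l' hl' he
    have := h.injOn _ (List.mem_cons_of_mem _ hl') _ hl he
    cases this; rfl
  refine hT.congr id rfl ?_ (by simp) ?_ ?_
  · intro z hz
    simp [CType.output, hne z hz]
  · intro z hz c' hc'
    refine boundary_congr rfl fun x' _ m => exists_congr fun M => and_congr_right fun hM => ?_
    -- Dependencies are on input ports, which have no constraint; hence the output that leaves the
    -- protocol does not count for the boundary.
    have hx' : x' ≠ portOf D r (.send l) := by
      rintro rfl
      have := h.hist.disjoint _ (h.hist.deps _ _ _ _ hc' hM)
      exact h.send_con l hl this
    have h1 : x' ∈ (localP D γ r R w).fp ↔ x' ∈ (localP D γ r R (.send l :: w)).fp := by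
      rw [mem_fp_iff, mem_fp_iff]
      simp [hx']
    have h2 : (localP D γ r R w).rep = (localP D γ r R (.send l :: w)).rep := by
      rw [rep_eq, rep_eq]
    rw [h1, h2]
  · intro z hz x M
    refine collected_congr fun hx _ => ⟨?_, fun x' y' hy => ?_⟩
    · rw [CType.dep_output, if_neg (hne z hz)]
    · simp only [CType.dep_output, if_neg (hne z hz)]
      by_cases hy' : y' = portOf D r (.send l)
      · subst hy'
        simp only [if_true]
        have hdep : ∀ M₀, T.dep (portOf D r (.send l)) x = some M₀ → ∃ n, M₀ = .per n ∧ 1 ≤ n := by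
          intro M₀ hM₀
          obtain ⟨c', hc', hd⟩ := CType.dep_eq_some.1 hM₀
          rw [hc] at hc'
          cases hc'
          exact hr.2 _ _ hd
        -- An output outside the repetition is not pending once it is done. Before the step these
        -- relations may hold, but the number is then positive and they yield nothing.
        have hnr : ¬ ((localP D γ r R w).Rel1 (portOf D r (.send l)) x' ∨
            (localP D γ r R w).Rel2 (portOf D r (.send l)) x') := by
          have key : Ev.send l ∈ w → Ev.send l ∉ view r R.body → False := by
            intro h1 h2
            exact h.unrolled.step.not_mem_of_mem h1 h2 (by simp)
          rintro (h1 | h1)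
          · obtain ⟨⟨l', l₁, hl', _, hs⟩, _, hB⟩ := rel1_iff.1 h1
            have hm : Ev.send l' ∈ w := hs.subset (by simp)
            cases hport l' (List.mem_append_left _ hm) hl'.symm
            exact key hm fun h => hB (List.mem_map_of_mem h)
          · obtain ⟨⟨l', l₁, hl', _, hm, _⟩, hB⟩ := rel2_iff.1 h1
            cases hport l' (List.mem_append_left _ hm) hl'.symm
            exact key hm fun h => hB (List.mem_map_of_mem h)
        have h3 : (localP D γ r R w).Rel3 (portOf D r (.send l)) x' ↔
            (localP D γ r R (.send l :: w)).Rel3 (portOf D r (.send l)) x' := by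
          rw [rel3_iff, rel3_iff]
        -- The value starts to flow: the indicator rises from 0 to 1 and makes up for the value that
        -- the constraint of `y'` loses.
        have hvf : (localP D γ r R w).Rel3 (portOf D r (.send l)) x' →
            (localP D γ r R w).vf x' (portOf D r (.send l)) = 1 ∧
            (localP D γ r R (.send l :: w)).vf x' (portOf D r (.send l)) = 0 := by
          intro h3
          obtain ⟨l', l₁, hl', rfl, hs⟩ := rel3_iff.1 h3
          cases hport l' (List.mem_append_right _ (hs.subset (by simp))) hl'.symm
          rw [vf_eq hinj' hs, vf_eq h.injOn hs, if_pos (h.unrolled.flows_tail hs), if_neg]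
          · simp
          · rintro ⟨c, q, hq, hb, ha⟩
            cases c with
            | nil => simp at hq
            | cons e c =>
              simp only [List.cons_append, List.cons.injEq] at hq
              exact ha (by simp [hq.1])
        cases hM₀ : T.dep (portOf D r (.send l)) x with
        | none => simp
        | some M₀ =>
          obtain ⟨n, rfl, hn⟩ := hdep _ hM₀
          refine exists_congr fun M' => ?_
          simp only [Option.map_some, Dep.decr, Option.some.injEq, exists_and_left,
            exists_eq_left']
          refine and_congr_right fun _ => ?_
          unfold Yields
          rw [← h3]
          constructor
          · rintro (⟨_, h1, _⟩ | ⟨_, h1, h2 | ⟨_, _, h2⟩⟩ | ⟨h1, n', n₀, rfl, h2, rfl⟩)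
            · exact absurd h1 hnr
            · cases h2
            · rw [(hvf h1).1] at h2; cases h2
            · refine .inr (.inr ⟨h1, n', n, rfl, rfl, ?_⟩)
              rw [(hvf h1).1, (hvf h1).2]
              simp only [Dep.per.injEq] at h2 ⊢
              omega
          · rintro (⟨_, _, h1⟩ | ⟨_, h1, h2 | ⟨_, h2, _⟩⟩ | ⟨h1, n', n₀, rfl, h2, rfl⟩)
            · exact absurd ⟨n, rfl, hn⟩ h1
            · cases h2
            · simp only [Dep.per.injEq] at h2; omega
            · refine .inr (.inr ⟨h1, n', n - 1, rfl, rfl, ?_⟩)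
              rw [(hvf h1).1, (hvf h1).2]
              simp only [Dep.per.injEq] at h2 ⊢
              omega
      · simp only [if_neg hy']
        refine exists_congr fun M' => exists_congr fun M₀ => and_congr_right fun hM' =>
          and_congr_right fun _ => yields_congr ?_ ?_ ?_ ?_
        · rw [rel1_iff, rel1_iff]
          refine and_congr_left fun _ => exists_congr fun l' => exists_congr fun l₁ => ?_
          refine and_congr_right ?_
          rintro rfl
          refine and_congr_right fun _ => ?_
          constructor
          · exact fun h => h.cons _
          · intro hs
            cases hs with
            | cons _ hs => exact hs
            | cons_cons => exact absurd rfl hy'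
        · rw [rel2_iff, rel2_iff]
          refine and_congr_left fun _ => exists_congr fun l' => exists_congr fun l₁ => ?_
          refine and_congr_right ?_
          rintro rfl
          refine and_congr_right fun _ => and_congr_left fun _ => ?_
          rw [List.mem_cons]
          refine (or_iff_right ?_).symm
          rintro h
          exact hy' (by rw [h])
        · rw [rel3_iff, rel3_iff]
        · intro h3
          obtain ⟨l', l₁, rfl, rfl, hs⟩ := rel3_iff.1 h3
          rw [vf_eq hinj' hs, vf_eq h.injOn hs]
          have hll : Ev.send l' ≠ Ev.send l := fun h => hy' (by rw [h])
          have : Flows (Ev.send l') (Ev.recv l₁) w ↔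
              Flows (Ev.send l') (Ev.recv l₁) (.send l :: w) := by
            classical
            rw [flows_iff, flows_iff, List.filter_cons_of_neg]
            simpa using fun h => hll (by rw [h])
          classical exact if_congr this rfl rfl

/-- An internal input does not change the extracted type. -/
theorem extracts_recv {l : Label}
    (h : Interface D r F A (view r R.body) (.recv l :: w) d τ T)
    (hT : InnerExtracts F (localP D γ r R (.recv l :: w)) T T₁) :
    InnerExtracts F (localP D γ r R w) (T.input (portOf D r (.recv l))) T₁ := by
  have hl : Ev.recv l ∈ Ev.recv l :: w ++ view r R.body := by simp
  have hnf := h.not_forwarded hl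
  have hinj' : InjOn (portOf D r) (w ++ view r R.body) :=
    h.injOn.mono (by simp)
  have hport : ∀ l', Ev.recv l' ∈ w ++ view r R.body →
      portOf D r (.recv l') = portOf D r (.recv l) → l' = l := by
    intro l' hl' he
    have := h.injOn _ (List.mem_cons_of_mem _ hl') _ hl he
    cases this; rfl
  have hrep : (localP D γ r R w).rep = (localP D γ r R (.recv l :: w)).rep := by
    rw [rep_eq, rep_eq]
  refine hT.congr (Constraint.input (portOf D r (.recv l))) rfl (fun _ _ => rfl)
    (fun _ => rfl) ?_ ?_
  · intro z hz c' hc'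
    refine boundary_congr rfl fun x' _ m => ?_
    -- With `n` available values, a pending non-repetitive input contributes `n + 1`; once received
    -- it has left the protocol and contributes its new number `n + 1`. A repetitive input
    -- contributes nothing, before or after.
    by_cases hx' : x' = portOf D r (.recv l)
    · subst hx'
      have h1 : portOf D r (.recv l) ∈ (localP D γ r R (.recv l :: w)).fp := by
        rw [mem_fp_iff]; simp
      have h2 : portOf D r (.recv l) ∈ (localP D γ r R w).fp ↔
          portOf D r (.recv l) ∈ (localP D γ r R w).rep := by
        rw [mem_fp_iff, rep_eq]
        refine or_iff_right_of_imp fun hm => ?_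
        obtain ⟨e, he, heq⟩ := List.mem_map.1 hm
        have := h.injOn e (by simp [he]) _ hl heq
        subst this
        by_contra hB
        exact h.unrolled.step.not_mem_of_mem he (fun h => hB (List.mem_map_of_mem h)) (by simp)
      rw [h2, ← hrep]
      simp only [Constraint.input, if_true]
      by_cases h3 : portOf D r (.recv l) ∈ (localP D γ r R w).rep
      · rcases c'.deps (portOf D r (.recv l)) with _ | (n | _) <;>
          simp [h1, h3, Dep.incr, Dep.Bounds]
      · rcases c'.deps (portOf D r (.recv l)) with _ | (n | _) <;>
          simp [h1, h3, Dep.incr, Dep.Bounds]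
    · have h1 : x' ∈ (localP D γ r R w).fp ↔ x' ∈ (localP D γ r R (.recv l :: w)).fp := by
        rw [mem_fp_iff, mem_fp_iff]
        simp [hx']
      rw [h1, hrep]
      simp [Constraint.input, hx']
  · intro z hz x M
    refine collected_congr fun hx _ => ?_
    have hxl : x ≠ portOf D r (.recv l) := by
      rintro rfl
      exact hnf.1 hx
    refine ⟨?_, fun x' y' hy => ?_⟩
    · rw [CType.dep_input, if_neg hxl]
    · simp only [CType.dep_input, if_neg hxl]
      by_cases hx' : x' = portOf D r (.recv l)
      · subst hx'
        simp only [if_true]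
        -- With the input done, it cannot be pending again if it is non-repetitive, and no
        -- non-repetitive output can be pending if it is repetitive. In the word before the step it
        -- is the head, so no output precedes this occurrence.
        have hnr : ∀ u, u = w ∨ u = .recv l :: w →
            ¬ ((localP D γ r R u).Rel1 y' (portOf D r (.recv l)) ∨
              (localP D γ r R u).Rel2 y' (portOf D r (.recv l))) := by
          intro u hu
          have hsub : u ⊆ .recv l :: w := by rcases hu with rfl | rfl <;> simp
          have hsend : ∀ l', Ev.send l' ∈ u → Ev.send l' ∈ w := by
            intro l' hl'
            simpa using hsub hl'
          rintro (h1 | h1)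
          · obtain ⟨⟨l', l₁, rfl, hl₁, hs⟩, hB, _⟩ := rel1_iff.1 h1
            have : l₁ = l := by
              have hm : Ev.recv l₁ ∈ u := hs.subset (by simp)
              rcases List.mem_cons.1 (hsub hm) with h | h
              · cases h; rfl
              · exact hport _ (List.mem_append_left _ h) hl₁.symm
            subst this
            have hs' : [Ev.send l', Ev.recv l₁].Sublist w := by
              rcases hu with rfl | rfl
              · exact hs
              · cases hs with
                | cons _ hs => exact hs
            exact h.unrolled.step.not_mem_of_mem (e := .recv l₁) (hs'.subset (by simp))
              (fun h => hB (List.mem_map_of_mem h)) (by simp)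
          · obtain ⟨⟨l', l₁, rfl, hl₁, hm, hm'⟩, hB⟩ := rel2_iff.1 h1
            cases hport _ (List.mem_append_right _ hm') hl₁.symm
            exact h.unrolled.step.not_mem_of_pending (hsend _ hm)
              (fun h => hB (List.mem_map_of_mem h)) hm' (by simp)
        have h3 : (localP D γ r R w).Rel3 y' (portOf D r (.recv l)) ↔
            (localP D γ r R (.recv l :: w)).Rel3 y' (portOf D r (.recv l)) := by
          rw [rel3_iff, rel3_iff]
        -- The value arrives: the indicator falls from 1 to 0 while the number for `x'` in the
        -- constraint of `z` grows by one.
        have hvf : (localP D γ r R w).Rel3 y' (portOf D r (.recv l)) →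
            (localP D γ r R w).vf (portOf D r (.recv l)) y' = 0 ∧
            (localP D γ r R (.recv l :: w)).vf (portOf D r (.recv l)) y' = 1 := by
          intro h3
          obtain ⟨l', l₁, rfl, hl₁, hs⟩ := rel3_iff.1 h3
          cases hport _ (List.mem_append_right _ (hs.subset (by simp))) hl₁.symm
          rw [vf_eq hinj' hs, vf_eq h.injOn hs, if_neg (h.unrolled.not_flows_tail hs), if_pos]
          · simp
          · exact ⟨[], w, rfl, by simp, by simp⟩
        cases hM' : T.dep z (portOf D r (.recv l)) with
        | none => simp
        | some M' =>
          cases M' with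
          | initial =>
            simp only [Option.bind_some, Dep.incr, reduceCtorEq, false_and, exists_false,
              false_iff, Option.some.injEq]
            rintro ⟨_, M₀, rfl, hM₀, h1⟩
            -- The initial dependency that disappears has yielded nothing: a value was flowing, so
            -- `y'` has been output and has no initial dependency, and the indicator was not 0.
            rcases h1 with ⟨_, h1, _⟩ | ⟨_, h1, h2 | ⟨_, _, h2⟩⟩ | ⟨_, _, _, h2, _⟩
            · exact hnr _ (.inr rfl) h1
            · subst h2
              obtain ⟨c, hc, hd⟩ := CType.dep_eq_some.1 hM₀
              have ho := h.outIn_of_vf h1 (by rw [(hvf (h3.2 h1)).2]; simp)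
              obtain ⟨⟨n, hn⟩, _⟩ := h.hist.emitted _ _ _ _ hc hd ho
              cases hn
            · rw [(hvf (h3.2 h1)).2] at h2; cases h2
            · cases h2
          | per n =>
            simp only [Option.bind_some, Dep.incr, Option.some.injEq, exists_and_left,
              exists_eq_left']
            refine exists_congr fun M₀ => and_congr_right fun _ => ?_
            unfold Yields
            rw [← h3]
            refine or_congr ?_ (or_congr ?_ ?_)
            · constructor
              · rintro ⟨_, h1, _⟩; exact absurd h1 (hnr _ (.inl rfl))
              · rintro ⟨_, h1, _⟩; exact absurd h1 (hnr _ (.inr rfl))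
            · simp
            · refine and_congr_right fun h1 => ?_
              rw [(hvf h1).1, (hvf h1).2]
              constructor
              · rintro ⟨n', n₀, h4, rfl, rfl⟩
                refine ⟨n, n₀, rfl, rfl, ?_⟩
                simp only [Dep.per.injEq] at h4 ⊢
                omega
              · rintro ⟨n', n₀, h4, rfl, rfl⟩
                refine ⟨n + 1, n₀, rfl, rfl, ?_⟩
                simp only [Dep.per.injEq] at h4 ⊢
                omega
      · simp only [if_neg hx']
        refine exists_congr fun M' => exists_congr fun M₀ => and_congr_right fun hM' =>
          and_congr_right fun _ => yields_congr ?_ ?_ ?_ ?_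
        · rw [rel1_iff, rel1_iff]
          refine and_congr_left fun _ => exists_congr fun l' => exists_congr fun l₁ => ?_
          refine and_congr_right fun _ => and_congr_right fun _ => ?_
          constructor
          · exact fun h => h.cons _
          · intro hs
            cases hs with
            | cons _ hs => exact hs
        · rw [rel2_iff, rel2_iff]
          refine and_congr_left fun _ => exists_congr fun l' => exists_congr fun l₁ => ?_
          refine and_congr_right fun _ => and_congr_right fun _ => and_congr_left fun _ => ?_
          simp
        · rw [rel3_iff, rel3_iff]
        · intro h3
          obtain ⟨l', l₁, rfl, rfl, hs⟩ := rel3_iff.1 h3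
          rw [vf_eq hinj' hs, vf_eq h.injOn hs]
          have hll : Ev.recv l₁ ≠ Ev.recv l := fun h => hx' (by rw [h])
          have : Flows (Ev.send l') (Ev.recv l₁) w ↔
              Flows (Ev.send l') (Ev.recv l₁) (.recv l :: w) := by
            classical
            rw [flows_iff, flows_iff, List.filter_cons_of_neg]
            simpa using fun h => hll (by rw [h])
          classical exact if_congr this rfl rfl

/-- A forwarded input acts on the extracted type as on the type of the interfacing component. -/
theorem extracts_input (h : Interface D r F A (view r R.body) w d τ T)
    (hT : InnerExtracts F (localP D γ r R w) T T₁) {z : Port} (hz : z ∈ innerIn F) :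
    InnerExtracts F (localP D γ r R w) (T.input z) (T₁.input z) := by
  refine ⟨hT.inputs, fun y hy => ?_, fun y hy => ?_⟩
  · have hS : ∀ x M, x ≠ z → (Collected F (localP D γ r R w) (T.input z) y x M ↔
        Collected F (localP D γ r R w) T y x M) := by
      intro x M hx
      refine collected_congr fun _ _ => ⟨by rw [CType.dep_input, if_neg hx], fun x' y' _ => ?_⟩
      simp only [CType.dep_input, if_neg hx]
      by_cases hx' : x' = z
      · subst hx'
        constructor <;> rintro ⟨_, _, _, _, hY⟩ <;>
          exact absurd hz (h.fp_not_forwarded (yields_mem_fp hY).2).1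
      · simp only [if_neg hx']
    have hSz : ∀ M', Collected F (localP D γ r R w) (T.input z) y z M' ↔
        ∃ n, M' = .per (n + 1) ∧ Collected F (localP D γ r R w) T y z (.per n) := by
      intro M
      constructor
      · intro hc
        obtain ⟨_, _, hd | ⟨x', y', M', M₀, hy', hM', hM₀, hY⟩⟩ := collected_iff.1 hc
        · rw [CType.dep_input, if_pos rfl] at hd
          rcases hd' : T.dep y z with _ | (n | _)
          · simp [hd'] at hd
          · simp only [hd', Option.bind_some, Dep.incr, Option.some.injEq] at hd
            exact ⟨n, hd.symm, collected_iff.2 ⟨hz, hy, .inl hd'⟩⟩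
          · simp [hd', Dep.incr] at hd
        · have hx' : x' ≠ z := by
            rintro rfl
            exact (h.fp_not_forwarded (yields_mem_fp hY).2).1 hz
          rw [CType.dep_input, if_neg hx'] at hM'
          rw [CType.dep_input, if_pos rfl] at hM₀
          rcases hd' : T.dep y' z with _ | (n | _)
          · simp [hd'] at hM₀
          · simp only [hd', Option.bind_some, Dep.incr, Option.some.injEq] at hM₀
            subst hM₀
            -- The incremented number is positive, which excludes every chain with an initial
            -- result.
            rcases hY with ⟨_, _, h1⟩ | ⟨_, _, h1 | ⟨_, h1, _⟩⟩ | ⟨h1, n', n₀, rfl, h2, rfl⟩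
            · exact absurd ⟨n + 1, rfl, Nat.succ_pos n⟩ h1
            · cases h1
            · simp at h1
            · simp only [Dep.per.injEq] at h2
              subst h2
              refine ⟨n + n' + (localP D γ r R w).vf x' y', by congr 1; omega,
                collected_iff.2 ⟨hz, hy, .inr ⟨x', y', _, _, hy', hM', hd',
                  .inr (.inr ⟨h1, n', n, rfl, rfl, rfl⟩)⟩⟩⟩
          · simp [hd', Dep.incr] at hM₀
      · rintro ⟨n, rfl, hc⟩
        obtain ⟨_, _, hd | ⟨x', y', M', M₀, hy', hM', hM₀, hY⟩⟩ := collected_iff.1 hc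
        · exact collected_iff.2 ⟨hz, hy, .inl (by simp [CType.dep_input, hd, Dep.incr])⟩
        · have hx' : x' ≠ z := by
            rintro rfl
            exact (h.fp_not_forwarded (yields_mem_fp hY).2).1 hz
          rcases hY with ⟨h1, _⟩ | ⟨h1, _⟩ | ⟨h1, n', n₀, rfl, rfl, h2⟩
          · cases h1
          · cases h1
          · simp only [Dep.per.injEq] at h2
            subst h2
            refine collected_iff.2 ⟨hz, hy, .inr ⟨x', y', .per n', .per (n₀ + 1), hy',
              by rw [CType.dep_input, if_neg hx', hM'],
              by simp [CType.dep_input, hM₀, Dep.incr],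
              .inr (.inr ⟨h1, n', n₀ + 1, rfl, rfl, by congr 1; omega⟩)⟩⟩
    have h1 := hT.con_out y hy
    change Option.Rel _ ((T.con y).map (Constraint.input z)) ((T₁.con y).map (Constraint.input z))
    generalize T.con y = o, T₁.con y = o₁ at h1
    cases h1 with
    | none => exact .none
    | @some c c₁ h1 =>
      obtain ⟨h2, h3, h4⟩ := h1
      have h5 : Prioritised (Collected F (localP D γ r R w) T y) c₁.deps := h4
      have h6 : Prioritised (Collected F (localP D γ r R w) (T.input z) y) (c₁.input z).deps :=
        h5.input hS hSz
      have h7 : boundary F (localP D γ r R w) (c.input z) = boundary F (localP D γ r R w) c := by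
        refine boundary_congr rfl fun x' hx' m => ?_
        have : x' ≠ z := by rintro rfl; exact hx' hz
        simp [Constraint.input, this]
      exact .some ⟨h2, h3.trans h7.symm, h6⟩
  · simp [CType.input, hT.con_none y hy]

/-- A forwarded output acts on the extracted type as on the type of the interfacing component. -/
theorem extracts_output (h : Interface D r F A (view r R.body) w d τ T)
    (hT : InnerExtracts F (localP D γ r R w) T T₁) {z : Port} (hz : z ∈ innerOut F)
    {c : Constraint ℕ B} (hc : T.con z = some c) (hr : c.Ready) :
    (∃ c₁, T₁.con z = some c₁ ∧ c₁.ty = c.ty ∧ c₁.Ready) ∧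
      InnerExtracts F (localP D γ r R w) (T.output z) (T₁.output z) := by
  -- The numbers of a ready constraint are positive, and by the history positive numbers come from
  -- past inputs.
  have hdep : ∀ x' M', T.dep z x' = some M' → ∃ n, M' = .per n ∧ 1 ≤ n ∧ InpIn x' τ := by
    intro x' M' hM'
    obtain ⟨c', hc', hd⟩ := CType.dep_eq_some.1 hM'
    rw [hc] at hc'
    cases hc'
    obtain ⟨n, rfl, hn⟩ := hr.2 _ _ hd
    exact ⟨n, rfl, hn, h.hist.received _ _ _ _ hc hd (by omega)⟩
  -- The past input on `x'` excludes $\diamond_1$ and $\diamond_2$; under $\diamond_3$ the port `y'`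
  -- has been output and has no initial dependency. Only the chains that add up numbers remain.
  have hyield : ∀ x x' y' n' M₀ M, InpIn x' τ → T.dep y' x = some M₀ →
      Yields (localP D γ r R w) y' x' (.per n') M₀ M → (localP D γ r R w).Rel3 y' x' ∧
        ∃ n, M₀ = .per n ∧ M = .per (n + n' + (localP D γ r R w).vf x' y') := by
    intro x x' y' n' M₀ M hi hM₀ hY
    rcases hY with ⟨_, h1, _⟩ | ⟨_, h1, h2 | ⟨h2, _⟩⟩ | ⟨h1, n'', n, h2, rfl, rfl⟩
    · exact absurd hi (h.not_inpIn_of_rel h1)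
    · subst h2
      obtain ⟨c', hc', hd⟩ := CType.dep_eq_some.1 hM₀
      obtain ⟨⟨n, hn⟩, _⟩ := h.hist.emitted _ _ _ _ hc' hd (h.outIn_of_inpIn h1 hi)
      cases hn
    · cases h2
    · simp only [Dep.per.injEq] at h2
      subst h2
      exact ⟨h1, n, rfl, rfl⟩
  have hpos : ∀ x M, Collected F (localP D γ r R w) T z x M → ∃ n, M = .per n ∧ 1 ≤ n := by
    intro x M hM
    obtain ⟨_, _, hd | ⟨x', y', M', M₀, hy', hM', hM₀, hY⟩⟩ := collected_iff.1 hM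
    · obtain ⟨n, h1, h2, _⟩ := hdep _ _ hd
      exact ⟨n, h1, h2⟩
    · obtain ⟨n', rfl, hn', hi⟩ := hdep _ _ hM'
      obtain ⟨_, n, _, rfl⟩ := hyield _ _ _ _ _ _ hi hM₀ hY
      exact ⟨_, rfl, by omega⟩
  have hSz : ∀ x M', Collected F (localP D γ r R w) (T.output z) z x M' ↔
      ∃ n, M' = .per (n - 1) ∧ Collected F (localP D γ r R w) T z x (.per n) := by
    intro x M
    constructor
    · intro hM
      obtain ⟨hx, _, hd | ⟨x', y', M', M₀, hy', hM', hM₀, hY⟩⟩ := collected_iff.1 hM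
      · rw [CType.dep_output, if_pos rfl, Option.map_eq_some_iff] at hd
        obtain ⟨M, hd, rfl⟩ := hd
        obtain ⟨n, rfl, _⟩ := hdep _ _ hd
        exact ⟨n, rfl, collected_iff.2 ⟨hx, hz, .inl hd⟩⟩
      · rw [CType.dep_output, if_pos rfl, Option.map_eq_some_iff] at hM'
        rw [CType.dep_output, if_neg hy'.symm] at hM₀
        obtain ⟨M', hM', rfl⟩ := hM'
        obtain ⟨n', rfl, hn', hi⟩ := hdep _ _ hM'
        obtain ⟨h3, n, rfl, rfl⟩ := hyield _ _ _ _ _ _ hi hM₀ hY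
        refine ⟨n + n' + (localP D γ r R w).vf x' y', by congr 1; omega,
          collected_iff.2 ⟨hx, hz, .inr ⟨x', y', _, _, hy', hM', hM₀,
            .inr (.inr ⟨h3, n', n, rfl, rfl, rfl⟩)⟩⟩⟩
    · rintro ⟨k, rfl, hM⟩
      obtain ⟨hx, _, hd | ⟨x', y', M', M₀, hy', hM', hM₀, hY⟩⟩ := collected_iff.1 hM
      · exact collected_iff.2 ⟨hx, hz, .inl (by simp [CType.dep_output, hd, Dep.decr])⟩
      · obtain ⟨n', rfl, hn', hi⟩ := hdep _ _ hM'
        obtain ⟨h3, n, rfl, hk⟩ := hyield _ _ _ _ _ _ hi hM₀ hY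
        simp only [Dep.per.injEq] at hk
        subst hk
        refine collected_iff.2 ⟨hx, hz, .inr ⟨x', y', .per (n' - 1), .per n, hy',
          by simp [CType.dep_output, hM', Dep.decr],
          by rw [CType.dep_output, if_neg hy'.symm, hM₀],
          .inr (.inr ⟨h3, n' - 1, n, rfl, rfl, by congr 1; omega⟩)⟩⟩
  have hS : ∀ y, y ≠ z → ∀ x M, Collected F (localP D γ r R w) (T.output z) y x M ↔
      Collected F (localP D γ r R w) T y x M := by
    intro y hy x M
    refine collected_congr fun _ _ => ⟨by rw [CType.dep_output, if_neg hy], fun x' y' _ => ?_⟩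
    simp only [CType.dep_output, if_neg hy]
    by_cases hy' : y' = z
    · subst hy'
      constructor <;> rintro ⟨_, _, _, _, hY⟩ <;>
        exact absurd hz (h.fp_not_forwarded (yields_mem_fp hY).1).2
    · simp only [if_neg hy']
  have h1 := hT.con_out z hz
  rw [hc] at h1
  generalize hc₁ : T₁.con z = o₁ at h1
  cases h1 with
  | @some _ c₁ h1 =>
    obtain ⟨h2, h3, h4⟩ := h1
    have hb := boundary_output (F := F) (P := localP D γ r R w) hr
    have hd₁ : ∀ x M, c₁.deps x = some M → ∃ n, M = .per n ∧ 1 ≤ n :=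
      fun x M hM => hpos x M (hT.collected hc₁ hM)
    refine ⟨⟨c₁, rfl, h2, by rw [h3]; exact hb.1, hd₁⟩, hT.inputs, fun y hy => ?_, fun y hy => ?_⟩
    · by_cases hyz : y = z
      · subst hyz
        have e : (T.output y).con y = some c.output := by simp [CType.output, hc]
        have e₁ : (T₁.output y).con y = some c₁.output := by simp [CType.output, hc₁]
        rw [e, e₁]
        refine .some ⟨h2, ?_, Prioritised.output (S := Collected F (localP D γ r R w) T y)
          (S' := Collected F (localP D γ r R w) (T.output y) y) h4
          (fun x M hM => (hd₁ x M hM).imp fun _ h => h.1) hSz⟩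
        rw [hb.2, ← h3]; rfl
      · have e : (T.output z).con y = T.con y := by simp [CType.output, hyz]
        have e₁ : (T₁.output z).con y = T₁.con y := by simp [CType.output, hyz]
        have h5 := hT.con_out y hy
        rw [e, e₁]
        generalize T.con y = o, T₁.con y = o₁ at h5
        cases h5 with
        | none => exact .none
        | some h5 =>
          exact .some ⟨h5.1, h5.2.1,
            Prioritised.congr (S := Collected F (localP D γ r R w) T y)
              (S' := Collected F (localP D γ r R w) (T.output z) y) h5.2.2 (hS y hyz)⟩
    · have : y ≠ z := by rintro rfl; exact hy hz
      simp [CType.output, this, hT.con_none y hy]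

end Interface

/-! ### Renaming along forwarders -/

/-- `c₂` is `c₁` with its ports renamed. -/
def RenamesCon (F : List Fwd) (c₁ c₂ : Constraint ℕ B) : Prop :=
  c₂.ty = c₁.ty ∧ c₂.bound = c₁.bound ∧
    ∀ x M, c₂.deps x = some M ↔ ∃ w, Fwd.inp w x ∈ F ∧ c₁.deps w = some M

theorem RenamesCon.unique {c c₂ c₂' : Constraint ℕ B} (h : RenamesCon F c c₂)
    (h' : RenamesCon F c c₂') : c₂ = c₂' := by
  obtain ⟨t, b, d⟩ := c₂
  obtain ⟨t', b', d'⟩ := c₂'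
  obtain ⟨h1, h2, h3⟩ := h
  obtain ⟨h1', h2', h3'⟩ := h'
  simp only at h1 h2 h3 h1' h2' h3'
  rw [Constraint.mk.injEq]
  refine ⟨h1.trans h1'.symm, h2.trans h2'.symm, ?_⟩
  funext x
  exact Option.ext fun M => (h3 x M).trans (h3' x M).symm

/-- The outer ports are distinct, so each outer input has at most one inner port to copy the
dependency from. -/
theorem exists_renamesCon (hF : (F.map Fwd.outer).Nodup) (c : Constraint ℕ B) :
    ∃ c₂, RenamesCon F c c₂ := by
  classical
  refine ⟨⟨c.ty, c.bound, fun x => if h : ∃ w, Fwd.inp w x ∈ F then c.deps h.choose else none⟩,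
    rfl, rfl, fun x M => ?_⟩
  by_cases h : ∃ w, Fwd.inp w x ∈ F
  · simp only [dif_pos h]
    constructor
    · exact fun hM => ⟨_, h.choose_spec, hM⟩
    · rintro ⟨w, hw, hM⟩
      cases fwd_eq_of_outer hF hw h.choose_spec rfl
      exact hM
  · simp only [dif_neg h]
    constructor
    · intro h; cases h
    · rintro ⟨w, hw, _⟩; exact absurd ⟨w, hw⟩ h

theorem RenamesCon.deps_eq (hF : (F.map Fwd.outer).Nodup) {c c₂ : Constraint ℕ B}
    (h : RenamesCon F c c₂) {z x : Port} (hz : Fwd.inp z x ∈ F) : c₂.deps x = c.deps z := by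
  refine Option.ext fun M => (h.2.2 x M).trans ⟨?_, fun hM => ⟨z, hz, hM⟩⟩
  rintro ⟨w, hw, hM⟩
  cases fwd_eq_of_outer hF hw hz rfl
  exact hM

theorem RenamesCon.input (hi : (F.map Fwd.inner).Nodup) (ho : (F.map Fwd.outer).Nodup)
    {c c₂ : Constraint ℕ B} (h : RenamesCon F c c₂) {z x : Port} (hz : Fwd.inp z x ∈ F) :
    RenamesCon F (c.input z) (c₂.input x) := by
  refine ⟨h.1, h.2.1, fun x' M => ?_⟩
  simp only [Constraint.input]
  by_cases hx : x' = x
  · subst hx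
    rw [if_pos rfl, h.deps_eq ho hz]
    constructor
    · exact fun hM => ⟨z, hz, by rwa [if_pos rfl]⟩
    · rintro ⟨w, hw, hM⟩
      cases fwd_eq_of_outer ho hw hz rfl
      rwa [if_pos rfl] at hM
  · rw [if_neg hx, h.2.2]
    refine exists_congr fun w => and_congr_right fun hw => ?_
    rw [if_neg]
    rintro rfl
    cases fwd_eq_of_inner hi hw hz rfl
    exact hx rfl

theorem RenamesCon.output {c c₂ : Constraint ℕ B} (h : RenamesCon F c c₂) :
    RenamesCon F c.output c₂.output := by
  refine ⟨h.1, by simp [Constraint.output, h.2.1], fun x' M => ?_⟩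
  simp only [Constraint.output, Option.map_eq_some_iff, h.2.2]
  constructor
  · rintro ⟨M', ⟨w, hw, hM⟩, rfl⟩; exact ⟨w, hw, M', hM, rfl⟩
  · rintro ⟨w, hw, M', hM, rfl⟩; exact ⟨M', ⟨w, hw, hM⟩, rfl⟩

theorem RenamesCon.ready {c c₂ : Constraint ℕ B} (h : RenamesCon F c c₂) (hr : c.Ready) :
    c₂.Ready := by
  refine ⟨by rw [h.2.1]; exact hr.1, fun x M hM => ?_⟩
  obtain ⟨w, _, hM⟩ := (h.2.2 x M).1 hM
  exact hr.2 w M hM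

theorem renames_iff {T₁ T₂ : CType ℕ B} : Renames F T₁ T₂ ↔
    (∀ x b, T₂.inputs x = some b ↔ ∃ z, Fwd.inp z x ∈ F ∧ T₁.inputs z = some b) ∧
    ∀ y c₂, T₂.con y = some c₂ ↔ ∃ z c₁, Fwd.out y z ∈ F ∧ T₁.con z = some c₁ ∧
      RenamesCon F c₁ c₂ :=
  ⟨fun h => ⟨h.1, h.2⟩, fun h => ⟨h.1, h.2⟩⟩

theorem Renames.exists_con (ho : (F.map Fwd.outer).Nodup) {T₁ T₂ : CType ℕ B}
    (h : Renames F T₁ T₂) {y z : Port} {c₁ : Constraint ℕ B} (hz : Fwd.out y z ∈ F)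
    (hc : T₁.con z = some c₁) : ∃ c₂, T₂.con y = some c₂ ∧ RenamesCon F c₁ c₂ := by
  obtain ⟨c₂, hc₂⟩ := exists_renamesCon ho c₁
  exact ⟨c₂, ((renames_iff.1 h).2 y c₂).2 ⟨z, c₁, hz, hc, hc₂⟩, hc₂⟩

theorem Renames.input (hi : (F.map Fwd.inner).Nodup) (ho : (F.map Fwd.outer).Nodup)
    {T₁ T₂ : CType ℕ B} (h : Renames F T₁ T₂) {z x : Port} (hz : Fwd.inp z x ∈ F) :
    Renames F (T₁.input z) (T₂.input x) := by
  refine renames_iff.2 ⟨h.inputs, fun y c₂ => ?_⟩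
  simp only [CType.input, Option.map_eq_some_iff]
  constructor
  · rintro ⟨c, hc, rfl⟩
    obtain ⟨z', c₁, hz', hc₁, hr⟩ := ((renames_iff.1 h).2 y c).1 hc
    exact ⟨z', _, hz', ⟨c₁, hc₁, rfl⟩, RenamesCon.input hi ho hr hz⟩
  · rintro ⟨z', _, hz', ⟨c₁, hc₁, rfl⟩, hr⟩
    obtain ⟨c, hc, hr'⟩ := h.exists_con ho hz' hc₁
    exact ⟨c, hc, (hr'.input hi ho hz).unique hr⟩

theorem Renames.output (hi : (F.map Fwd.inner).Nodup) (ho : (F.map Fwd.outer).Nodup)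
    {T₁ T₂ : CType ℕ B} (h : Renames F T₁ T₂) {y z : Port} (hz : Fwd.out y z ∈ F) :
    Renames F (T₁.output z) (T₂.output y) := by
  refine renames_iff.2 ⟨h.inputs, fun y' c₂ => ?_⟩
  simp only [CType.output]
  by_cases hy : y' = y
  · subst hy
    rw [Function.update_self, Option.map_eq_some_iff]
    constructor
    · rintro ⟨c, hc, rfl⟩
      obtain ⟨z', c₁, hz', hc₁, hr⟩ := ((renames_iff.1 h).2 y' c).1 hc
      cases fwd_eq_of_outer ho hz hz' rfl
      exact ⟨z, c₁.output, hz, by simp [hc₁], RenamesCon.output hr⟩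
    · rintro ⟨z', c₁, hz', hc₁, hr⟩
      cases fwd_eq_of_outer ho hz hz' rfl
      rw [Function.update_self, Option.map_eq_some_iff] at hc₁
      obtain ⟨c₁, hc₁, rfl⟩ := hc₁
      obtain ⟨c, hc, hr'⟩ := h.exists_con ho hz hc₁
      exact ⟨c, hc, hr'.output.unique hr⟩
  · rw [Function.update_of_ne hy, (renames_iff.1 h).2 y' c₂]
    refine exists_congr fun z' => exists_congr fun c₁ => and_congr_right fun hz' => ?_
    rw [Function.update_of_ne]
    rintro rfl
    cases fwd_eq_of_inner hi hz hz' rfl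
    exact hy rfl

end

/-! ### Composite components and subject reduction -/

section
variable {V : Type u} {B : Type v} {ty : V → B} {D : List DBinder} {r : Role} {F : List Fwd}
  {R : Tail V} {γ : Label → B} {n : ℕ} {role : Fin n → Role} {sub : Fin n → Component ty}
  {xs ys : List Port}

theorem Interface.unfold {A w d : List Ev} {τ : List (Act V)} {T : CType ℕ B}
    (h : Interface D r F A (view r R.body) w d τ T) (m : ℕ) :
    Interface D r F A (view r R.body) (w ++ copies m (view r R.body)) d τ T := by
  have hsub : (w ++ copies m (view r R.body)) ++ view r R.body ⊆ w ++ view r R.body := by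
    intro e he
    simp only [List.mem_append] at he ⊢
    rcases he with (he | he) | he
    · exact .inl he
    · exact .inr (mem_copies he)
    · exact .inr he
  exact ⟨h.binders, h.apart, h.unrolled.unfold m, h.hist, fun e he => h.on e (hsub he), h.inp,
    h.send, fun l hl => h.send_con l (hsub hl), fun l hl => h.recv_inp l (hsub hl)⟩

theorem Component.Runtime.base {L : List (LocalBinder ty)}
    (h : (Component.base xs ys L).Runtime) : ys.Nodup ∧ QueuesSegmented L := by
  obtain ⟨K₀, t, h0, ht⟩ := h.exists_trace
  cases K₀ with
  | base xs₀ ys₀ L₀ =>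
    obtain ⟨L', hL', hH⟩ := ht.base h0
    cases hL'
    exact ⟨(List.nodup_append.1 h0.1).2.1, hH.segmented⟩
  | composite =>
    obtain ⟨A, R, rfl, hA⟩ := h0.exists_items
    obtain ⟨_, _, h, _⟩ := ht.composite h0.2.2.1 hA
    cases h

/-- The conventions on the names of a composite component, and the pasts of its subcomponents. -/
structure CompositeHistory (D : List DBinder) (r : Role) (F : List Fwd) (A : List (Item V))
    (R : Tail V) (t : List (Act V)) (I : List (Item V)) {n : ℕ} (role : Fin n → Role)
    (sub : Fin n → Component ty) : Prop where
  role_inj : Function.Injective role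
  binders : UniqueBinders D
  inner : (F.map Fwd.inner).Nodup
  outer : (F.map Fwd.outer).Nodup
  apart : BindersApart D r F
  role : ∀ i, ∃ K₀ τ d, K₀.Initial ∧ RoleHistory D r F A R t I (role i) K₀ (sub i) τ d

theorem Trace.runtime {K₀ K : Component ty} {t : List (Act V)} (h0 : K₀.Initial)
    (h : Trace K₀ t K) : K.Runtime := by
  refine ⟨K₀, h0, ?_⟩
  induction h with
  | nil => exact .refl
  | snoc _ hs ih => exact ih.tail ⟨_, hs⟩

theorem Component.Runtime.composite {G : Global V}
    (h : (Component.composite xs ys G n role sub D r F).Runtime) :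
    ∃ (A : List (Item V)) (R : Tail V) (t : List (Act V)) (I : List (Item V)),
      G = fillG I R.global ∧ CompositeHistory D r F A R t I role sub := by
  obtain ⟨K₀, t, h0, ht⟩ := h.exists_trace
  cases K₀ with
  | base xs₀ ys₀ L₀ =>
    obtain ⟨L', hL', _⟩ := ht.base h0
    cases hL'
  | composite _ _ G₀ _ _ sub₀ =>
    obtain ⟨A, R, rfl, hA⟩ := h0.exists_items
    obtain ⟨_, _, hrole, hD, hin, hout, hap, hsub⟩ := h0
    obtain ⟨sub', I, h, hH⟩ := ht.composite hrole hA
    cases h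
    refine ⟨A, R, t, I, rfl, hrole, hD, hin, hout, hap, fun i => ?_⟩
    obtain ⟨τ, d, h⟩ := hH i
    exact ⟨sub₀ i, τ, d, hsub i, h⟩

/-- The premises of the typing of a composite component, in terms of the events of its roles. -/
structure CompositeTyping (D : List DBinder) (r : Role) (F : List Fwd) (R : Tail V)
    (I : List (Item V)) {n : ℕ} (role : Fin n → Role) (sub : Fin n → Component ty)
    (γ : Label → B) (Ts : Fin n → CType ℕ B) (k : Fin n) (T T₁ : CType ℕ B) : Prop where
  interfacing : role k = r
  sub : ∀ i, HasType (sub i) (Ts i)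
  on : ∀ i, ∀ e ∈ view (role i) I ++ view (role i) R.body, ∃ x, e.On D (role i) x
  typed : ∀ j ∈ I ++ R.body, j.Typed ty γ
  closed : ∀ X, R ≠ .var X
  loops : ∀ i, Loops ((view (role i) I).map (Ev.act (portOf D (role i)) γ))
    ((view (role i) R.body).map (Ev.act (portOf D (role i)) γ))
    (modified (if role i = r then F else []) (Ts i))
  extracts : InnerExtracts F (localP D γ r R (view r I)) (Ts k) T₁
  renames : Renames F T₁ T

theorem CompositeTyping.hasType {I : List (Item V)} {Ts : Fin n → CType ℕ B} {k : Fin n}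
    {T T₁ : CType ℕ B} (hD : UniqueBinders D)
    (h : CompositeTyping D r F R I role sub γ Ts k T T₁) :
    HasType (.composite xs ys (fillG I R.global) n role sub D r F) T := by
  refine .composite _ _ _ _ _ _ _ _ _ γ Ts
    (fun i => localP D γ (role i) R (view (role i) I)) k T h.interfacing h.sub
    (fun i => (proj_iff hD _ _ _).2 ⟨h.on i, h.typed, rfl⟩) ⟨T₁, ?_, h.renames⟩
    (fun i => (conforms_iff _ _ _ _ _ _).2 ⟨h.closed, h.loops i⟩)
  rw [h.interfacing]
  exact h.extracts

/-- The local protocols of a typing are determined by the words of the roles, so its premises can be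
restated for these words. After a step they are checked in this form and turned back by
`CompositeTyping.hasType`. -/
theorem HasType.compositeTyping {I : List (Item V)} {T : CType ℕ B} (hD : UniqueBinders D)
    (h : HasType (.composite xs ys (fillG I R.global) n role sub D r F) T) :
    ∃ γ Ts k T₁, CompositeTyping D r F R I role sub γ Ts k T T₁ := by
  generalize hG : fillG I R.global = G at h
  cases h with
  | composite _ _ _ _ _ _ _ _ _ γ Ts Ps k _ hk hTs hPs hE hC =>
    subst hG
    obtain ⟨T₁, h1, h2⟩ := hE
    have hp := fun i => (proj_iff hD _ _ _).1 (hPs i)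
    have hc : ∀ i, _ := fun i => (conforms_iff (portOf D (role i)) γ (role i) (view (role i) I) R
      (modified (if role i = r then F else []) (Ts i))).1 ((hp i).2.2 ▸ hC i)
    refine ⟨γ, Ts, k, T₁, hk, hTs, fun i => (hp i).1, (hp k).2.1, (hc k).1, fun i => (hc i).2,
      ?_, h2⟩
    subst hk
    have := (hp k).2.2
    rw [this] at h1
    exact h1

variable {A I : List (Item V)} {t : List (Act V)} {Ts : Fin n → CType ℕ B} {k : Fin n}
  {T T₁ : CType ℕ B}

theorem CompositeTyping.interface (h : CompositeTyping D r F R I role sub γ Ts k T T₁)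
    (hH : CompositeHistory D r F A R t I role sub) :
    ∃ (τ : List (Act V)) (d : List Ev), Interface D r F (view r A) (view r R.body) (view r I) d τ (Ts k) := by
  obtain ⟨K₀, τ, d, h0, hR⟩ := hH.role k
  have hh := hR.trace.typeHistory h0 (h.sub k)
  have hl := h.loops k
  have ho := h.on k
  rw [h.interfacing] at hR hl ho
  rw [if_pos rfl] at hl
  exact ⟨τ, d, hR.interface hH.binders hH.apart hh ho hl⟩

theorem CompositeHistory.runtime (hH : CompositeHistory D r F A R t I role sub) (i : Fin n) :
    (sub i).Runtime := by
  obtain ⟨K₀, τ, d, h0, hR⟩ := hH.role i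
  exact hR.trace.runtime h0

theorem hasType_update {K' : Component ty} {T' : CType ℕ B} {i : Fin n}
    (h : ∀ j, HasType (sub j) (Ts j)) (hi : HasType K' T') (j : Fin n) :
    HasType (Function.update sub i K' j) (Function.update Ts i T' j) := by
  by_cases hj : j = i
  · subst hj; simpa using hi
  · simpa [hj] using h j

/-- A forwarded port does not occur in the protocol, so conformance survives by `Loops.other_out`;
the outer type follows by `Interface.extracts_output` and renaming. -/
theorem CompositeTyping.forward_out (h : CompositeTyping D r F R I role sub γ Ts k T T₁)
    (hH : CompositeHistory D r F A R t I role sub) {y z : Port} {b : B} {K' : Component ty}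
    {T' : CType ℕ B} (hF : Fwd.out y z ∈ F) (hs : CType.Step (Ts k) (.out z b) T')
    (hK' : HasType K' T') :
    ∃ T₁' T'', CType.Step T (.out y b) T'' ∧ CompositeTyping D r F R I role
      (Function.update sub k K') γ (Function.update Ts k T') k T'' T₁' := by
  obtain ⟨τ, d, hi⟩ := h.interface hH
  obtain ⟨c, hc, hb, hr, rfl⟩ := (CType.step_out_iff _ _ _ _).1 hs
  have hz : z ∈ innerOut F := mem_innerOut.2 ⟨y, hF⟩
  obtain ⟨⟨c₁, hc₁, hty, hr₁⟩, hE⟩ := hi.extracts_output h.extracts hz hc hr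
  obtain ⟨c₂, hc₂, hren⟩ := h.renames.exists_con hH.outer hF hc₁
  refine ⟨T₁.output z, T.output y, (CType.step_out_iff _ _ _ _).2
    ⟨c₂, hc₂, by rw [hren.1, hty, hb], hren.ready hr₁, rfl⟩, h.interfacing,
    hasType_update h.sub hK', h.on, h.typed, h.closed, fun i => ?_, ?_,
    h.renames.output hH.inner hH.outer hF⟩
  · by_cases hik : i = k
    · subst hik
      have hl := h.loops i
      simp only [Function.update_self]
      refine hl.other_out (modified_step _ hs) fun c hm => ?_
      rw [← List.map_append, h.interfacing] at hm
      obtain ⟨e, he, heq⟩ := List.mem_map.1 hm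
      have := (hi.not_forwarded he).2
      cases e with
      | send l =>
        simp only [Ev.act, Act.out.injEq] at heq
        exact this (heq.1 ▸ hz)
      | recv l => simp [Ev.act] at heq
    · simpa [hik] using h.loops i
  · simpa using hE

/-- The modified type of the interfacing component absorbs the input, so conformance is literally
unchanged. -/
theorem CompositeTyping.forward_inp (h : CompositeTyping D r F R I role sub γ Ts k T T₁)
    (hH : CompositeHistory D r F A R t I role sub) {x z : Port} {b : B} {K' : Component ty}
    {T' : CType ℕ B} (hF : Fwd.inp z x ∈ F) (hs : CType.Step (Ts k) (.inp z b) T')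
    (hK' : HasType K' T') :
    ∃ T₁' T'', CType.Step T (.inp x b) T'' ∧ CompositeTyping D r F R I role
      (Function.update sub k K') γ (Function.update Ts k T') k T'' T₁' := by
  obtain ⟨τ, d, hi⟩ := h.interface hH
  obtain ⟨hb, rfl⟩ := (CType.step_inp_iff _ _ _ _).1 hs
  have hz : z ∈ innerIn F := mem_innerIn.2 ⟨x, hF⟩
  refine ⟨T₁.input z, T.input x, (CType.step_inp_iff _ _ _ _).2 ⟨?_, rfl⟩, h.interfacing,
    hasType_update h.sub hK', h.on, h.typed, h.closed, fun i => ?_, ?_,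
    h.renames.input hH.inner hH.outer hF⟩
  · exact (h.renames.inputs x b).2 ⟨z, hF, by rw [h.extracts.inputs, if_pos hz, hb]⟩
  · by_cases hik : i = k
    · subst hik
      have hl := h.loops i
      rw [if_pos h.interfacing] at hl ⊢
      simpa [modified_input_of_mem hz] using hl
    · simpa [hik] using h.loops i
  · simpa using hi.extracts_input h.extracts hz

theorem CompositeTyping.internal (h : CompositeTyping D r F R I role sub γ Ts k T T₁)
    {i : Fin n} {K' : Component ty} (hK' : HasType K' (Ts i)) :
    CompositeTyping D r F R I role (Function.update sub i K') γ Ts k T T₁ :=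
  ⟨h.interfacing, fun j => by simpa using hasType_update (i := i) h.sub hK' j, h.on, h.typed,
    h.closed, h.loops, h.extracts, h.renames⟩

/-- An internal communication of the subcomponent `i`. -/
theorem CompositeTyping.comm (h : CompositeTyping D r F R I role sub γ Ts k T T₁)
    (hH : CompositeHistory D r F A R t I role sub) {i : Fin n} {K' : Component ty} {m : ℕ}
    {g : GAct V} {I' : List (Item V)} (hI : ItemStep (I ++ copies m R.body) g I')
    (hg : g.subj = role i) (htyped : ∀ p l v, g = .snd p l v → ty v = γ l) {T' : CType ℕ B}
    (hs : CType.Step (Ts i) (g.ev.act (portOf D (role i)) γ) T') (hK' : HasType K' T') :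
    CompositeTyping D r F R I' role (Function.update sub i K') γ (Function.update Ts i T') k
      T T₁ := by
  have hview : ∀ j, view (role j) I ++ copies m (view (role j) R.body) =
      (if role j = role i then [g.ev] else []) ++ view (role j) I' := by
    intro j
    rw [← view_copies, ← view_append, hI.view_eq, hg]
  have hon : ∀ j, ∀ e ∈ view (role j) I', e ∈ view (role j) I ++ view (role j) R.body := by
    intro j e he
    have : e ∈ view (role j) I ++ copies m (view (role j) R.body) := by
      rw [hview]; exact List.mem_append_right _ he
    rcases List.mem_append.1 this with h | h
    · exact List.mem_append_left _ h
    · exact List.mem_append_right _ (mem_copies h)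
  refine ⟨h.interfacing, hasType_update h.sub hK', fun j e he => h.on j e ?_, fun j hj => ?_,
    h.closed, fun j => ?_, ?_, h.renames⟩
  · rcases List.mem_append.1 he with he | he
    · exact hon j e he
    · exact List.mem_append_right _ he
  · rcases List.mem_append.1 hj with hj | hj
    · refine hI.typed (fun j hj => h.typed j ?_) htyped j hj
      rcases List.mem_append.1 hj with h | h
      · exact List.mem_append_left _ h
      · exact List.mem_append_right _ (mem_copies h)
    · exact h.typed j (List.mem_append_right _ hj)
  · have hl := (h.loops j).unfold m
    have hmap : (view (role j) I).map (Ev.act (portOf D (role j)) γ) ++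
        copies m ((view (role j) R.body).map (Ev.act (portOf D (role j)) γ)) =
        (view (role j) I ++ copies m (view (role j) R.body)).map
          (Ev.act (portOf D (role j)) γ) := by
      rw [List.map_append]
      congr 1
      simp [copies]
    rw [hmap, hview] at hl
    by_cases hj : j = i
    · subst hj
      rw [if_pos rfl, List.singleton_append, List.map_cons] at hl
      simp only [Function.update_self]
      exact hl.step (modified_step _ hs)
    · rw [if_neg fun h => hj (hH.role_inj h), List.nil_append] at hl
      simpa [hj] using hl
  · obtain ⟨τ, d, hi⟩ := h.interface hH
    have hE := hi.extracts_unfold h.extracts m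
    have hi' := hi.unfold m
    have hv := hview k
    rw [h.interfacing] at hv
    rw [hv] at hE hi'
    by_cases hik : k = i
    · subst hik
      rw [h.interfacing] at hE hi' hs
      rw [if_pos rfl, List.singleton_append] at hE hi'
      simp only [Function.update_self]
      rcases he : g.ev with l | l
      · rw [he] at hE hi' hs
        obtain ⟨c, hc, _, hr, rfl⟩ := (CType.step_out_iff _ _ _ _).1 hs
        exact hi'.extracts_send hE hc hr
      · rw [he] at hE hi' hs
        obtain ⟨_, rfl⟩ := (CType.step_inp_iff _ _ _ _).1 hs
        exact hi'.extracts_recv hE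
    · have : r ≠ role i := by
        rw [← h.interfacing]
        exact fun h => hik (hH.role_inj h)
      rw [if_neg this, List.nil_append] at hE
      simpa [hik] using hE

/-- The first event of a role, after some unfolding, has the type of its label. -/
theorem CompositeTyping.head (h : CompositeTyping D r F R I role sub γ Ts k T T₁) {i : Fin n}
    {m : ℕ} {g : GAct V} {I' : List (Item V)} (hI : ItemStep (I ++ copies m R.body) g I')
    (hg : g.subj = role i) : ∃ S, CType.Step (modified (if role i = r then F else []) (Ts i))
      (g.ev.act (portOf D (role i)) γ) S := by
  obtain ⟨S₁, S₂, h1, h2, _⟩ := (h.loops i).unfold m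
  have hmap : (view (role i) I).map (Ev.act (portOf D (role i)) γ) ++
      copies m ((view (role i) R.body).map (Ev.act (portOf D (role i)) γ)) =
      (view (role i) (I ++ copies m R.body)).map (Ev.act (portOf D (role i)) γ) := by
    rw [view_append, List.map_append, view_copies]
    congr 1
    simp [copies]
  rw [hmap, hI.view_eq, if_pos hg.symm, List.singleton_append, List.map_cons] at h1
  obtain ⟨S, hS, _⟩ := h1
  exact ⟨S, hS⟩

/-- Induction on the step, so that the subcomponent that acts can be treated first; being reachable
and typed are inherited by it. Its assumption on input values comes from the outer one for forwarded
inputs, and from the type of the message for receptions. -/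
theorem subject_reduction {K K' : Component ty} {a : Act V} (hstep : Component.Step K a K')
    {T : CType ℕ B} (hK : K.Runtime) (hT : HasType K T)
    (hv : ∀ x v, a = .inp x v → ∀ b, T.inputs x = some b → ty v = b) :
    ∃ T' : CType ℕ B, CType.Step T (a.map ty) T' ∧ HasType K' T' := by
  induction hstep generalizing T with
  | outBase xs ys L L' y v hs hy =>
    cases hT with
    | base _ _ _ _ hT =>
      obtain ⟨T', h1, h2⟩ := base_step hK.base.1 hK.base.2 hT hs (by simp) hv
      exact ⟨T', h1, .base _ _ _ _ h2⟩
  | inpBase xs ys L L' x v hs hx =>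
    cases hT with
    | base _ _ _ _ hT =>
      obtain ⟨T', h1, h2⟩ := base_step hK.base.1 hK.base.2 hT hs (by
        rintro x' v' h
        simp only [Act.inp.injEq] at h
        exact h.1 ▸ hx) hv
      exact ⟨T', h1, .base _ _ _ _ h2⟩
  | outComp xs ys G n role sub D r F i K' y z v hr hs hF hy ih =>
    obtain ⟨A, R, t, I, rfl, hH⟩ := hK.composite
    obtain ⟨γ, Ts, k, T₁, hC⟩ := hT.compositeTyping hH.binders
    -- Roles are distinct, so the acting subcomponent is the one from which the type was extracted.
    cases hH.role_inj (hr.trans hC.interfacing.symm)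
    obtain ⟨T', h1, h2⟩ := ih (hH.runtime i) (hC.sub i) (by simp)
    obtain ⟨T₁', T'', h3, h4⟩ := hC.forward_out hH hF h1 h2
    exact ⟨T'', h3, h4.hasType hH.binders⟩
  | inpComp xs ys G n role sub D r F i K' x z v hr hs hF hx ih =>
    obtain ⟨A, R, t, I, rfl, hH⟩ := hK.composite
    obtain ⟨γ, Ts, k, T₁, hC⟩ := hT.compositeTyping hH.binders
    cases hH.role_inj (hr.trans hC.interfacing.symm)
    obtain ⟨T', h1, h2⟩ := ih (hH.runtime i) (hC.sub i) (by
      rintro x' v' h b hb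
      simp only [Act.inp.injEq] at h
      obtain ⟨rfl, rfl⟩ := h
      refine hv x v rfl b ((hC.renames.inputs x b).2 ⟨z, hF, ?_⟩)
      rw [hC.extracts.inputs, if_pos (mem_innerIn.2 ⟨x, hF⟩), hb])
    obtain ⟨T₁', T'', h3, h4⟩ := hC.forward_inp hH hF h1 h2
    exact ⟨T'', h3, h4.hasType hH.binders⟩
  | internal xs ys G n role sub D r F i K' hs ih =>
    obtain ⟨A, R, t, I, rfl, hH⟩ := hK.composite
    obtain ⟨γ, Ts, k, T₁, hC⟩ := hT.compositeTyping hH.binders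
    obtain ⟨T', h1, h2⟩ := ih (hH.runtime i) (hC.sub i) (by simp)
    rw [Act.map, CType.step_tau_iff] at h1
    subst h1
    exact ⟨T, .tau _, (hC.internal h2).hasType hH.binders⟩
  | outChor xs ys G G' n role sub D r F i K' y l v hs hD hG ih =>
    obtain ⟨A, R, t, I, rfl, hH⟩ := hK.composite
    obtain ⟨γ, Ts, k, T₁, hC⟩ := hT.compositeTyping hH.binders
    obtain ⟨m, I', rfl, hI⟩ := hG.items R I rfl
    obtain ⟨T', h1, h2⟩ := ih (hH.runtime i) (hC.sub i) (by simp)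
    obtain ⟨S, hS⟩ := hC.head hI rfl
    have hport := Ev.On.port_eq hH.binders (e := .send l) hD
    simp only [GAct.ev, Ev.act, hport] at hS
    -- The step of the subcomponent and the one required by conformance read off the type of the
    -- same constraint, so the emitted value has the type of its label.
    have hty : ty v = γ l := by
      have h3 := modified_step (if role i = r then F else []) h1
      rw [Act.map, CType.step_out_iff] at h3
      rw [CType.step_out_iff] at hS
      obtain ⟨c, hc, hb, _⟩ := h3
      obtain ⟨c', hc', hb', _⟩ := hS
      rw [hc] at hc'
      cases hc'
      exact hb.symm.trans hb'
    refine ⟨T, .tau _, (hC.comm hH hI rfl ?_ (T' := T') ?_ h2).hasType hH.binders⟩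
    · intro p l' v' h
      cases h
      exact hty
    · rw [GAct.ev, Ev.act, hport, ← hty]
      exact h1
  | inpChor xs ys G G' n role sub D r F i K' x l v hs hD hG ih =>
    obtain ⟨A, R, t, I, rfl, hH⟩ := hK.composite
    obtain ⟨γ, Ts, k, T₁, hC⟩ := hT.compositeTyping hH.binders
    obtain ⟨m, I', rfl, hI⟩ := hG.items R I rfl
    have hport := Ev.On.port_eq hH.binders (e := .recv l) hD
    -- The value was in transit, and projection demands that such a value has the type of its label.
    have hty : ty v = γ l := by
      refine hI.rcv_typed fun j hj => hC.typed j ?_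
      rcases List.mem_append.1 hj with h | h
      · exact List.mem_append_left _ h
      · exact List.mem_append_right _ (mem_copies h)
    obtain ⟨S, hS⟩ := hC.head hI rfl
    simp only [GAct.ev, Ev.act, hport] at hS
    obtain ⟨T', h1, h2⟩ := ih (hH.runtime i) (hC.sub i) (by
      rintro x' v' h b hb
      simp only [Act.inp.injEq] at h
      obtain ⟨rfl, rfl⟩ := h
      have h3 := ((CType.step_inp_iff _ _ _ _).1 hS).1
      rw [modified_inputs, hb] at h3
      cases h3
      exact hty)
    refine ⟨T, .tau _, (hC.comm hH hI rfl (by simp) (T' := T') ?_ h2).hasType hH.binders⟩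
    rw [GAct.ev, Ev.act, hport, ← hty]
    exact h1

end
end GC

theorem theorem4p1 {V : Type*} {B : Type*} (ty : V → B) (K K' : GC.Component ty)
    (T : GC.CType ℕ B) (a : GC.Act V)
    (hK : K.Runtime) (hT : GC.HasType K T) (hstep : GC.Component.Step K a K')
    (hv : ∀ x v, a = .inp x v → ∀ b, T.inputs x = some b → ty v = b) :
    ∃ T' : GC.CType ℕ B, GC.CType.Step T (a.map ty) T' ∧ GC.HasType K' T' :=
  GC.subject_reduction hstep hK hT hv
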